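/- **Trees.** Fix $d\ge 0$, a set of kernels $K$ with regularities $\beta_k\in\mathbb R$ and a set of noises $\Xi$ with path regularities $\alpha_\xi\in\mathbb R$. $\mathfrak T$ is spanned by the planar rooted trees whose vertices $v$ carry a decoration $n_v\in\mathbb N^d$ and whose edges carry a type in $K\cup\Xi$ (kernel or noise edge) and a decoration in $\mathbb N^d$, such that every vertex has at most one outgoing noise edge and a noise vertex (the upper end of a noise edge) has no outgoing edges. For a multi-index $|n|=\sum_i n_i$, $n!=\prod_i n_i!$. The regularity $|\tau|$ is the sum of $|n_v|$ over all vertices, of $\beta_k-|e|$ over all kernel edges of type $k$ and decoration $e$, and of $\alpha_\xi-1-|e|$ over all noise edges. $\mathfrak T^-$ is spanned by the trees with $|\tau|<0$, and $S(\mathfrak T^-)$ is the free commutative algebra on $\mathfrak T^-$. $\mathfrak T_{ex}$ is spanned by trees as above whose vertices carry in addition an extended decoration in $\mathbb R$ (in particular in the set of regularities); $|\tau|_+$ is the regularity plus the sum of all extended decorations. $\mathfrak T^+_{ex}$ is spanned by the trees in $\mathfrak T_{ex}$ without a noise edge at the root that have $|\tau|_+>0$ or are the single vertex with zero decorations. Coefficients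 are in an arbitrary commutative ring. **Recentering.** A left admissible cut $c$ of $\tau$ is a set of kernel edges that contains at most one edge of each path from the root to a leaf and contains, with an edge, all edges to its left with the same lower vertex. Its trunk $T$ is the part connected to the root; write $c_v$ for the edges of $c$ outgoing from a vertex $v$ of $T$. For multi-indices $a_v\le n_v$ ($v$ a non-noise vertex of $T$) and $\ell_e$ ($e\in c$) let $T_{a,\ell}$ be $T$ with decorations $N_v=n_v-a_v+\sum_{e\in c_v}\ell_e$ at the non-noise vertices. Let $P_{a,\ell}$ be the sum of the trees obtained by grafting the cut branches, with the decorations of the edges $e\in c$ increased by $\ell_e$, onto a new root with decoration $\sum_v a_v$ and extended decoration $0$, over all shuffles (edges cut from the same vertex keep their order). All vertices other than the new root keep their extended decorations. With $\pi_+$ the projection onto $\mathfrak T^+_{ex}$, $$\Delta^+_{ex}\tau=\sum_{c,a,\ell}\frac{(\sum_v a_v)!}{\prod_v a_v!}\prod_v\frac{N_v!}{(n_v-a_v)!\prod_{e\in c_v}\ell_e!}\;\pi_+(P_{a,\ell})\otimes T_{a,\ell},\qquad \Delta^+_{ex}:\mathfrak T_{ex}\to\mathfrak T^+_{ex}\otimes\mathfrak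 T_{ex}.$$ **Renormalisation.** Consider the finite sets $\{\sigma_1,\dots,\sigma_m\}$ ($m\ge0$) of pairwise disjoint subtrees of $\tau$ such that: if an edge is in $\sigma_i$, so are all edges to its right with the same lower vertex; and for each noise edge either it and both its ends belong to the same $\sigma_i$, or neither end belongs to any $\sigma_j$. For each $\sigma=\sigma_i$, sum over all $a_v\le n_v$ ($v$ a non-noise vertex of $\sigma$) and $\ell_e$ ($e$ an edge outgoing from $\sigma$ and not in it). Change the decorations of the non-noise vertices of $\sigma$ to $N_v=n_v-a_v+\sum_{e\text{ at }v}\ell_e$, increase the decorations of the outgoing edges by $\ell_e$, contract $\sigma$ to one vertex with decoration $\sum_v a_v$ and extended decoration the $|\cdot|_+$-degree of the changed $\sigma$, and sum over all shuffles of the outgoing edges (edges from the same vertex keep their order), with coefficient $\frac{(\sum_v a_v)!}{\prod_v a_v!}\prod_v\frac{N_v!}{(n_v-a_v)!\prod_{e}\ell_e!}$. Then $$\Delta^-_{ex}:\mathfrak T_{ex}\to S(\mathfrak T^-)\otimes\mathfrak T_{ex}$$ maps $\tau$ to the sum of the resulting terms (product of the changed $\sigma_i$) $\otimes$ (contracted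 tree), where extended decorations are forgotten in the left factor and a term is $0$ if a changed $\sigma_i$ does not have negative regularity. $\Delta^-_{ex\text{-}non\text{-}root}:\mathfrak T^+_{ex}\to S(\mathfrak T^-)\otimes\mathfrak T^+_{ex}$ is defined in the same way, using only sets in which no $\sigma_i$ contains the root. **Proposition.** With $m^{1,3}(x\otimes y\otimes z\otimes w)=xz\otimes y\otimes w$, $$(\mathrm{Id}\otimes\Delta^+_{ex})\,\Delta^-_{ex}=m^{1,3}\,(\Delta^-_{ex\text{-}non\text{-}root}\otimes\Delta^-_{ex})\,\Delta^+_{ex}$$ as maps $\mathfrak T_{ex}\to S(\mathfrak T^-)\otimes\mathfrak T^+_{ex}\otimes\mathfrak T_{ex}$. -/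

import Mathlib

open scoped TensorProduct

namespace PlanarRS

/-! ## Decorated planar trees -/

/-- Multi-indices in `ℕ^d`. -/
abbrev MIdx (d : ℕ) : Type := Fin d → ℕ

/-- `|n| = n₁ + ⋯ + n_d`. -/
def MIdx.size {d : ℕ} (n : MIdx d) : ℕ := ∑ i, n i

/-- The multi-index binomial coefficient `∏ i, (n i choose k i)`. -/
def mchoose {d : ℕ} (n k : MIdx d) : ℕ := ∏ i, (n i).choose (k i)

/-- `Branches d K Ξ O b` is the planar list, from left to right, of everything that grows out of one
vertex. `K` is the set of convolution kernels, `Ξ` the set of noises. Every edge carries a type in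
`K` or `Ξ` and a decoration in `ℕ^d`; every vertex carries a decoration in `ℕ^d` and a second
decoration in `O`. Two rules are built in: a vertex has at most one outgoing noise edge, and a noise
vertex (the upper end of a noise edge) has no outgoing edges. The index `b` says whether a noise
edge may still occur: there is none in `Branches d K Ξ O false`, and at most one, at an arbitrary
place, in `Branches d K Ξ O true`.

* `kernel k e n o above rest`: the leftmost edge is a kernel edge of type `(k, e)` to a vertex
  decorated by `(n, o)` with outgoing branches `above`; the edges to its right are `rest`.
* `noise ξ e n o rest`: the leftmost edge is a noise edge of type `(ξ, e)` to a noise vertex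
  decorated by `(n, o)`; the edges to its right are `rest`. -/
inductive Branches (d : ℕ) (K Ξ O : Type) : Bool → Type
  | nil {b : Bool} : Branches d K Ξ O b
  | kernel {b : Bool} (k : K) (e : MIdx d) (n : MIdx d) (o : O)
      (above : Branches d K Ξ O true) (rest : Branches d K Ξ O b) : Branches d K Ξ O b
  | noise (ξ : Ξ) (e : MIdx d) (n : MIdx d) (o : O)
      (rest : Branches d K Ξ O false) : Branches d K Ξ O true

/-- A planar tree: the two decorations of the root and the branches at the root. All trees are of
the form `PTree d K Ξ O true`; those in `PTree d K Ξ O false` have no noise edge at the root. -/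
structure PTree (d : ℕ) (K Ξ O : Type) (b : Bool) : Type where
  dec : MIdx d
  exdec : O
  br : Branches d K Ξ O b

/-- A kernel edge of type `(k, e)` together with the tree on top of it. -/
structure Limb (d : ℕ) (K Ξ O : Type) : Type where
  k : K
  e : MIdx d
  tree : PTree d K Ξ O true

variable {d : ℕ} {K Ξ O : Type}

/-- The planar list of branches with the given limbs, from left to right. -/
def ofLimbs {b : Bool} : List (Limb d K Ξ O) → Branches d K Ξ O b
  | [] => .nil
  | x :: l => .kernel x.k x.e x.tree.dec x.tree.exdec x.tree.br (ofLimbs l)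

/-- Forget the second vertex decoration. -/
def Branches.forget : {b : Bool} → Branches d K Ξ O b → Branches d K Ξ Unit b
  | _, .nil => .nil
  | _, .kernel k e n _ above rest => .kernel k e n () above.forget rest.forget
  | _, .noise ξ e n _ rest => .noise ξ e n () rest.forget

/-- Forget the second vertex decoration. -/
def PTree.forget {b : Bool} (t : PTree d K Ξ O b) : PTree d K Ξ Unit b := ⟨t.dec, (), t.br.forget⟩

/-! ## Degrees

`β k` is the regularity of the kernel `k` and `α ξ` the regularity of the path behind the noise `ξ`;
a noise edge contributes `α ξ - 1`. The function `x` says what a second vertex decoration counts. -/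

/-- The sum of all contributions of the edges and vertices in the branches. -/
def Branches.deg (β : K → ℝ) (α : Ξ → ℝ) (x : O → ℝ) : {b : Bool} → Branches d K Ξ O b → ℝ
  | _, .nil => 0
  | _, .kernel k e n o above rest =>
      (β k - (e.size : ℝ)) + ((n.size : ℝ) + x o + above.deg β α x) + rest.deg β α x
  | _, .noise ξ e n o rest =>
      (α ξ - 1 - (e.size : ℝ)) + ((n.size : ℝ) + x o) + rest.deg β α x

/-- The regularity `|τ|` of a tree without second decorations. -/
def PTree.reg (β : K → ℝ) (α : Ξ → ℝ) {b : Bool} (t : PTree d K Ξ Unit b) : ℝ :=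
  (t.dec.size : ℝ) + t.br.deg β α (fun _ => 0)

/-- The degree `|τ|₊` of a tree with extended decorations: its regularity plus the sum of all its
extended decorations. -/
def PTree.degPlus (β : K → ℝ) (α : Ξ → ℝ) {b : Bool} (t : PTree d K Ξ ℝ b) : ℝ :=
  (t.dec.size : ℝ) + t.exdec + t.br.deg β α id

/-- The sum of the absolute values of all contributions to the degree. -/
def Branches.absSize (β : K → ℝ) (α : Ξ → ℝ) : {b : Bool} → Branches d K Ξ ℝ b → ℝ
  | _, .nil => 0
  | _, .kernel k e n o above rest =>
      (|β k| + (e.size : ℝ)) + ((n.size : ℝ) + |o| + above.absSize β α) + rest.absSize β α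
  | _, .noise ξ e n o rest =>
      (|α ξ - 1| + (e.size : ℝ)) + ((n.size : ℝ) + |o|) + rest.absSize β α

/-- A number `B` such that no term of the two coactions below survives its projection (onto positive
trees, or onto negative trees) if an edge decoration is increased by some `ℓ` with `|ℓ| > B`. It
turns the formally infinite sums over `ℓ ∈ ℕ^d` into finite ones without changing their value. -/
noncomputable def PTree.bound (β : K → ℝ) (α : Ξ → ℝ) {b : Bool} (t : PTree d K Ξ ℝ b) : ℕ :=
  ⌈(t.dec.size : ℝ) + |t.exdec| + t.br.absSize β α⌉₊

/-! ## Spaces -/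

/-- Basis of `𝔗⁻`: trees (without extended decorations) of negative regularity. -/
abbrev NegTree (d : ℕ) {K Ξ : Type} (β : K → ℝ) (α : Ξ → ℝ) : Type :=
  {t : PTree d K Ξ Unit true // t.reg β α < 0}

/-- `S(𝔗⁻)`, the free commutative algebra generated by the trees of negative regularity. -/
abbrev SMinus (d : ℕ) {K Ξ : Type} (β : K → ℝ) (α : Ξ → ℝ) (R : Type*) [CommRing R] : Type _ :=
  MvPolynomial (NegTree d β α) R

/-- `𝔗_ex`, the free module on all trees with extended decorations. -/
abbrev TEx (d : ℕ) (K Ξ : Type) (R : Type*) [CommRing R] : Type _ := PTree d K Ξ ℝ true →₀ R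

/-- The tree consisting of a single vertex with zero decorations, the unit of `𝔗⁺_ex`. -/
def PTree.one {b : Bool} : PTree d K Ξ ℝ b := ⟨0, 0, .nil⟩

/-- The tree is positive for `|·|₊`, or it is the unit. -/
def PTree.IsPos (β : K → ℝ) (α : Ξ → ℝ) (t : PTree d K Ξ ℝ false) : Prop :=
  0 < t.degPlus β α ∨ t = PTree.one

/-- Basis of `𝔗⁺_ex`: trees with extended decorations and without a noise edge at the root which
are positive for `|·|₊`, together with the unit. -/
abbrev PosTree (d : ℕ) {K Ξ : Type} (β : K → ℝ) (α : Ξ → ℝ) : Type :=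
  {t : PTree d K Ξ ℝ false // t.IsPos β α}

/-- `𝔗⁺_ex`. -/
abbrev TExPlus (d : ℕ) {K Ξ : Type} (β : K → ℝ) (α : Ξ → ℝ) (R : Type*) [CommRing R] : Type _ :=
  PosTree d β α →₀ R

open Classical in
/-- The projection onto `𝔗⁺_ex`, on basis elements. -/
noncomputable def projPos (β : K → ℝ) (α : Ξ → ℝ) (R : Type*) [CommRing R]
    (t : PTree d K Ξ ℝ false) : TExPlus d β α R :=
  if h : t.IsPos β α then Finsupp.single ⟨t, h⟩ 1 else 0

open Classical in
/-- A tree, its extended decorations being forgotten, as an element of `𝔗⁻ ⊆ S(𝔗⁻)`; it is `0` if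
its regularity is not negative. -/
noncomputable def projNeg (β : K → ℝ) (α : Ξ → ℝ) (R : Type*) [CommRing R]
    (t : PTree d K Ξ ℝ true) : SMinus d β α R :=
  if h : t.forget.reg β α < 0 then MvPolynomial.X ⟨t.forget, h⟩ else 0

/-! ## Left admissible cuts with deformed decorations -/

/-- All shuffles of two lists, with multiplicity. -/
def shuffle {X : Type} : List X → List X → Multiset (List X)
  | [], l => {l}
  | x :: l, [] => {x :: l}
  | x :: l, y :: m =>
      (shuffle l (y :: m)).map (fun s => x :: s) + (shuffle (x :: l) m).map (fun s => y :: s)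
termination_by l m => l.length + m.length

/-- A term obtained by cutting inside the branches at one vertex `v`.
* `coef`: its coefficient;
* `red`: the total amount taken off the decorations of the kept vertices (`v` not included);
* `shift`: the sum of the `ℓ`'s by which the decorations of the cut edges at `v` are increased;
* `own`: the limbs cut off at `v`, in planar order;
* `deep`: the limbs cut off at vertices above `v`, shuffled;
* `kept`: the branches that stay at `v`. -/
structure BranchCut (C : Type*) (d : ℕ) (K Ξ O : Type) (b : Bool) where
  coef : C
  red : MIdx d
  shift : MIdx d
  own : List (Limb d K Ξ O)
  deep : List (Limb d K Ξ O)
  kept : Branches d K Ξ O b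

/-- A term obtained by cutting a tree.
* `coef`: its coefficient;
* `red`: the total amount taken off the decorations of the vertices of the trunk;
* `pruned`: the limbs that have been cut off, shuffled;
* `trunk`: the trunk. -/
structure TreeCut (C : Type*) (d : ℕ) (K Ξ O : Type) (b : Bool) where
  coef : C
  red : MIdx d
  pruned : List (Limb d K Ξ O)
  trunk : PTree d K Ξ O b

section Steps

variable {C : Type*} [CommSemiring C]

/-- Nothing is cut at a vertex without outgoing edges. -/
def nilStep {b : Bool} : Multiset (BranchCut C d K Ξ O b) := {⟨1, 0, 0, [], [], .nil⟩}

/-- Cut the leftmost edge, of type `(k, e)`, and increase its decoration to `e + ℓ`. The trees that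
may be on top of the edge are `heads`, with their coefficients; the terms for the edges to the right
are `rests`. The factors `(shift + ℓ choose ℓ)` multiply up to the multinomial coefficient
`(∑ ℓ)! / ∏ ℓ!` over the cut edges at the vertex. -/
def cutStep {b : Bool} (B : ℕ) (k : K) (e : MIdx d) (heads : Multiset (C × PTree d K Ξ O true))
    (rests : Multiset (BranchCut C d K Ξ O b)) : Multiset (BranchCut C d K Ξ O b) :=
  (Finset.Iic (fun _ => B : MIdx d)).val.bind fun ℓ =>
    heads.bind fun h => rests.map fun t =>
      ⟨h.1 * t.coef * (mchoose (t.shift + ℓ) ℓ : C), t.red, t.shift + ℓ,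
        ⟨k, e + ℓ, h.2⟩ :: t.own, t.deep, t.kept⟩

/-- Keep the leftmost edge, of type `(k, e)`. The terms for the tree above it are `aboves`, those
for the edges to the right are `rests`. -/
def keepStep {b : Bool} (k : K) (e : MIdx d) (aboves : Multiset (TreeCut C d K Ξ O true))
    (rests : Multiset (BranchCut C d K Ξ O b)) : Multiset (BranchCut C d K Ξ O b) :=
  aboves.bind fun s => rests.bind fun t => (shuffle s.pruned t.deep).map fun l =>
    ⟨s.coef * t.coef * (mchoose (s.red + t.red) s.red : C), s.red + t.red, t.shift, t.own, l,
      .kernel k e s.trunk.dec s.trunk.exdec s.trunk.br t.kept⟩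

/-- A noise edge stays, and its noise vertex is not touched. -/
def noiseStep (ξ : Ξ) (e n : MIdx d) (o : O) (rests : Multiset (BranchCut C d K Ξ O false)) :
    Multiset (BranchCut C d K Ξ O true) :=
  rests.map fun t => ⟨t.coef, t.red, t.shift, t.own, t.deep, .noise ξ e n o t.kept⟩

/-- Pass from the branches at a vertex with decorations `(n, o)` to the tree with this root: take
`a ≤ n` off `n`, and add the sum of the `ℓ`'s of the edges that have been cut at the vertex. With
`N = n - a + ∑ ℓ` the new decoration, the coefficient is completed to the multinomial coefficient
`N! / ((n - a)! ∏ ℓ!)`, and the `a`'s of all vertices contribute the multinomial coefficient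
`(∑ a)! / ∏ a!`. -/
def closeVertex {b : Bool} (n : MIdx d) (o : O) (terms : Multiset (BranchCut C d K Ξ O b)) :
    Multiset (TreeCut C d K Ξ O b) :=
  (Finset.Iic n).val.bind fun a => terms.bind fun t => (shuffle t.own t.deep).map fun l =>
    ⟨t.coef * (mchoose (n - a + t.shift) t.shift * mchoose (a + t.red) a : ℕ), a + t.red, l,
      ⟨n - a + t.shift, o, t.kept⟩⟩

end Steps

/-- All left admissible cuts inside the branches at a vertex: the cut edges at a vertex form an
initial segment of the kernel edges to the left of a possible noise edge, and nothing above a cut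
edge is cut. The flag says whether all edges further to the left have been cut, so that the leftmost
edge may be cut as well. -/
def cuts (B : ℕ) : Bool → {b : Bool} → Branches d K Ξ O b → Multiset (BranchCut ℕ d K Ξ O b)
  | _, _, .nil => nilStep
  | true, _, .kernel k e n o above rest =>
      cutStep B k e {(1, ⟨n, o, above⟩)} (cuts B true rest) +
        keepStep k e (closeVertex n o (cuts B true above)) (cuts B false rest)
  | false, _, .kernel k e n o above rest =>
      keepStep k e (closeVertex n o (cuts B true above)) (cuts B false rest)
  | _, _, .noise ξ e n o rest => noiseStep ξ e n o (cuts B false rest)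

/-- The recentering coaction `Δ⁺_ex : 𝔗_ex → 𝔗⁺_ex ⊗ 𝔗_ex`. For every left admissible cut, the pruned
limbs are grafted onto a new root which receives everything that has been taken off the vertices of
the trunk and which has extended decoration `0`; all other vertices keep their extended decoration. -/
noncomputable def deltaPlusEx (β : K → ℝ) (α : Ξ → ℝ) (R : Type*) [CommRing R] :
    TEx d K Ξ R →ₗ[R] TExPlus d β α R ⊗[R] TEx d K Ξ R :=
  Finsupp.linearCombination R fun t : PTree d K Ξ ℝ true =>
    ((closeVertex t.dec t.exdec (cuts (t.bound β α) true t.br)).map fun s =>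
      (s.coef : R) • (projPos β α R ⟨s.red, 0, ofLimbs s.pruned⟩ ⊗ₜ[R] Finsupp.single s.trunk 1)).sum

/-! ## Contraction of negative subtrees -/

/-- All ways to contract subtrees in a tree whose root has decorations `(n, o)`, given the ways `A`
to contract subtrees inside the branches at the root, and the ways `E` to single out inside these
branches the part of a subtree that contains the root. In the second case the subtree is the trunk
`s.trunk`, it is put into `S(𝔗⁻)` if it is negative, and it is contracted into a vertex whose
extended decoration is its `|·|₊`-degree. -/
noncomputable def contractVertex (β : K → ℝ) (α : Ξ → ℝ) (R : Type*) [CommRing R] (n : MIdx d) (o : ℝ)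
    (A : Multiset (SMinus d β α R × Branches d K Ξ ℝ true))
    (E : Multiset (BranchCut (SMinus d β α R) d K Ξ ℝ true)) :
    Multiset (SMinus d β α R × PTree d K Ξ ℝ true) :=
  A.map (fun q => (q.1, ⟨n, o, q.2⟩)) +
    (closeVertex n o E).map fun s =>
      (s.coef * projNeg β α R s.trunk, ⟨s.red, s.trunk.degPlus β α, ofLimbs s.pruned⟩)

mutual

/-- All ways to contract admissible partitions inside the branches at a vertex which itself does not
belong to a contracted subtree. -/
noncomputable def contract (β : K → ℝ) (α : Ξ → ℝ) (R : Type*) [CommRing R] (B : ℕ) :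
    {b : Bool} → Branches d K Ξ ℝ b → Multiset (SMinus d β α R × Branches d K Ξ ℝ b)
  | _, .nil => {(1, .nil)}
  | _, .kernel k e n o above rest =>
      (contractVertex β α R n o (contract β α R B above) (extract β α R B true above)).bind fun h =>
        (contract β α R B rest).map fun q =>
          (h.1 * q.1, .kernel k e h.2.dec h.2.exdec h.2.br q.2)
  | _, .noise ξ e n o rest =>
      (contract β α R B rest).map fun q => (q.1, .noise ξ e n o q.2)

/-- All ways to single out inside the branches at a vertex `v` the part of a contracted subtree that
contains `v`. The edges at a vertex of the subtree which do not belong to the subtree form an initial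
segment of the kernel edges to the left of a possible noise edge, so the subtree is the trunk of a
left admissible cut; the edges that leave the subtree are deformed as cut edges are, and further
subtrees are contracted in the trees on top of them. -/
noncomputable def extract (β : K → ℝ) (α : Ξ → ℝ) (R : Type*) [CommRing R] (B : ℕ) :
    Bool → {b : Bool} → Branches d K Ξ ℝ b → Multiset (BranchCut (SMinus d β α R) d K Ξ ℝ b)
  | _, _, .nil => nilStep
  | true, _, .kernel k e n o above rest =>
      cutStep B k e
          (contractVertex β α R n o (contract β α R B above) (extract β α R B true above))
          (extract β α R B true rest) +
        keepStep k e (closeVertex n o (extract β α R B true above)) (extract β α R B false rest)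
  | false, _, .kernel k e n o above rest =>
      keepStep k e (closeVertex n o (extract β α R B true above)) (extract β α R B false rest)
  | _, _, .noise ξ e n o rest => noiseStep ξ e n o (extract β α R B false rest)

end

/-- The renormalisation coaction `Δ⁻_ex : 𝔗_ex → S(𝔗⁻) ⊗ 𝔗_ex`. -/
noncomputable def deltaMinusEx (β : K → ℝ) (α : Ξ → ℝ) (R : Type*) [CommRing R] :
    TEx d K Ξ R →ₗ[R] SMinus d β α R ⊗[R] TEx d K Ξ R :=
  Finsupp.linearCombination R fun t : PTree d K Ξ ℝ true =>
    ((contractVertex β α R t.dec t.exdec (contract β α R (t.bound β α) t.br)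
        (extract β α R (t.bound β α) true t.br)).map fun q =>
      q.1 ⊗ₜ[R] Finsupp.single q.2 1).sum

/-! The `|·|₊`-degree is preserved by contractions, hence contractions away from the root map `𝔗⁺_ex`
to itself. -/

/-- The contribution of a list of limbs to the `|·|₊`-degree. -/
noncomputable def limbsDeg (β : K → ℝ) (α : Ξ → ℝ) (l : List (Limb d K Ξ ℝ)) : ℝ :=
  (l.map fun x => (β x.k - (x.e.size : ℝ)) + x.tree.degPlus β α).sum

theorem MIdx.size_add (a b : MIdx d) : (a + b).size = a.size + b.size := by
  simp [MIdx.size, Finset.sum_add_distrib]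

theorem MIdx.size_zero : (0 : MIdx d).size = 0 := by
  simp [MIdx.size]

theorem deg_ofLimbs (β : K → ℝ) (α : Ξ → ℝ) {b : Bool} (l : List (Limb d K Ξ ℝ)) :
    (ofLimbs l : Branches d K Ξ ℝ b).deg β α id = limbsDeg β α l := by
  induction l with
  | nil => simp [ofLimbs, Branches.deg, limbsDeg]
  | cons x l ih =>
    simp only [ofLimbs, Branches.deg, ih]
    simp [limbsDeg, PTree.degPlus]

theorem perm_of_mem_shuffle {X : Type} (l m s : List X) (h : s ∈ shuffle l m) :
    s.Perm (l ++ m) := by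
  induction l, m using shuffle.induct generalizing s with
  | case1 l => simp_all [shuffle]
  | case2 x l => simp_all [shuffle]
  | case3 x l y m ih1 ih2 =>
    rw [shuffle, Multiset.mem_add, Multiset.mem_map, Multiset.mem_map] at h
    rcases h with ⟨s, hs, rfl⟩ | ⟨s, hs, rfl⟩
    · exact (ih1 s hs).cons x
    · exact ((ih2 s hs).cons y).trans List.perm_middle.symm

theorem limbsDeg_shuffle (β : K → ℝ) (α : Ξ → ℝ) {l m s : List (Limb d K Ξ ℝ)}
    (h : s ∈ shuffle l m) : limbsDeg β α s = limbsDeg β α l + limbsDeg β α m := by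
  rw [limbsDeg, ((perm_of_mem_shuffle l m s h).map _).sum_eq]
  simp [limbsDeg]

/-- The total degree of a term is `D`. -/
def BranchCut.HasDeg {C : Type*} {b : Bool} (β : K → ℝ) (α : Ξ → ℝ) (D : ℝ)
    (t : BranchCut C d K Ξ ℝ b) : Prop :=
  t.kept.deg β α id + limbsDeg β α t.own + limbsDeg β α t.deep + (t.red.size : ℝ)
    + (t.shift.size : ℝ) = D

/-- The total degree of a term is `D`. -/
def TreeCut.HasDeg {C : Type*} {b : Bool} (β : K → ℝ) (α : Ξ → ℝ) (D : ℝ)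
    (s : TreeCut C d K Ξ ℝ b) : Prop :=
  s.trunk.degPlus β α + limbsDeg β α s.pruned + (s.red.size : ℝ) = D

theorem hasDeg_nilStep {C : Type*} [CommSemiring C] {b : Bool} (β : K → ℝ) (α : Ξ → ℝ)
    (t : BranchCut C d K Ξ ℝ b) (ht : t ∈ nilStep) : t.HasDeg β α 0 := by
  rw [nilStep, Multiset.mem_singleton] at ht
  subst ht
  simp [BranchCut.HasDeg, Branches.deg, limbsDeg, MIdx.size_zero]

theorem hasDeg_cutStep {C : Type*} [CommSemiring C] {b : Bool} (β : K → ℝ) (α : Ξ → ℝ) {D D' : ℝ}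
    (B : ℕ) (k : K) (e : MIdx d) (heads : Multiset (C × PTree d K Ξ ℝ true))
    (rests : Multiset (BranchCut C d K Ξ ℝ b)) (h1 : ∀ h ∈ heads, h.2.degPlus β α = D)
    (h2 : ∀ t ∈ rests, t.HasDeg β α D') (t : BranchCut C d K Ξ ℝ b)
    (ht : t ∈ cutStep B k e heads rests) :
    t.HasDeg β α ((β k - (e.size : ℝ)) + D + D') := by
  simp only [cutStep, Multiset.mem_bind, Multiset.mem_map] at ht
  obtain ⟨ℓ, -, h, hh, t, ht, rfl⟩ := ht
  have h1 := h1 h hh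
  have h2 := h2 t ht
  simp only [BranchCut.HasDeg, limbsDeg, List.map_cons, List.sum_cons, MIdx.size_add,
    Nat.cast_add] at h2 ⊢
  linarith

theorem hasDeg_keepStep {C : Type*} [CommSemiring C] {b : Bool} (β : K → ℝ) (α : Ξ → ℝ) {D D' : ℝ}
    (k : K) (e : MIdx d) (aboves : Multiset (TreeCut C d K Ξ ℝ true))
    (rests : Multiset (BranchCut C d K Ξ ℝ b)) (h1 : ∀ s ∈ aboves, s.HasDeg β α D)
    (h2 : ∀ t ∈ rests, t.HasDeg β α D') (t : BranchCut C d K Ξ ℝ b)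
    (ht : t ∈ keepStep k e aboves rests) :
    t.HasDeg β α ((β k - (e.size : ℝ)) + D + D') := by
  simp only [keepStep, Multiset.mem_bind, Multiset.mem_map] at ht
  obtain ⟨s, hs, t, ht, l, hl, rfl⟩ := ht
  have h1 := h1 s hs
  have h2 := h2 t ht
  have h3 := limbsDeg_shuffle β α hl
  simp only [BranchCut.HasDeg, TreeCut.HasDeg, PTree.degPlus, Branches.deg, MIdx.size_add,
    Nat.cast_add, id] at h1 h2 ⊢
  linarith

theorem hasDeg_noiseStep {C : Type*} [CommSemiring C] (β : K → ℝ) (α : Ξ → ℝ) {D : ℝ}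
    (ξ : Ξ) (e n : MIdx d) (o : ℝ) (rests : Multiset (BranchCut C d K Ξ ℝ false))
    (h2 : ∀ t ∈ rests, t.HasDeg β α D) (t : BranchCut C d K Ξ ℝ true)
    (ht : t ∈ noiseStep ξ e n o rests) :
    t.HasDeg β α ((α ξ - 1 - (e.size : ℝ)) + ((n.size : ℝ) + o) + D) := by
  simp only [noiseStep, Multiset.mem_map] at ht
  obtain ⟨t, ht, rfl⟩ := ht
  have h2 := h2 t ht
  simp only [BranchCut.HasDeg, Branches.deg, id] at h2 ⊢
  linarith

theorem hasDeg_closeVertex {C : Type*} [CommSemiring C] {b : Bool} (β : K → ℝ) (α : Ξ → ℝ) {D : ℝ}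
    (n : MIdx d) (o : ℝ) (terms : Multiset (BranchCut C d K Ξ ℝ b))
    (h : ∀ t ∈ terms, t.HasDeg β α D) (s : TreeCut C d K Ξ ℝ b)
    (hs : s ∈ closeVertex n o terms) : s.HasDeg β α ((n.size : ℝ) + o + D) := by
  simp only [closeVertex, Multiset.mem_bind, Multiset.mem_map, Finset.mem_val,
    Finset.mem_Iic] at hs
  obtain ⟨a, ha, t, ht, l, hl, rfl⟩ := hs
  have h1 := h t ht
  have h3 := limbsDeg_shuffle β α hl
  have h4 : ((n - a).size : ℝ) + (a.size : ℝ) = (n.size : ℝ) := by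
    rw [← Nat.cast_add, ← MIdx.size_add, tsub_add_cancel_of_le ha]
  simp only [BranchCut.HasDeg, TreeCut.HasDeg, PTree.degPlus, MIdx.size_add, Nat.cast_add] at h1 ⊢
  linarith

theorem degPlus_contractVertex (β : K → ℝ) (α : Ξ → ℝ) (R : Type*) [CommRing R] {D : ℝ}
    (n : MIdx d) (o : ℝ) (A : Multiset (SMinus d β α R × Branches d K Ξ ℝ true))
    (E : Multiset (BranchCut (SMinus d β α R) d K Ξ ℝ true))
    (hA : ∀ q ∈ A, q.2.deg β α id = D) (hE : ∀ t ∈ E, t.HasDeg β α D)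
    (q : SMinus d β α R × PTree d K Ξ ℝ true) (hq : q ∈ contractVertex β α R n o A E) :
    q.2.degPlus β α = (n.size : ℝ) + o + D := by
  simp only [contractVertex, Multiset.mem_add, Multiset.mem_map] at hq
  rcases hq with ⟨q, hq, rfl⟩ | ⟨s, hs, rfl⟩
  · simp [PTree.degPlus, hA q hq]
  · have h := hasDeg_closeVertex β α n o E hE s hs
    simp only [TreeCut.HasDeg] at h
    simp only [PTree.degPlus, deg_ofLimbs] at h ⊢
    linarith

theorem deg_contract_extract (β : K → ℝ) (α : Ξ → ℝ) (R : Type*) [CommRing R] (B : ℕ)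
    {b : Bool} (br : Branches d K Ξ ℝ b) :
    (∀ q ∈ contract β α R B br, q.2.deg β α id = br.deg β α id) ∧
      ∀ c, ∀ t ∈ extract β α R B c br, t.HasDeg β α (br.deg β α id) := by
  induction br with
  | nil =>
    refine ⟨fun q hq => ?_, fun c t ht => ?_⟩
    · simp only [contract, Multiset.mem_singleton] at hq
      rw [hq]
    · cases c <;> simp only [extract] at ht <;> exact hasDeg_nilStep β α t ht
  | kernel k e n o above rest ih1 ih2 =>
    have hV := degPlus_contractVertex β α R n o _ _ ih1.1 (ih1.2 true)
    have hC := hasDeg_closeVertex β α n o _ (ih1.2 true)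
    refine ⟨fun q hq => ?_, fun c t ht => ?_⟩
    · simp only [contract, Multiset.mem_bind, Multiset.mem_map] at hq
      obtain ⟨h, hh, q, hq, rfl⟩ := hq
      have h1 := hV h hh
      have h2 := ih2.1 q hq
      simp only [PTree.degPlus, Branches.deg, id] at h1 h2 ⊢
      linarith
    · have hK := hasDeg_keepStep β α k e _ _ hC (ih2.2 false)
      cases c
      · simp only [extract] at ht
        exact hK t ht
      · simp only [extract, Multiset.mem_add] at ht
        rcases ht with ht | ht
        · exact hasDeg_cutStep β α B k e _ _ hV (ih2.2 true) t ht
        · exact hK t ht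
  | noise ξ e n o rest ih =>
    refine ⟨fun q hq => ?_, fun c t ht => ?_⟩
    · simp only [contract, Multiset.mem_map] at hq
      obtain ⟨q, hq, rfl⟩ := hq
      simp only [Branches.deg, ih.1 q hq]
    · cases c <;> simp only [extract] at ht <;>
        exact hasDeg_noiseStep β α ξ e n o _ (ih.2 false) t ht

theorem isPos_of_mem_contract (β : K → ℝ) (α : Ξ → ℝ) (R : Type*) [CommRing R] (B : ℕ)
    (t : PosTree d β α) (q : SMinus d β α R × Branches d K Ξ ℝ false)
    (hq : q ∈ contract β α R B t.1.br) :
    (⟨t.1.dec, t.1.exdec, q.2⟩ : PTree d K Ξ ℝ false).IsPos β α := by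
  obtain ⟨t, ht | rfl⟩ := t
  · left
    have h := (deg_contract_extract β α R B t.br).1 q hq
    simp only [PTree.degPlus] at ht ⊢
    rwa [h]
  · right
    simp only [PTree.one, contract, Multiset.mem_singleton] at hq ⊢
    rw [hq]

/-- The renormalisation coaction `Δ⁻_{ex-non-root} : 𝔗⁺_ex → S(𝔗⁻) ⊗ 𝔗⁺_ex`, which contracts only
subtrees that do not contain the root. -/
noncomputable def deltaMinusExNonRoot (β : K → ℝ) (α : Ξ → ℝ) (R : Type*) [CommRing R] :
    TExPlus d β α R →ₗ[R] SMinus d β α R ⊗[R] TExPlus d β α R :=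
  Finsupp.linearCombination R fun t : PosTree d β α =>
    ((contract β α R (t.1.bound β α) t.1.br).pmap
      (fun q hq => q.1 ⊗ₜ[R] Finsupp.single
        (⟨⟨t.1.dec, t.1.exdec, q.2⟩, hq⟩ : PosTree d β α) (1 : R))
      (isPos_of_mem_contract β α R (t.1.bound β α) t)).sum

/-- `m^{1,3}(a ⊗ b ⊗ c ⊗ e) = ac ⊗ b ⊗ e`. -/
noncomputable def m13 (R S M N : Type*) [CommRing R] [CommRing S] [Algebra R S]
    [AddCommGroup M] [Module R M] [AddCommGroup N] [Module R N] :
    (S ⊗[R] M) ⊗[R] (S ⊗[R] N) →ₗ[R] S ⊗[R] (M ⊗[R] N) :=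
  TensorProduct.map (LinearMap.mul' R S) LinearMap.id ∘ₗ
    (TensorProduct.tensorTensorTensorComm R S M S N).toLinearMap

end PlanarRS

-- Both coactions single out trunks of left admissible cuts. What is taken off the vertices of a
-- trunk is collected with binomial coefficients, as in a product of divided powers, and limbs cut
-- off at different vertices are shuffled. A family `x` multiplying like divided powers and a
-- shuffle character `U`, both with values in a commutative ring, turn these two operations into
-- products. Evaluated along such `Chars`, cuts obey a recursion without shuffles, in which only the
-- binomials of the shifts survive (`wsum_keepStep`, `wsum_closeVertex`). Nothing is lost by
-- evaluating, because the basis of the algebra `DPSh` of divided powers and shuffles provides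
-- universal characters.
--
-- Two statements are proved by a simultaneous induction over the branches at a vertex.
-- `ContractCut`: contractions that avoid the vertex commute with cuts, once the contractions inside
-- pruned limbs are built into the character (`Chars.con`). `ExtractCut`: the vertex lies in a
-- contracted subtree σ. Cutting at the vertex that replaces σ splits its decoration and cuts its
-- word of limbs into an initial and a final segment. Both operations are multiplicative
-- (`nsmul_dsum_add`, `shsum_dcsum`), so they produce new characters `Chars.comp`. An edge at a
-- vertex of σ belongs to σ, or leaves σ and is kept by the recentering cut, or leaves σ and is cut.
-- In the last case the two increases ℓ and ℓ' of its decoration add up to the single increase seen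
-- when recentering comes first, and the coefficients agree by Vandermonde's identity
-- (`sum_cut_cut`); `dsum_close` does the same for the vertex decorations. A contraction of a tree
-- either avoids the root or contracts a subtree at the root, so the two statements together give
-- `contractCut_tree`.
--
-- The sums over increases are formally infinite, and a finite box of increases is not closed under
-- addition. The increases are therefore weighted by `X ^ |ℓ|` in polynomials modulo `X ^ (N + 1)`:
-- this weight is multiplicative and vanishes outside the box of side `N`, so the identity is exact
-- for every `N` (`sum_contract_cut_trunc`). An increase lowers the degree of what is cut off and
-- raises the regularity of the subtree that is extracted, so the projections discard large
-- increases (`sum_cutsWith_box`, `sum_contract_extract_box`). For large `N` the boxes can thus be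
-- shrunk to those in the definitions, and the sum of the coefficients up to degree `N` is the value
-- at `X = 1`, which gives back the coactions.

universe u

namespace PlanarRS

variable {d : ℕ} {K Ξ O : Type}

/-! ## Divided power coefficients -/

/-- The coefficient of `x_{a+b}` in the divided power product `x_a x_b`. -/
def dpc (a b : MIdx d) : ℕ := mchoose (a + b) a

theorem mchoose_add_right (a b : MIdx d) : mchoose (a + b) b = dpc a b := by
  unfold dpc mchoose
  exact Finset.prod_congr rfl fun i _ => (Nat.choose_symm_add (a := a i) (b := b i)).symm

theorem dpc_comm (a b : MIdx d) : dpc a b = dpc b a := by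
  rw [← mchoose_add_right a b, add_comm a b]; rfl

theorem dpc_zero_left (a : MIdx d) : dpc 0 a = 1 := by
  simp [dpc, mchoose]

theorem dpc_zero_right (a : MIdx d) : dpc a 0 = 1 := by
  rw [dpc_comm, dpc_zero_left]

/-- Both sides are the trinomial coefficient of `a`, `b`, `c`. -/
theorem dpc_assoc (a b c : MIdx d) : dpc a b * dpc (a + b) c = dpc b c * dpc a (b + c) := by
  unfold dpc mchoose
  rw [← Finset.prod_mul_distrib, ← Finset.prod_mul_distrib]
  refine Finset.prod_congr rfl fun i _ => ?_
  have h := Nat.choose_mul (n := a i + b i + c i) (k := a i + b i) (s := a i) (by omega)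
  simp only [Pi.add_apply]
  rw [mul_comm, h, mul_comm, ← add_assoc]
  congr 2 <;> omega

/-- Vandermonde's identity in each coordinate: a choice of `p` among `p + q` objects is sorted by
the number `b` of chosen objects among the first `a`. -/
theorem sum_mchoose_mul_mchoose (p q a : MIdx d) (h : a ≤ p + q) :
    ∑ b ∈ Finset.Iic p, mchoose a b * mchoose (p + q - a) (p - b) = dpc p q := by
  have h1 : ∀ i, ∑ j ∈ Finset.Iic (p i), (a i).choose j * (p i + q i - a i).choose (p i - j) =
      (p i + q i).choose (p i) := by
    intro i
    have hi : a i ≤ p i + q i := h i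
    have h2 := Nat.add_choose_eq (a i) (p i + q i - a i) (p i)
    rw [Nat.add_sub_cancel' hi, Finset.Nat.sum_antidiagonal_eq_sum_range_succ_mk] at h2
    rw [h2]
    refine Finset.sum_congr ?_ fun _ _ => rfl
    ext j; simp
  have h2 : dpc p q = ∏ i, (p i + q i).choose (p i) := rfl
  -- Expanding the product gives a sum over the product of the intervals `Finset.Iic (p i)`, which
  -- is `Finset.Iic p` by definition.
  rw [h2, ← Finset.prod_congr rfl fun i _ => h1 i, Finset.prod_univ_sum]
  unfold mchoose
  simp only [← Finset.prod_mul_distrib]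
  rfl

/-- The sum over all decompositions of a multi-index into two. -/
def dsum {M : Type*} [AddCommMonoid M] (n : MIdx d) (f : MIdx d → MIdx d → M) : M :=
  ∑ a ∈ Finset.Iic n, f a (n - a)

-- Multiplicativity and coassociativity of splitting multi-indices

section Sums

variable {M : Type*} [AddCommMonoid M]

theorem dsum_zero (f : MIdx d → MIdx d → M) : dsum 0 f = f 0 0 := by
  have : Finset.Iic (0 : MIdx d) = {0} := by
    ext a; simp
  rw [dsum, this, Finset.sum_singleton, tsub_zero]

theorem dsum_congr {n : MIdx d} {f g : MIdx d → MIdx d → M}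
    (h : ∀ a b, a + b = n → f a b = g a b) : dsum n f = dsum n g :=
  Finset.sum_congr rfl fun a ha => h a _ (add_tsub_cancel_of_le (Finset.mem_Iic.1 ha))

/-- The coproduct of divided powers is multiplicative. Vandermonde's identity distributes the
coefficient over the ways in which a part of `p + q` consists of a part of `p` and a part of `q`. -/
theorem nsmul_dsum_add (p q : MIdx d) (f : MIdx d → MIdx d → M) :
    dpc p q • dsum (p + q) f = dsum p fun a a' => dsum q fun b b' =>
      (dpc a b * dpc a' b') • f (a + b) (a' + b') := by
  unfold dsum
  rw [Finset.smul_sum]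
  have h1 : ∀ a ∈ Finset.Iic (p + q), dpc p q • f a (p + q - a) = ∑ b ∈ Finset.Iic p,
      (mchoose a b * mchoose (p + q - a) (p - b)) • f a (p + q - a) := by
    intro a ha
    rw [← Finset.sum_smul, sum_mchoose_mul_mchoose p q a (Finset.mem_Iic.1 ha)]
  rw [Finset.sum_congr rfl h1, Finset.sum_comm]
  refine Finset.sum_congr rfl fun a ha => ?_
  have ha := Finset.mem_Iic.1 ha
  symm
  -- For a fixed part `a` of `p`, the parts of `p + q` of the form `a + b` with `b ≤ q` are the only
  -- ones with a nonzero product of binomials.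
  refine Finset.sum_of_injOn (fun b => a + b) (fun _ _ _ _ h => add_left_cancel h) ?_ ?_ ?_
  · intro b hb
    simp only [Finset.coe_Iic, Set.mem_Iic] at hb ⊢
    exact add_le_add ha hb
  · intro b hb hn
    have hz : mchoose b a * mchoose (p + q - b) (p - a) = 0 := by
      by_contra hne
      have h2 := left_ne_zero_of_mul hne
      have h3 := right_ne_zero_of_mul hne
      unfold mchoose at h2 h3
      rw [Finset.prod_ne_zero_iff] at h2 h3
      refine hn ⟨b - a, ?_, ?_⟩
      · simp only [Finset.coe_Iic, Set.mem_Iic]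
        intro i
        have h2 := h2 i (Finset.mem_univ i)
        have h3 := h3 i (Finset.mem_univ i)
        rw [Nat.choose_ne_zero_iff] at h2 h3
        have := Finset.mem_Iic.1 hb i
        have := ha i
        simp only [Pi.sub_apply, Pi.add_apply] at *
        omega
      · refine add_tsub_cancel_of_le fun i => ?_
        have h2 := h2 i (Finset.mem_univ i)
        rwa [Nat.choose_ne_zero_iff] at h2
    rw [hz, zero_smul]
  · intro b hb
    have hb := Finset.mem_Iic.1 hb
    have h4 : p + q - (a + b) = (p - a) + (q - b) := by
      funext i
      have h6 : a i ≤ p i := ha i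
      have h7 : b i ≤ q i := hb i
      simp only [Pi.sub_apply, Pi.add_apply]
      omega
    simp only [h4]
    have h5 : mchoose (p - a + (q - b)) (p - a) = dpc (p - a) (q - b) := rfl
    rw [h5]
    rfl

theorem dsum_assoc (n : MIdx d) (f : MIdx d → MIdx d → MIdx d → M) :
    (dsum n fun a c => dsum a fun b b' => f b b' c) =
      dsum n fun b r => dsum r fun b' c => f b b' c := by
  unfold dsum
  rw [Finset.sum_sigma', Finset.sum_sigma']
  refine Finset.sum_bij' (fun s _ => ⟨s.2, s.1 - s.2⟩) (fun s _ => ⟨s.1 + s.2, s.1⟩) ?_ ?_ ?_ ?_ ?_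
  · rintro ⟨a, b⟩ h
    simp only [Finset.mem_sigma, Finset.mem_Iic] at h ⊢
    exact ⟨h.2.trans h.1, tsub_le_tsub_right h.1 b⟩
  · rintro ⟨a, b⟩ h
    simp only [Finset.mem_sigma, Finset.mem_Iic] at h ⊢
    refine ⟨?_, fun i => Nat.le_add_right _ _⟩
    calc a + b ≤ a + (n - a) := add_le_add le_rfl h.2
      _ = n := add_tsub_cancel_of_le h.1
  · rintro ⟨a, b⟩ h
    simp only [Finset.mem_sigma, Finset.mem_Iic] at h
    simp [add_tsub_cancel_of_le h.2]
  · rintro ⟨a, b⟩ h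
    simp
  · rintro ⟨a, b⟩ h
    simp only [Finset.mem_sigma, Finset.mem_Iic] at h
    simp only
    rw [tsub_tsub, add_tsub_cancel_of_le h.2]

/-- This is why increases carry weights. The left side runs over pairs with `a + b ∈ S`, the right
side over all of `S × S`; the additional pairs have weight `w a * w b = w (a + b) = 0`. That `S` is
a lower set puts both parts of an element of `S` into `S`. -/
theorem sum_smul_dsum {C : Type*} [CommSemiring C] [Module C M] (S : Finset (MIdx d))
    (hS : IsLowerSet (S : Set (MIdx d))) (w : MIdx d → C) (hw : ∀ a b, w (a + b) = w a * w b)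
    (h0 : ∀ a, a ∉ S → w a = 0) (f : MIdx d → MIdx d → M) :
    ∑ m ∈ S, w m • dsum m f = ∑ a ∈ S, ∑ b ∈ S, w a • w b • f a b := by
  unfold dsum
  simp only [Finset.smul_sum]
  rw [Finset.sum_sigma', ← Finset.sum_product']
  refine Finset.sum_of_injOn (fun s => (s.2, s.1 - s.2)) ?_ ?_ ?_ ?_
  · rintro ⟨a, b⟩ h ⟨a', b'⟩ h' e
    simp only [Finset.coe_sigma, Set.mem_sigma_iff, Finset.coe_Iic, Set.mem_Iic] at h h'
    simp only [Prod.mk.injEq] at e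
    obtain ⟨rfl, e⟩ := e
    have : a = a' := by rw [← add_tsub_cancel_of_le h.2, e, add_tsub_cancel_of_le h'.2]
    rw [this]
  · rintro ⟨a, b⟩ h
    simp only [Finset.coe_sigma, Set.mem_sigma_iff, Finset.coe_Iic, Set.mem_Iic, Finset.coe_product,
      Set.mem_prod] at h ⊢
    exact ⟨hS h.2 h.1, hS tsub_le_self h.1⟩
  · rintro ⟨a, b⟩ h hn
    by_cases hab : a + b ∈ S
    · refine absurd ⟨⟨a + b, a⟩, ?_, ?_⟩ hn
      · simp only [Finset.coe_sigma, Set.mem_sigma_iff, Finset.coe_Iic, Set.mem_Iic]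
        exact ⟨hab, fun i => Nat.le_add_right _ _⟩
      · simp
    · rw [smul_smul, ← hw, h0 _ hab, zero_smul]
  · rintro ⟨a, b⟩ h
    simp only [Finset.mem_sigma, Finset.mem_Iic] at h
    simp only
    rw [smul_smul, ← hw, add_tsub_cancel_of_le h.2]

end Sums

/-! ## Weighted sums over multisets -/

/-- The sum of the values of `f` over a multiset of weighted points. -/
def wsum {C A M : Type*} [AddCommMonoid M] [SMul C M] (T : Multiset (C × A)) (f : A → M) : M :=
  (T.map fun q => q.1 • f q.2).sum

section WSum

variable {C A A' M M' : Type*} [CommSemiring C] [AddCommMonoid M] [Module C M]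
  [AddCommMonoid M'] [Module C M']

theorem wsum_singleton (c : C) (a : A) (f : A → M) : wsum {(c, a)} f = c • f a := by
  simp [wsum]

theorem wsum_add_left (T T' : Multiset (C × A)) (f : A → M) :
    wsum (T + T') f = wsum T f + wsum T' f := by
  simp [wsum]

theorem wsum_add (T : Multiset (C × A)) (f g : A → M) :
    (wsum T fun a => f a + g a) = wsum T f + wsum T g := by
  simp [wsum]

theorem wsum_smul (T : Multiset (C × A)) (c : C) (f : A → M) :
    (wsum T fun a => c • f a) = c • wsum T f := by
  simp only [wsum, Multiset.smul_sum, Multiset.map_map, Function.comp_def]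
  exact congrArg Multiset.sum (Multiset.map_congr rfl fun q _ => smul_comm _ _ _)

theorem wsum_nsmul (T : Multiset (C × A)) (c : ℕ) (f : A → M) :
    (wsum T fun a => c • f a) = c • wsum T f := by
  simp only [← Nat.cast_smul_eq_nsmul C, wsum_smul]

theorem wsum_mul_left {C : Type*} [CommSemiring C] (T : Multiset (C × A)) (c : C) (f : A → C) :
    (wsum T fun a => c * f a) = c * wsum T f :=
  wsum_smul T c f

theorem wsum_smul_right (T : Multiset (C × A)) (c : A → C) (m : M) :
    (wsum T fun a => c a • m) = (wsum T c) • m := by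
  simp only [wsum, Multiset.sum_smul, Multiset.map_map, Function.comp_def, smul_smul, smul_eq_mul]

theorem wsum_finset_sum {ι : Type*} (T : Multiset (C × A)) (s : Finset ι) (f : ι → A → M) :
    (wsum T fun a => ∑ i ∈ s, f i a) = ∑ i ∈ s, wsum T (f i) := by
  classical
  induction s using Finset.induction_on with
  | empty => simp [wsum]
  | insert i s hi ih => simp only [Finset.sum_insert hi, wsum_add, ih]

theorem wsum_dsum (T : Multiset (C × A)) (n : MIdx d) (f : MIdx d → MIdx d → A → M) :
    (wsum T fun a => dsum n fun r s => f r s a) = dsum n fun r s => wsum T (f r s) :=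
  wsum_finset_sum T _ _

theorem wsum_comm (T : Multiset (C × A)) (T' : Multiset (C × A')) (f : A → A' → M) :
    (wsum T fun a => wsum T' (f a)) = wsum T' fun a' => wsum T fun a => f a a' := by
  induction T using Multiset.induction_on with
  | empty => simp [wsum]
  | cons q T ih =>
    obtain ⟨c, a⟩ := q
    rw [← Multiset.singleton_add]
    simp only [wsum_add_left, wsum_add, ih, wsum_singleton, wsum_smul]

theorem map_wsum (T : Multiset (C × A)) (φ : M →ₗ[C] M') (f : A → M) :
    φ (wsum T f) = wsum T fun a => φ (f a) := by
  simp [wsum, map_multiset_sum]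

end WSum

/-! ## Shuffles -/

section Shuffle

variable {X Y : Type} {M : Type*} [AddCommMonoid M]

theorem shuffle_nil_right (l : List X) : shuffle l [] = {l} := by
  cases l <;> simp [shuffle]

/-- The sum over all shuffles. -/
def shsum (l m : List X) (f : List X → M) : M := ((shuffle l m).map f).sum

theorem shsum_nil_left (l : List X) (f : List X → M) : shsum [] l f = f l := by
  simp [shsum, shuffle]

theorem shsum_nil_right (l : List X) (f : List X → M) : shsum l [] f = f l := by
  simp [shsum, shuffle_nil_right]

theorem shsum_cons_cons (x y : X) (l m : List X) (f : List X → M) :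
    shsum (x :: l) (y :: m) f =
      shsum l (y :: m) (fun s => f (x :: s)) + shsum (x :: l) m fun s => f (y :: s) := by
  simp [shsum, shuffle]

theorem shsum_add (l m : List X) (f g : List X → M) :
    (shsum l m fun s => f s + g s) = shsum l m f + shsum l m g := by
  simp [shsum]

theorem shuffle_comm (l m : List X) : shuffle l m = shuffle m l := by
  induction l, m using shuffle.induct with
  | case1 l => simp [shuffle, shuffle_nil_right]
  | case2 x l => simp [shuffle]
  | case3 x l y m ih1 ih2 => simp only [shuffle, ih1, ih2, add_comm]

/-- Threefold shuffles are sorted by the list that supplies the first letter. Each of the three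
classes is an induction hypothesis for the list that has lost this letter. -/
theorem shsum_assoc (a b c : List X) (f : List X → M) :
    (shsum a b fun l => shsum l c f) = shsum b c fun l => shsum a l f := by
  induction a generalizing b c f with
  | nil => simp [shsum_nil_left]
  | cons x a iha =>
    induction b generalizing c f with
    | nil => simp [shsum_nil_left, shsum_nil_right]
    | cons y b ihb =>
      induction c generalizing f with
      | nil => simp [shsum_nil_right]
      | cons z c ihc =>
        have h1 := iha (y :: b) (z :: c) fun s => f (x :: s)
        have h2 := ihb (z :: c) fun s => f (y :: s)
        have h3 := ihc fun s => f (z :: s)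
        rw [shsum_cons_cons] at h3
        rw [shsum_cons_cons, shsum_cons_cons]
        have e : ∀ u v : List X, ∀ t : X, (shsum u v fun l => shsum (t :: l) (z :: c) f) =
            (shsum u v fun l => shsum l (z :: c) fun s => f (t :: s)) +
              shsum u v fun l => shsum (t :: l) c fun s => f (z :: s) := by
          intro u v t
          simp only [shsum_cons_cons, shsum_add]
        rw [e, e, h1, h2]
        -- `h3` expands the class starting with `z`, whose two halves `B` and `D'` come from
        -- different summands of the goal.
        have h4 : ∀ A B D D' E : M, B + D' = E → A + B + (D + D') = A + D + E := by
          intro A B D D' E h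
          rw [← h]; abel
        rw [h4 _ _ _ _ _ h3]
        simp only [shsum_cons_cons, shsum_add]
        abel

/-- The sum over all ways to cut a list into an initial and a final segment. -/
def dcsum : List X → (List X → List X → M) → M
  | [], f => f [] []
  | x :: l, f => f [] (x :: l) + dcsum l fun a b => f (x :: a) b

theorem dcsum_add (l : List X) (f g : List X → List X → M) :
    (dcsum l fun a b => f a b + g a b) = dcsum l f + dcsum l g := by
  induction l generalizing f g with
  | nil => rfl
  | cons x l ih => simp only [dcsum, ih]; abel

/-- Deconcatenation is multiplicative for shuffles: an initial segment of a shuffle of `l` and `m`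
is a shuffle of initial segments of `l` and `m`, and what remains is a shuffle of the two final
segments. Through this a cut at a contracted vertex is compatible with the shuffling of its
branches. -/
theorem shsum_dcsum (l m : List X) (f : List X → List X → M) :
    (shsum l m fun s => dcsum s f) = dcsum l fun a b => dcsum m fun a' b' =>
      shsum a a' fun u => shsum b b' fun v => f u v := by
  induction l, m using shuffle.induct generalizing f with
  | case1 l => simp [shsum_nil_left, dcsum]
  | case2 x l => simp [shsum_nil_right, dcsum]
  | case3 x l y m ih1 ih2 =>
    rw [shsum_cons_cons]
    simp only [dcsum, shsum_add, ih1, ih2, shsum_nil_left, shsum_nil_right, shsum_cons_cons,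
      dcsum_add]
    abel

variable {C : Type*} [CommSemiring C] [Module C M]

theorem wsum_shsum {A : Type*} (T : Multiset (C × A)) (l m : List X) (f : A → List X → M) :
    (wsum T fun a => shsum l m (f a)) = shsum l m fun s => wsum T fun a => f a s := by
  induction T using Multiset.induction_on with
  | empty => simp [wsum, shsum]
  | cons q T ih =>
    obtain ⟨c, a⟩ := q
    rw [← Multiset.singleton_add]
    simp only [wsum_add_left, shsum_add, ih, wsum_singleton]
    simp [shsum, Multiset.smul_sum]

/-- Substitute each letter of a list by one of its weighted replacements. -/
def substList (σ : X → Multiset (C × Y)) : List X → Multiset (C × List Y)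
  | [] => {(1, [])}
  | x :: l => (σ x).bind fun h => (substList σ l).map fun q => (h.1 * q.1, h.2 :: q.2)

theorem wsum_substList_nil (σ : X → Multiset (C × Y)) (f : List Y → M) :
    wsum (substList σ []) f = f [] := by
  simp [substList, wsum]

theorem wsum_bind_map {A B D : Type*} (S : Multiset (C × A)) (T : Multiset (C × B)) (c : A → B → D)
    (f : D → M) :
    wsum (S.bind fun h => T.map fun q => (h.1 * q.1, c h.2 q.2)) f =
      wsum S fun a => wsum T fun b => f (c a b) := by
  simp [wsum, Multiset.map_bind, Multiset.sum_bind, Multiset.smul_sum, mul_smul]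

theorem wsum_substList_cons (σ : X → Multiset (C × Y)) (x : X) (l : List X) (f : List Y → M) :
    wsum (substList σ (x :: l)) f =
      wsum (σ x) fun y => wsum (substList σ l) fun m => f (y :: m) := by
  rw [substList]
  exact wsum_bind_map _ _ (fun y m => y :: m) f

/-- Letters are replaced one by one and the weights commute, so it does not matter whether the order
is shuffled before or after the replacement. -/
theorem shsum_substList (σ : X → Multiset (C × Y)) (l m : List X) (f : List Y → M) :
    (shsum l m fun s => wsum (substList σ s) f) =
      wsum (substList σ l) fun a => wsum (substList σ m) fun b => shsum a b f := by
  induction l, m using shuffle.induct generalizing f with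
  | case1 l => simp [shsum_nil_left, wsum_substList_nil]
  | case2 x l => simp [shsum_nil_right, wsum_substList_nil]
  | case3 x l y m ih1 ih2 =>
    rw [shsum_cons_cons]
    simp only [wsum_substList_cons, ← wsum_shsum, ih1, ih2, shsum_cons_cons, wsum_add]
    congr 1
    rw [wsum_comm]
    refine congrArg _ (funext fun a => ?_)
    rw [wsum_comm]

end Shuffle

/-! ## The universal algebra with a divided power character and a shuffle character -/

theorem map_shsum {M M' F : Type*} [AddCommMonoid M] [AddCommMonoid M'] [FunLike F M M']
    [AddMonoidHomClass F M M'] {X : Type} (φ : F) (l m : List X) (f : List X → M) :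
    φ (shsum l m f) = shsum l m fun s => φ (f s) := by
  simp [shsum, map_multiset_sum]

/-- A family multiplying like divided powers. -/
structure IsDPChar {C : Type*} [CommSemiring C] (x : MIdx d → C) : Prop where
  zero : x 0 = 1
  mul : ∀ a b, x a * x b = (dpc a b : C) * x (a + b)

/-- A family of elements indexed by words which multiplies by shuffling the words. -/
structure IsShChar {C : Type*} [CommSemiring C] {X : Type} (U : List X → C) : Prop where
  nil : U [] = 1
  mul : ∀ l m, U l * U m = shsum l m U

/-- The free module on pairs of a multi-index and a word. -/
def DPSh (d : ℕ) (X : Type) (C : Type*) [CommRing C] : Type _ := (MIdx d × List X) →₀ C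

namespace DPSh

variable {X : Type} {C : Type*} [CommRing C]

noncomputable instance : AddCommGroup (DPSh d X C) := inferInstanceAs (AddCommGroup (_ →₀ C))

noncomputable instance : Module C (DPSh d X C) := inferInstanceAs (Module C (_ →₀ C))

/-- The basis elements. -/
noncomputable def bas (a : MIdx d) (l : List X) : DPSh d X C :=
  (Finsupp.single (a, l) 1 : (MIdx d × List X) →₀ C)

/-- The linear map with prescribed values on the basis. -/
noncomputable def lift {M : Type*} [AddCommGroup M] [Module C M] (f : MIdx d → List X → M) :
    DPSh d X C →ₗ[C] M :=
  Finsupp.linearCombination C fun q : MIdx d × List X => f q.1 q.2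

theorem lift_bas {M : Type*} [AddCommGroup M] [Module C M] (f : MIdx d → List X → M)
    (a : MIdx d) (l : List X) : lift f (bas a l : DPSh d X C) = f a l := by
  unfold lift bas
  exact (Finsupp.linearCombination_single C _ _).trans (one_smul _ _)

theorem hom_ext {M : Type*} [AddCommGroup M] [Module C M] {φ ψ : DPSh d X C →ₗ[C] M}
    (h : ∀ a l, φ (bas a l) = ψ (bas a l)) : φ = ψ :=
  Finsupp.lhom_ext' fun q => LinearMap.ext_ring (h q.1 q.2)

/-- The product, as a bilinear map. -/
noncomputable def mulHom : DPSh d X C →ₗ[C] DPSh d X C →ₗ[C] DPSh d X C :=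
  lift fun a l => lift fun b m => dpc a b • shsum l m fun s => bas (a + b) s

theorem mulHom_bas (a b : MIdx d) (l m : List X) :
    mulHom (bas a l : DPSh d X C) (bas b m) = dpc a b • shsum l m fun s => bas (a + b) s := by
  rw [mulHom, lift_bas, lift_bas]

theorem mulHom_comm (u v : DPSh d X C) : mulHom u v = mulHom v u := by
  have h : (mulHom : DPSh d X C →ₗ[C] _) = mulHom.flip := by
    refine hom_ext fun a l => hom_ext fun b m => ?_
    rw [LinearMap.flip_apply, mulHom_bas, mulHom_bas, dpc_comm, shsum, shuffle_comm, add_comm a b]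
    rfl
  exact LinearMap.congr_fun₂ h u v

theorem mulHom_assoc (u v z : DPSh d X C) :
    mulHom (mulHom u v) z = mulHom u (mulHom v z) := by
  -- Both sides are written as trilinear maps, so that they can be compared on basis elements; there
  -- the claim is `dpc_assoc` together with `shsum_assoc`.
  have h : (LinearMap.llcomp C _ _ _ mulHom ∘ₗ mulHom : DPSh d X C →ₗ[C] _) =
      (LinearMap.llcomp C (DPSh d X C) _ (DPSh d X C →ₗ[C] DPSh d X C)).flip mulHom ∘ₗ
        LinearMap.llcomp C _ _ _ ∘ₗ mulHom := by
    refine hom_ext fun a l => hom_ext fun b m => hom_ext fun c n => ?_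
    simp only [LinearMap.coe_comp, Function.comp_apply, LinearMap.llcomp_apply,
      LinearMap.flip_apply, mulHom_bas, map_nsmul, map_shsum, LinearMap.smul_apply]
    have e : ∀ s : List X, mulHom (bas (a + b) s : DPSh d X C) (bas c n) =
        dpc (a + b) c • shsum s n fun t => bas (a + b + c) t := fun s => mulHom_bas _ _ _ _
    have e' : (shsum l m fun s => mulHom (bas (a + b) s : DPSh d X C)) (bas c n) =
        shsum l m fun s => mulHom (bas (a + b) s : DPSh d X C) (bas c n) :=
      map_shsum (LinearMap.applyₗ (bas c n) : (DPSh d X C →ₗ[C] DPSh d X C) →ₗ[C] _) l m _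
    have e2 : ∀ (k : ℕ) (u v : List X) (f : List X → DPSh d X C),
        (shsum u v fun s => k • f s) = k • shsum u v f := by
      intro k u v f
      simp [shsum, Multiset.smul_sum]
    rw [e']
    simp only [e, e2, smul_smul, shsum_assoc]
    rw [dpc_assoc, add_assoc]
  exact LinearMap.congr_fun (LinearMap.congr_fun₂ h u v) z

theorem bas_mulHom_one (u : DPSh d X C) : mulHom (bas 0 []) u = u := by
  have h : mulHom (bas 0 [] : DPSh d X C) = LinearMap.id := by
    refine hom_ext fun a l => ?_
    rw [mulHom_bas, dpc_zero_left, one_smul, shsum_nil_left, zero_add]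
    rfl
  exact LinearMap.congr_fun h u

noncomputable instance : CommRing (DPSh d X C) :=
  { (inferInstance : AddCommGroup (DPSh d X C)) with
    mul := fun u v => mulHom u v
    one := bas 0 []
    left_distrib := fun u v z => map_add (mulHom u) v z
    right_distrib := fun u v z => LinearMap.map_add₂ mulHom u v z
    zero_mul := fun u => LinearMap.map_zero₂ mulHom u
    mul_zero := fun u => map_zero (mulHom u)
    mul_assoc := mulHom_assoc
    one_mul := bas_mulHom_one
    mul_one := fun u => (mulHom_comm u _).trans (bas_mulHom_one u)
    mul_comm := mulHom_comm }

noncomputable instance : Algebra C (DPSh d X C) :=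
  Algebra.ofModule (fun c u v => LinearMap.map_smul₂ mulHom c u v)
    fun c u v => map_smul (mulHom u) c v

theorem bas_mul_bas (a b : MIdx d) (l m : List X) :
    (bas a l : DPSh d X C) * bas b m = dpc a b • shsum l m fun s => bas (a + b) s :=
  mulHom_bas a b l m

theorem isDPChar_bas : IsDPChar fun a : MIdx d => (bas a [] : DPSh d X C) where
  zero := rfl
  mul a b := by rw [bas_mul_bas, shsum_nil_left, nsmul_eq_mul]

theorem isShChar_bas : IsShChar fun l : List X => (bas 0 l : DPSh d X C) where
  nil := rfl
  mul l m := by rw [bas_mul_bas, dpc_zero_left, one_smul, zero_add]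

/-- The divided powers and the words together recover the whole basis, so an identity evaluated
along these two characters determines every single coefficient. -/
theorem bas_eq (a : MIdx d) (l : List X) : (bas a l : DPSh d X C) = bas a [] * bas 0 l := by
  rw [bas_mul_bas, dpc_zero_right, one_smul, shsum_nil_left, add_zero]

end DPSh

/-! ## Weighted cuts and contractions -/

section Weighted

variable {C₀ : Type*} [CommSemiring C₀]

/-- As `cutStep`, with an additional weight `w ℓ` for the increase `ℓ` of an edge decoration. -/
def wcutStep {b : Bool} (w : MIdx d → C₀) (B : ℕ) (k : K) (e : MIdx d)
    (heads : Multiset (C₀ × PTree d K Ξ O true)) (rests : Multiset (BranchCut C₀ d K Ξ O b)) :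
    Multiset (BranchCut C₀ d K Ξ O b) :=
  (Finset.Iic (fun _ => B : MIdx d)).val.bind fun ℓ =>
    heads.bind fun h => rests.map fun t =>
      ⟨h.1 * t.coef * (mchoose (t.shift + ℓ) ℓ : C₀) * w ℓ, t.red, t.shift + ℓ,
        ⟨k, e + ℓ, h.2⟩ :: t.own, t.deep, t.kept⟩

/-- Left admissible cuts inside the branches at a vertex, where a tree that is cut off is replaced
by its weighted images under `H`. -/
def cutsWith (w : MIdx d → C₀) (B : ℕ) (H : PTree d K Ξ O true → Multiset (C₀ × PTree d K Ξ O true)) :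
    Bool → {b : Bool} → Branches d K Ξ O b → Multiset (BranchCut C₀ d K Ξ O b)
  | _, _, .nil => nilStep
  | true, _, .kernel k e n o above rest =>
      wcutStep w B k e (H ⟨n, o, above⟩) (cutsWith w B H true rest) +
        keepStep k e (closeVertex n o (cutsWith w B H true above)) (cutsWith w B H false rest)
  | false, _, .kernel k e n o above rest =>
      keepStep k e (closeVertex n o (cutsWith w B H true above)) (cutsWith w B H false rest)
  | _, _, .noise ξ e n o rest => noiseStep ξ e n o (cutsWith w B H false rest)

/-- A tree with weight `1`. -/
def unitHead (t : PTree d K Ξ O true) : Multiset (C₀ × PTree d K Ξ O true) := {(1, t)}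

/-- As `contractVertex`, with an arbitrary weight `p σ` for a contracted subtree `σ` and an arbitrary
decoration `g σ` of the resulting vertex. -/
def wcontractVertex (p : PTree d K Ξ O true → C₀) (g : PTree d K Ξ O true → O) (n : MIdx d) (o : O)
    (A : Multiset (C₀ × Branches d K Ξ O true)) (E : Multiset (BranchCut C₀ d K Ξ O true)) :
    Multiset (C₀ × PTree d K Ξ O true) :=
  A.map (fun q => (q.1, ⟨n, o, q.2⟩)) +
    (closeVertex n o E).map fun s =>
      (s.coef * p s.trunk, ⟨s.red, g s.trunk, ofLimbs s.pruned⟩)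

mutual

/-- As `contract`, with arbitrary weights. -/
def wcontract (w : MIdx d → C₀) (B : ℕ) (p : PTree d K Ξ O true → C₀) (g : PTree d K Ξ O true → O) :
    {b : Bool} → Branches d K Ξ O b → Multiset (C₀ × Branches d K Ξ O b)
  | _, .nil => {(1, .nil)}
  | _, .kernel k e n o above rest =>
      (wcontractVertex p g n o (wcontract w B p g above) (wextract w B p g true above)).bind fun h =>
        (wcontract w B p g rest).map fun q =>
          (h.1 * q.1, .kernel k e h.2.dec h.2.exdec h.2.br q.2)
  | _, .noise ξ e n o rest =>
      (wcontract w B p g rest).map fun q => (q.1, .noise ξ e n o q.2)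

/-- As `extract`, with arbitrary weights. -/
def wextract (w : MIdx d → C₀) (B : ℕ) (p : PTree d K Ξ O true → C₀) (g : PTree d K Ξ O true → O) :
    Bool → {b : Bool} → Branches d K Ξ O b → Multiset (BranchCut C₀ d K Ξ O b)
  | _, _, .nil => nilStep
  | true, _, .kernel k e n o above rest =>
      wcutStep w B k e
          (wcontractVertex p g n o (wcontract w B p g above) (wextract w B p g true above))
          (wextract w B p g true rest) +
        keepStep k e (closeVertex n o (wextract w B p g true above)) (wextract w B p g false rest)
  | false, _, .kernel k e n o above rest =>
      keepStep k e (closeVertex n o (wextract w B p g true above)) (wextract w B p g false rest)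
  | _, _, .noise ξ e n o rest => noiseStep ξ e n o (wextract w B p g false rest)

end

/-- All weighted contractions of a tree. -/
def contractTree (w : MIdx d → C₀) (B : ℕ) (p : PTree d K Ξ O true → C₀)
    (g : PTree d K Ξ O true → O) (t : PTree d K Ξ O true) : Multiset (C₀ × PTree d K Ξ O true) :=
  wcontractVertex p g t.dec t.exdec (wcontract w B p g t.br) (wextract w B p g true t.br)

/-- Extracting a subtree is a left admissible cut whose cut-off trees are replaced by their
contractions. A single recursion `cutsWith` therefore serves recentering and renormalisation, with
different `H`. -/
theorem wextract_eq_cutsWith (w : MIdx d → C₀) (B : ℕ) (p : PTree d K Ξ O true → C₀)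
    (g : PTree d K Ξ O true → O) (c : Bool) {b : Bool} (br : Branches d K Ξ O b) :
    wextract w B p g c br = cutsWith w B (contractTree w B p g) c br := by
  induction br generalizing c with
  | nil => cases c <;> simp only [wextract, cutsWith]
  | kernel k e n o above rest ih1 ih2 =>
    cases c <;> simp only [wextract, cutsWith, contractTree, ih1, ih2]
  | noise ξ e n o rest ih => cases c <;> simp only [wextract, cutsWith, ih]

end Weighted

/-! ## Evaluation along characters -/

section Evaluation

variable {C₀ C : Type*} [CommSemiring C₀] [CommSemiring C] {M : Type*} [AddCommMonoid M] [Module C M]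

/-- Map the weights of a multiset of weighted points. -/
def mapWeight {A : Type*} (i : C₀ →+* C) (T : Multiset (C₀ × A)) : Multiset (C × A) :=
  T.map fun q => (i q.1, q.2)

/-- Evaluate the reductions and the deep limbs of terms along characters; what remains are the shift,
the limbs cut off at the vertex and the branches that are kept. -/
def evalBranch (i : C₀ →+* C) (x : MIdx d → C) (U : List (Limb d K Ξ O) → C) {b : Bool}
    (T : Multiset (BranchCut C₀ d K Ξ O b)) :
    Multiset (C × MIdx d × List (Limb d K Ξ O) × Branches d K Ξ O b) :=
  T.map fun t => (i t.coef * x t.red * U t.deep, t.shift, t.own, t.kept)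

/-- Evaluate the reductions and the pruned limbs of terms along characters; what remains is the
trunk. -/
def evalTree (i : C₀ →+* C) (x : MIdx d → C) (U : List (Limb d K Ξ O) → C) {b : Bool}
    (T : Multiset (TreeCut C₀ d K Ξ O b)) : Multiset (C × PTree d K Ξ O b) :=
  T.map fun s => (i s.coef * x s.red * U s.pruned, s.trunk)

theorem wsum_mapWeight {A : Type*} (i : C₀ →+* C) (T : Multiset (C₀ × A)) (f : A → M) :
    wsum (mapWeight i T) f = (T.map fun q => i q.1 • f q.2).sum := by
  simp [wsum, mapWeight]

theorem wsum_evalBranch (i : C₀ →+* C) (x : MIdx d → C) (U : List (Limb d K Ξ O) → C) {b : Bool}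
    (T : Multiset (BranchCut C₀ d K Ξ O b))
    (F : MIdx d × List (Limb d K Ξ O) × Branches d K Ξ O b → M) :
    wsum (evalBranch i x U T) F =
      (T.map fun t => (i t.coef * x t.red * U t.deep) • F (t.shift, t.own, t.kept)).sum := by
  simp [wsum, evalBranch]

theorem wsum_evalTree (i : C₀ →+* C) (x : MIdx d → C) (U : List (Limb d K Ξ O) → C) {b : Bool}
    (T : Multiset (TreeCut C₀ d K Ξ O b)) (f : PTree d K Ξ O b → M) :
    wsum (evalTree i x U T) f =
      (T.map fun s => (i s.coef * x s.red * U s.pruned) • f s.trunk).sum := by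
  simp [wsum, evalTree]

theorem evalBranch_add (i : C₀ →+* C) (x : MIdx d → C) (U : List (Limb d K Ξ O) → C) {b : Bool}
    (T T' : Multiset (BranchCut C₀ d K Ξ O b)) :
    evalBranch i x U (T + T') = evalBranch i x U T + evalBranch i x U T' :=
  Multiset.map_add _ _ _

theorem sum_map_smul_comm {A B : Type*} (S : Multiset A) (T : Multiset B) (c : B → C)
    (f : A → B → M) :
    (S.map fun a => (T.map fun b => c b • f a b).sum).sum =
      (T.map fun b => c b • (S.map fun a => f a b).sum).sum := by
  induction S using Multiset.induction_on with
  | empty => simp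
  | cons a S ih => simp [ih, Multiset.sum_map_add]

section Char

variable (i : C₀ →+* C) {x : MIdx d → C} {U : List (Limb d K Ξ O) → C}

theorem wsum_nilStep (hx : IsDPChar x) (hU : IsShChar U) {b : Bool}
    (F : MIdx d × List (Limb d K Ξ O) × Branches d K Ξ O b → M) :
    wsum (evalBranch i x U nilStep) F = F (0, [], .nil) := by
  simp [wsum_evalBranch, nilStep, hx.zero, hU.nil]

theorem wsum_wcutStep {b : Bool} (w : MIdx d → C₀) (B : ℕ) (k : K) (e : MIdx d)
    (heads : Multiset (C₀ × PTree d K Ξ O true)) (rests : Multiset (BranchCut C₀ d K Ξ O b))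
    (F : MIdx d × List (Limb d K Ξ O) × Branches d K Ξ O b → M) :
    wsum (evalBranch i x U (wcutStep w B k e heads rests)) F =
      ∑ ℓ ∈ Finset.Iic (fun _ => B : MIdx d), i (w ℓ) • wsum (mapWeight i heads) fun h =>
        wsum (evalBranch i x U rests) fun t =>
          dpc t.1 ℓ • F (t.1 + ℓ, ⟨k, e + ℓ, h⟩ :: t.2.1, t.2.2) := by
  simp only [wsum_evalBranch, wsum_mapWeight, wcutStep, Multiset.map_bind, Multiset.sum_bind,
    Multiset.map_map, Function.comp_def, Finset.sum, Multiset.smul_sum]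
  refine congrArg Multiset.sum (Multiset.map_congr rfl fun ℓ _ => congrArg Multiset.sum
    (Multiset.map_congr rfl fun h _ => congrArg Multiset.sum (Multiset.map_congr rfl fun t _ => ?_)))
  rw [mchoose_add_right, ← Nat.cast_smul_eq_nsmul C, smul_smul, smul_smul, smul_smul]
  simp only [map_mul, map_natCast]
  congr 1
  ring

/-- The binomial coefficient of the reductions and the shuffle of the limbs are the structure
constants in `IsDPChar` and `IsShChar`. Along the characters they are absorbed into a product of a
factor for the tree above the edge and a factor for the edges to its right. -/
theorem wsum_keepStep (hx : IsDPChar x) (hU : IsShChar U) {b : Bool} (k : K) (e : MIdx d)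
    (aboves : Multiset (TreeCut C₀ d K Ξ O true)) (rests : Multiset (BranchCut C₀ d K Ξ O b))
    (F : MIdx d × List (Limb d K Ξ O) × Branches d K Ξ O b → M) :
    wsum (evalBranch i x U (keepStep k e aboves rests)) F =
      wsum (evalTree i x U aboves) fun τ => wsum (evalBranch i x U rests) fun t =>
        F (t.1, t.2.1, .kernel k e τ.dec τ.exdec τ.br t.2.2) := by
  simp only [wsum_evalBranch, wsum_evalTree, keepStep, Multiset.map_bind, Multiset.sum_bind,
    Multiset.map_map, Function.comp_def, Multiset.smul_sum]
  refine congrArg Multiset.sum (Multiset.map_congr rfl fun s _ => congrArg Multiset.sum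
    (Multiset.map_congr rfl fun t _ => ?_))
  have h1 := hx.mul s.red t.red
  have h2 := hU.mul s.pruned t.deep
  rw [smul_smul]
  have h3 : i s.coef * x s.red * U s.pruned * (i t.coef * x t.red * U t.deep) =
      (i s.coef * i t.coef * (dpc s.red t.red : C) * x (s.red + t.red)) *
        shsum s.pruned t.deep U := by
    rw [← h2, mul_assoc (i s.coef * i t.coef), ← h1]; ring
  rw [h3, shsum, ← smul_smul,
    Multiset.sum_smul, Multiset.smul_sum, Multiset.map_map, Multiset.map_map]
  refine congrArg Multiset.sum (Multiset.map_congr rfl fun l _ => ?_)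
  simp only [Function.comp_apply, smul_smul, map_mul, map_natCast, dpc]

theorem wsum_noiseStep (ξ : Ξ) (e n : MIdx d) (o : O)
    (rests : Multiset (BranchCut C₀ d K Ξ O false))
    (F : MIdx d × List (Limb d K Ξ O) × Branches d K Ξ O true → M) :
    wsum (evalBranch i x U (noiseStep ξ e n o rests)) F =
      wsum (evalBranch i x U rests) fun t => F (t.1, t.2.1, .noise ξ e n o t.2.2) := by
  simp [wsum_evalBranch, noiseStep]

/-- As for `wsum_keepStep`, now for the reduction `a` of the vertex itself and the limbs cut off at
it. The binomial with the shift stays, since it concerns the decoration of the trunk, which is not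
evaluated. -/
theorem wsum_closeVertex (hx : IsDPChar x) (hU : IsShChar U) {b : Bool} (n : MIdx d) (o : O)
    (terms : Multiset (BranchCut C₀ d K Ξ O b)) (f : PTree d K Ξ O b → M) :
    wsum (evalTree i x U (closeVertex n o terms)) f =
      wsum (evalBranch i x U terms) fun t => dsum n fun a r =>
        (x a * U t.2.1) • dpc r t.1 • f ⟨r + t.1, o, t.2.2⟩ := by
  simp only [wsum_evalBranch, wsum_evalTree, closeVertex, Multiset.map_bind, Multiset.sum_bind,
    Multiset.map_map, Function.comp_def, dsum, Finset.sum]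
  rw [← sum_map_smul_comm]
  refine congrArg Multiset.sum (Multiset.map_congr rfl fun a _ => congrArg Multiset.sum
    (Multiset.map_congr rfl fun t _ => ?_))
  have h1 := hx.mul a t.red
  have h2 := hU.mul t.own t.deep
  rw [← Nat.cast_smul_eq_nsmul C, smul_smul, smul_smul]
  have h3 : i t.coef * x t.red * U t.deep * (x a * U t.own * (dpc (n - a) t.shift : C)) =
      (i t.coef * (dpc (n - a) t.shift : C) * (dpc a t.red : C) * x (a + t.red)) *
        shsum t.own t.deep U := by
    rw [← h2, mul_assoc (i t.coef * (dpc (n - a) t.shift : C)), ← h1]; ring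
  rw [mul_assoc (i t.coef * x t.red * U t.deep), h3, shsum, ← smul_smul,
    Multiset.sum_smul, Multiset.smul_sum, Multiset.map_map, Multiset.map_map]
  refine congrArg Multiset.sum (Multiset.map_congr rfl fun l _ => ?_)
  simp only [Function.comp_apply, smul_smul, map_mul, map_natCast, mchoose_add_right, Nat.cast_mul]
  congr 1
  simp only [dpc]
  ring

end Char

end Evaluation

/-! ## Rules and characters -/

/-- The data of a weighted contraction procedure. -/
structure Rule (d : ℕ) (K Ξ O : Type) (C₀ : Type*) where
  w : MIdx d → C₀
  B : ℕ
  p : PTree d K Ξ O true → C₀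
  g : PTree d K Ξ O true → O

/-- Characters on the divided powers and on the words of limbs. -/
structure Chars (d : ℕ) (K Ξ O : Type) (C : Type*) [CommSemiring C] where
  x : MIdx d → C
  U : List (Limb d K Ξ O) → C
  isDP : IsDPChar x
  isSh : IsShChar U

/-- The limbs among the branches at a vertex. -/
def limbsOf : {b : Bool} → Branches d K Ξ O b → List (Limb d K Ξ O)
  | _, .nil => []
  | _, .kernel k e n o above rest => ⟨k, e, ⟨n, o, above⟩⟩ :: limbsOf rest
  | _, .noise _ _ _ _ rest => limbsOf rest

theorem limbsOf_ofLimbs {b : Bool} (l : List (Limb d K Ξ O)) :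
    limbsOf (ofLimbs l : Branches d K Ξ O b) = l := by
  induction l with
  | nil => rfl
  | cons x l ih => simp only [ofLimbs, limbsOf, ih]

/-- The weighted limbs of the form of `z` with weighted trees on top. -/
def onLimb {C : Type*} (T : PTree d K Ξ O true → Multiset (C × PTree d K Ξ O true))
    (z : Limb d K Ξ O) : Multiset (C × Limb d K Ξ O) :=
  (T z.tree).map fun h => (h.1, ⟨z.k, z.e, h.2⟩)

section Recursion

variable {C₀ C : Type*} [CommSemiring C₀] [CommSemiring C] {M : Type*} [AddCommMonoid M] [Module C M]

theorem wsum_onLimb (T : PTree d K Ξ O true → Multiset (C × PTree d K Ξ O true))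
    (z : Limb d K Ξ O) (f : Limb d K Ξ O → M) :
    wsum (onLimb T z) f = wsum (T z.tree) fun h => f ⟨z.k, z.e, h⟩ := by
  simp [wsum, onLimb]

variable (r : Rule d K Ξ O C₀) (i : C₀ →+* C) (χ : Chars d K Ξ O C)
  (H : PTree d K Ξ O true → Multiset (C₀ × PTree d K Ξ O true))

/-- The evaluation of cuts inside the branches at a vertex. -/
def cutB (c : Bool) {b : Bool} (br : Branches d K Ξ O b) :
    Multiset (C × MIdx d × List (Limb d K Ξ O) × Branches d K Ξ O b) :=
  evalBranch i χ.x χ.U (cutsWith r.w r.B H c br)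

/-- The evaluation of cuts of a tree. -/
def cutT (t : PTree d K Ξ O true) : Multiset (C × PTree d K Ξ O true) :=
  evalTree i χ.x χ.U (closeVertex t.dec t.exdec (cutsWith r.w r.B H true t.br))

/-- All weighted contractions of a tree. -/
def Rule.heads (t : PTree d K Ξ O true) : Multiset (C₀ × PTree d K Ξ O true) :=
  contractTree r.w r.B r.p r.g t

/-- The evaluation of contractions of a tree. -/
def conT (t : PTree d K Ξ O true) : Multiset (C × PTree d K Ξ O true) := mapWeight i (r.heads t)

/-- The evaluation of contractions inside the branches at a vertex. -/
def conB {b : Bool} (br : Branches d K Ξ O b) : Multiset (C × Branches d K Ξ O b) :=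
  mapWeight i (wcontract r.w r.B r.p r.g br)

/-- The evaluation of contractions inside a list of limbs. -/
def conL (l : List (Limb d K Ξ O)) : Multiset (C × List (Limb d K Ξ O)) :=
  substList (onLimb (conT r i)) l

theorem cutB_nil (c : Bool) {b : Bool} (F : MIdx d × List (Limb d K Ξ O) × Branches d K Ξ O b → M) :
    wsum (cutB r i χ H c .nil) F = F (0, [], .nil) := by
  cases c <;> simp only [cutB, cutsWith] <;> exact wsum_nilStep i χ.isDP χ.isSh F

theorem cutB_noise (c : Bool) (ξ : Ξ) (e n : MIdx d) (o : O) (rest : Branches d K Ξ O false)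
    (F : MIdx d × List (Limb d K Ξ O) × Branches d K Ξ O true → M) :
    wsum (cutB r i χ H c (.noise ξ e n o rest)) F =
      wsum (cutB r i χ H false rest) fun t => F (t.1, t.2.1, .noise ξ e n o t.2.2) := by
  cases c <;> simp only [cutB, cutsWith, wsum_noiseStep]

theorem cutB_false_kernel {b : Bool} (k : K) (e n : MIdx d) (o : O) (above : Branches d K Ξ O true)
    (rest : Branches d K Ξ O b) (F : MIdx d × List (Limb d K Ξ O) × Branches d K Ξ O b → M) :
    wsum (cutB r i χ H false (.kernel k e n o above rest)) F =
      wsum (cutT r i χ H ⟨n, o, above⟩) fun τ => wsum (cutB r i χ H false rest) fun t =>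
        F (t.1, t.2.1, .kernel k e τ.dec τ.exdec τ.br t.2.2) := by
  simp only [cutB, cutT, cutsWith, wsum_keepStep i χ.isDP χ.isSh]

theorem cutB_true_kernel {b : Bool} (k : K) (e n : MIdx d) (o : O) (above : Branches d K Ξ O true)
    (rest : Branches d K Ξ O b) (F : MIdx d × List (Limb d K Ξ O) × Branches d K Ξ O b → M) :
    wsum (cutB r i χ H true (.kernel k e n o above rest)) F =
      (∑ ℓ ∈ Finset.Iic (fun _ => r.B : MIdx d), i (r.w ℓ) •
        wsum (mapWeight i (H ⟨n, o, above⟩)) fun h => wsum (cutB r i χ H true rest) fun t =>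
          dpc t.1 ℓ • F (t.1 + ℓ, ⟨k, e + ℓ, h⟩ :: t.2.1, t.2.2)) +
      wsum (cutT r i χ H ⟨n, o, above⟩) fun τ => wsum (cutB r i χ H false rest) fun t =>
        F (t.1, t.2.1, .kernel k e τ.dec τ.exdec τ.br t.2.2) := by
  simp only [cutB, cutT, cutsWith, evalBranch_add, wsum_add_left, wsum_wcutStep,
    wsum_keepStep i χ.isDP χ.isSh]

theorem cutT_mk (n : MIdx d) (o : O) (br : Branches d K Ξ O true) (f : PTree d K Ξ O true → M) :
    wsum (cutT r i χ H ⟨n, o, br⟩) f =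
      wsum (cutB r i χ H true br) fun t => dsum n fun a q =>
        (χ.x a * χ.U t.2.1) • dpc q t.1 • f ⟨q + t.1, o, t.2.2⟩ := by
  simp only [cutB, cutT, wsum_closeVertex i χ.isDP χ.isSh]

/-- An edge can be cut only if all edges to its left at the vertex are cut. Once one of them is
kept, no limb is cut off at this vertex any more and the shift is zero. -/
theorem cutB_false {b : Bool} (br : Branches d K Ξ O b)
    (F : MIdx d × List (Limb d K Ξ O) × Branches d K Ξ O b → M) :
    wsum (cutB r i χ H false br) F = wsum (cutB r i χ H false br) fun t => F (0, [], t.2.2) := by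
  induction br with
  | nil => simp only [cutB_nil]
  | kernel k e n o above rest ih1 ih2 =>
    simp only [cutB_false_kernel]
    refine congrArg _ (funext fun τ => ?_)
    rw [ih2]
  | noise ξ e n o rest ih =>
    simp only [cutB_noise]
    rw [ih]

theorem wsum_mapWeight_unitHead (t : PTree d K Ξ O true) (f : PTree d K Ξ O true → M) :
    wsum (mapWeight i (unitHead t)) f = f t := by
  simp [wsum, mapWeight, unitHead]

theorem conB_nil {b : Bool} (F : Branches d K Ξ O b → M) : wsum (conB r i .nil) F = F .nil := by
  simp [wsum, conB, mapWeight, wcontract]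

theorem conB_noise (ξ : Ξ) (e n : MIdx d) (o : O) (rest : Branches d K Ξ O false)
    (F : Branches d K Ξ O true → M) :
    wsum (conB r i (.noise ξ e n o rest)) F =
      wsum (conB r i rest) fun κ => F (.noise ξ e n o κ) := by
  simp [wsum, conB, mapWeight, wcontract]

theorem conB_kernel {b : Bool} (k : K) (e n : MIdx d) (o : O) (above : Branches d K Ξ O true)
    (rest : Branches d K Ξ O b) (F : Branches d K Ξ O b → M) :
    wsum (conB r i (.kernel k e n o above rest)) F =
      wsum (conT r i ⟨n, o, above⟩) fun h => wsum (conB r i rest) fun κ =>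
        F (.kernel k e h.dec h.exdec h.br κ) := by
  simp [wsum, conB, conT, mapWeight, wcontract, Rule.heads, contractTree, Multiset.map_bind,
    Multiset.sum_bind, Multiset.smul_sum, mul_smul]

theorem conL_nil (f : List (Limb d K Ξ O) → M) : wsum (conL r i []) f = f [] :=
  wsum_substList_nil _ f

theorem conL_cons (z : Limb d K Ξ O) (l : List (Limb d K Ξ O)) (f : List (Limb d K Ξ O) → M) :
    wsum (conL r i (z :: l)) f =
      wsum (conT r i z.tree) fun h => wsum (conL r i l) fun m => f (⟨z.k, z.e, h⟩ :: m) := by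
  simp only [conL, wsum_substList_cons, wsum_onLimb]

theorem conB_ofLimbs {b : Bool} (l : List (Limb d K Ξ O)) (F : Branches d K Ξ O b → M) :
    wsum (conB r i (ofLimbs l)) F = wsum (conL r i l) fun m => F (ofLimbs m) := by
  induction l generalizing F with
  | nil => simp only [ofLimbs, conB_nil, conL_nil]
  | cons z l ih => simp only [ofLimbs, conB_kernel, conL_cons, ih]

end Recursion

/-! ## New characters from old ones -/

section Chars

variable {C₀ C : Type*} [CommSemiring C₀] [CommSemiring C]

theorem isShChar_substList {X Y : Type} (σ : X → Multiset (C × Y)) {U : List Y → C}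
    (hU : IsShChar U) : IsShChar fun l => wsum (substList σ l) U where
  nil := by rw [wsum_substList_nil, hU.nil]
  mul l m := by
    rw [shsum_substList]
    simp only [← hU.mul, wsum_mul_left]
    rw [← smul_eq_mul, ← wsum_smul_right]
    simp only [smul_eq_mul]

theorem mul_dcsum {X : Type} (l : List X) (c : C) (f : List X → List X → C) :
    c * dcsum l f = dcsum l fun a b => c * f a b := by
  induction l generalizing f with
  | nil => rfl
  | cons x l ih => simp only [dcsum, mul_add, ih]

theorem dcsum_mul {X : Type} (l : List X) (c : C) (f : List X → List X → C) :
    dcsum l f * c = dcsum l fun a b => f a b * c := by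
  simp only [mul_comm _ c, mul_dcsum]

/-- The convolution of two shuffle characters is a shuffle character because deconcatenation is
multiplicative (`shsum_dcsum`). -/
theorem isShChar_dcsum {X : Type} {U V : List X → C} (hU : IsShChar U) (hV : IsShChar V) :
    IsShChar fun l => dcsum l fun a b => U a * V b where
  nil := by simp [dcsum, hU.nil, hV.nil]
  mul l m := by
    rw [shsum_dcsum, dcsum_mul]
    simp only [mul_dcsum]
    refine congrArg _ (funext fun a => funext fun b => congrArg _ (funext fun a' => funext fun b' => ?_))
    have h1 := hU.mul a a'
    have h2 := hV.mul b b'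
    rw [mul_mul_mul_comm, h1, h2]
    simp only [shsum, Multiset.sum_map_mul_left, Multiset.sum_map_mul_right]

/-- The analogue for divided powers, from `nsmul_dsum_add`. -/
theorem isDPChar_dsum {x y : MIdx d → C} (hx : IsDPChar x) (hy : IsDPChar y) :
    IsDPChar fun n => dsum n fun a b => x a * y b where
  zero := by rw [dsum_zero, hx.zero, hy.zero, mul_one]
  mul p q := by
    rw [← nsmul_eq_mul, nsmul_dsum_add]
    simp only [dsum, Finset.sum_mul_sum]
    refine Finset.sum_congr rfl fun a _ => Finset.sum_congr rfl fun b _ => ?_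
    rw [mul_mul_mul_comm, hx.mul, hy.mul, nsmul_eq_mul, Nat.cast_mul]
    ring

variable (r : Rule d K Ξ O C₀) (i : C₀ →+* C) (χ η : Chars d K Ξ O C)

/-- Contract inside the limbs before evaluating. -/
def Chars.con : Chars d K Ξ O C where
  x := χ.x
  U := fun l => wsum (conL r i l) χ.U
  isDP := χ.isDP
  isSh := isShChar_substList _ χ.isSh

theorem cutB_ofLimbs_false {M : Type*} [AddCommMonoid M] [Module C M] (l : List (Limb d K Ξ O))
    (F : MIdx d × List (Limb d K Ξ O) × Branches d K Ξ O true → M) :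
    wsum (cutB r i χ unitHead false (ofLimbs l : Branches d K Ξ O true)) F =
      wsum (substList (onLimb (cutT r i χ unitHead)) l) fun m => F (0, [], ofLimbs m) := by
  induction l generalizing F with
  | nil => simp only [ofLimbs, cutB_nil, wsum_substList_nil]
  | cons z l ih => simp only [ofLimbs, cutB_false_kernel, wsum_substList_cons, wsum_onLimb, ih]

/-- The deformed copies of a limb. -/
def shiftLimb (z : Limb d K Ξ O) : Multiset (C × Limb d K Ξ O) :=
  (Finset.Iic (fun _ => r.B : MIdx d)).val.map fun ℓ => (i (r.w ℓ) * η.x ℓ, ⟨z.k, z.e + ℓ, z.tree⟩)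

/-- At a vertex with kernel edges only, a left admissible cut removes an initial segment of the
limbs and keeps the final one. The binomials of the shifts are absorbed by `η.x`, so each removed
limb contributes its own factor. This exhibits `U` in `Chars.comp` as a convolution of two shuffle
characters. -/
theorem cutB_ofLimbs_true (l : List (Limb d K Ξ O)) (U : List (Limb d K Ξ O) → C)
    (V : Branches d K Ξ O true → C) :
    (wsum (cutB r i χ unitHead true (ofLimbs l : Branches d K Ξ O true)) fun t =>
        η.x t.1 * U t.2.1 * V t.2.2) =
      dcsum l fun a b => wsum (substList (shiftLimb r i η) a) U *
        wsum (substList (onLimb (cutT r i χ unitHead)) b) fun m => V (ofLimbs m) := by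
  induction l generalizing U with
  | nil => simp [ofLimbs, cutB_nil, wsum_substList_nil, dcsum, η.isDP.zero]
  | cons z l ih =>
    have h : (wsum (cutB r i χ unitHead false (ofLimbs (z :: l) : Branches d K Ξ O true)) fun t =>
        η.x t.1 * U t.2.1 * V t.2.2) = U [] *
          wsum (substList (onLimb (cutT r i χ unitHead)) (z :: l)) fun m => V (ofLimbs m) := by
      rw [cutB_ofLimbs_false]
      simp only [η.isDP.zero, one_mul, wsum_mul_left]
    simp only [ofLimbs, cutB_false_kernel] at h
    simp only [ofLimbs, cutB_true_kernel, wsum_mapWeight_unitHead, h, dcsum, wsum_substList_nil]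
    rw [add_comm]
    congr 1
    -- The divided power rule for `η.x` detaches the increase `ℓ` of the leftmost limb from the
    -- shifts of the other ones.
    have h1 : ∀ ℓ, (wsum (cutB r i χ unitHead true (ofLimbs l : Branches d K Ξ O true)) fun t =>
        dpc t.1 ℓ • (η.x (t.1 + ℓ) * U (⟨z.k, z.e + ℓ, z.tree⟩ :: t.2.1) * V t.2.2)) =
        η.x ℓ * dcsum l fun a b =>
          (wsum (substList (shiftLimb r i η) a) fun m => U (⟨z.k, z.e + ℓ, z.tree⟩ :: m)) *
          wsum (substList (onLimb (cutT r i χ unitHead)) b) fun m => V (ofLimbs m) := by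
      intro ℓ
      rw [← ih, ← wsum_mul_left]
      refine congrArg _ (funext fun t => ?_)
      rw [nsmul_eq_mul, ← mul_assoc, ← mul_assoc, ← η.isDP.mul]
      ring
    simp only [h1, wsum_substList_cons, smul_eq_mul, mul_dcsum]
    have h2 : ∀ (s : Finset (MIdx d)) (f : MIdx d → List (Limb d K Ξ O) → List (Limb d K Ξ O) → C),
        ∑ ℓ ∈ s, dcsum l (f ℓ) = dcsum l fun a b => ∑ ℓ ∈ s, f ℓ a b := by
      intro s f
      clear h h1 ih
      induction l generalizing f with
      | nil => rfl
      | cons y l ih => simp only [dcsum, Finset.sum_add_distrib, ih]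
    rw [h2]
    refine congrArg _ (funext fun a => funext fun b => ?_)
    simp only [← mul_assoc, ← Finset.sum_mul]
    congr 1
    simp only [wsum, shiftLimb, Multiset.map_map, Function.comp_def, smul_eq_mul]
    rfl

/-- Cut the words of limbs, evaluate what is cut off along `χ` and what is kept along `η`. -/
def Chars.comp : Chars d K Ξ O C where
  x := fun n => dsum n fun a b => χ.x a * η.x b
  U := fun l => wsum (cutB r i χ unitHead true (ofLimbs l : Branches d K Ξ O true)) fun t =>
    η.x t.1 * χ.U t.2.1 * η.U (limbsOf t.2.2)
  isDP := isDPChar_dsum χ.isDP η.isDP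
  isSh := by
    have h := isShChar_dcsum (isShChar_substList (shiftLimb r i η) χ.isSh)
      (isShChar_substList (onLimb (cutT r i χ unitHead)) η.isSh)
    convert h using 2 with l
    rw [cutB_ofLimbs_true r i χ η l χ.U fun κ => η.U (limbsOf κ)]
    simp only [limbsOf_ofLimbs]

end Chars

/-! ## Cuts and contractions commute -/

-- Multi-index identities behind the commutation

section Pointwise

variable {C M : Type*} [CommSemiring C] [AddCommMonoid M] [Module C M]

theorem smul_dsum (c : C) (n : MIdx d) (f : MIdx d → MIdx d → M) :
    c • dsum n f = dsum n fun a b => c • f a b := Finset.smul_sum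

theorem dsum_smul (n : MIdx d) (f : MIdx d → MIdx d → C) (m : M) :
    dsum n f • m = dsum n fun a b => f a b • m := Finset.sum_smul

theorem dsum_comm (n m : MIdx d) (f : MIdx d → MIdx d → MIdx d → MIdx d → M) :
    (dsum n fun a b => dsum m fun a' b' => f a b a' b') =
      dsum m fun a' b' => dsum n fun a b => f a b a' b' := Finset.sum_comm

theorem dpc_mul_swap (s u ℓ : MIdx d) :
    dpc s u * dpc (s + u) ℓ = dpc s ℓ * dpc (s + ℓ) u := by
  rw [dpc_assoc, dpc_assoc, dpc_comm u ℓ, add_comm u ℓ]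

/-- The coefficients of an edge that leaves the extracted subtree and is then cut. On the left, `ℓ`
comes from the extraction and `ℓ'` from the later cut. On the right, the cut comes first with the
total `m`, and the contraction then splits the enlarged decoration `n + m`. By `nsmul_dsum_add` this
splits `n` and `m` separately, and `sum_smul_dsum` turns the sum over `m` and its splittings into
the sum over `ℓ` and `ℓ'`. -/
theorem sum_cut_cut (S : Finset (MIdx d)) (hS : IsLowerSet (S : Set (MIdx d))) (W : MIdx d → C)
    (hw : ∀ a b, W (a + b) = W a * W b) (h0 : ∀ a, a ∉ S → W a = 0) (n u : MIdx d)
    (Φ : MIdx d → MIdx d → MIdx d → M) :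
    ∑ ℓ ∈ S, ∑ ℓ' ∈ S, (dsum n fun s' s => dpc s u • W ℓ • W ℓ' • dpc (s + u) ℓ • dpc s' ℓ' •
        Φ (ℓ + ℓ') (s + u + ℓ) (s' + ℓ')) =
      ∑ m ∈ S, W m • dpc n m • dsum (n + m) fun s' s => dpc s u • Φ m (s + u) s' := by
  have h1 : ∀ m ∈ S, W m • dpc n m • (dsum (n + m) fun s' s => dpc s u • Φ m (s + u) s') =
      W m • dsum m fun ℓ' ℓ => dsum n fun s' s => (dpc s' ℓ' * (dpc s u * dpc (s + u) ℓ)) •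
        Φ (ℓ + ℓ') (s + u + ℓ) (s' + ℓ') := by
    intro m _
    rw [nsmul_dsum_add, dsum_comm]
    congr 1
    refine dsum_congr fun ℓ' ℓ e => congrArg _ (funext fun s' => funext fun s => ?_)
    subst e
    rw [smul_smul, dpc_mul_swap, mul_assoc, add_comm ℓ ℓ', add_right_comm]
  rw [Finset.sum_congr rfl h1, sum_smul_dsum S hS W hw h0, Finset.sum_comm]
  refine Finset.sum_congr rfl fun ℓ' _ => Finset.sum_congr rfl fun ℓ _ => ?_
  rw [smul_dsum, smul_dsum]
  refine congrArg _ (funext fun s' => funext fun s => ?_)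
  simp only [← Nat.cast_smul_eq_nsmul C, smul_smul]
  congr 1
  push_cast
  ring

/-- The decoration `n` of a vertex of an extracted subtree is split into three parts: one for the
root of the pruned tree (along `χ`), one for the contracted vertex (along `η`), and one that stays.
The two sides make the two splittings in opposite orders, so they agree by coassociativity;
`nsmul_dsum_add` separates the shift `m` from the part of `n` to which it has been added. -/
theorem dsum_close (χ η : MIdx d → C) (hη : IsDPChar η) (n m u : MIdx d) (f : MIdx d → M) :
    (dsum m fun s' s => dpc s u • η s' • dsum n fun a q => (dsum a fun b c => χ b * η c) •
        dpc q (s + u) • f (q + (s + u))) =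
      dsum n fun b q => χ b • dpc q m • dsum (q + m) fun a v => η a • dpc v u • f (v + u) := by
  have h1 : ∀ b q, χ b • dpc q m • (dsum (q + m) fun a v => η a • dpc v u • f (v + u)) =
      dsum q fun c q' => dsum m fun s' s => χ b • dpc s u • η s' • η c • dpc q' (s + u) •
        f (q' + (s + u)) := by
    intro b q
    rw [nsmul_dsum_add, smul_dsum]
    refine congrArg _ (funext fun c => funext fun q' => ?_)
    rw [smul_dsum]
    refine congrArg _ (funext fun s' => funext fun s => ?_)
    congr 1
    have h2 : (dpc c s' : C) * η (c + s') = η c * η s' := (hη.mul _ _).symm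
    have h3 : (dpc q' s : C) * (dpc (q' + s) u : C) = (dpc s u : C) * (dpc q' (s + u) : C) := by
      rw [← Nat.cast_mul, dpc_assoc, Nat.cast_mul]
    simp only [← Nat.cast_smul_eq_nsmul C, smul_smul, add_assoc]
    congr 1
    push_cast
    calc _ = ((dpc c s' : C) * η (c + s')) * ((dpc q' s : C) * (dpc (q' + s) u : C)) := by ring
      _ = _ := by rw [h2, h3]; ring
  simp only [h1]
  rw [← dsum_assoc n fun b c q' => dsum m fun s' s => χ b • dpc s u • η s' • η c •
    dpc q' (s + u) • f (q' + (s + u))]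
  simp only [smul_dsum, dsum_smul]
  rw [dsum_comm]
  refine congrArg _ (funext fun a => funext fun q => ?_)
  rw [dsum_comm]
  refine congrArg _ (funext fun b => funext fun c => congrArg _ (funext fun s' => funext fun s => ?_))
  simp only [← Nat.cast_smul_eq_nsmul C, smul_smul]
  congr 1
  ring

end Pointwise

-- Commutation statements under truncating weights

section Small

variable {C₀ : Type u} [CommRing C₀] (r : Rule d K Ξ O C₀)

/-- The weights are multiplicative, and after applying `i` they vanish outside the box. -/
structure Rule.Small {C : Type*} [CommRing C] (i : C₀ →+* C) : Prop where
  mul : ∀ a b, i (r.w (a + b)) = i (r.w a) * i (r.w b)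
  box : ∀ a, a ∉ Finset.Iic (fun _ => r.B : MIdx d) → i (r.w a) = 0

/-- Cuts commute with contractions which do not involve the vertex. -/
def ContractCut {b : Bool} (br : Branches d K Ξ O b) : Prop :=
  ∀ (C : Type u) [CommRing C] (i : C₀ →+* C), r.Small i → ∀ (χ : Chars d K Ξ O C)
    (M : Type u) [AddCommGroup M] [Module C M] (c : Bool)
    (F : MIdx d × List (Limb d K Ξ O) × Branches d K Ξ O b → M),
    (wsum (conB r i br) fun κ => wsum (cutB r i χ unitHead c κ) F) =
      wsum (cutB r i (χ.con r i) unitHead c br) fun t => wsum (conL r i t.2.1) fun own =>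
        wsum (conB r i t.2.2) fun κ => F (t.1, own, κ)

/-- Cuts commute with the extraction of a subtree which contains the vertex. -/
def ExtractCut {b : Bool} (br : Branches d K Ξ O b) : Prop :=
  ∀ (C : Type u) [CommRing C] (i : C₀ →+* C), r.Small i → ∀ (χ η : Chars d K Ξ O C)
    (M : Type u) [AddCommGroup M] [Module C M] (c₁ c₂ : Bool), (c₁ = true → c₂ = true) →
    ∀ (G : MIdx d → MIdx d → List (Limb d K Ξ O) → Branches d K Ξ O true →
      Branches d K Ξ O b → M),
    (wsum (cutB r i (χ.comp r i η) r.heads c₂ br) fun t =>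
        wsum (cutB r i χ unitHead c₁ (ofLimbs t.2.1 : Branches d K Ξ O true)) fun t' =>
          G t.1 t'.1 t'.2.1 t'.2.2 t.2.2) =
      wsum (cutB r i (χ.con r i) unitHead c₁ br) fun t => wsum (conL r i t.2.1) fun own =>
        wsum (cutB r i η r.heads c₂ t.2.2) fun u => dsum t.1 fun s' s =>
          dpc s u.1 • G (s + u.1) s' own (ofLimbs u.2.1) u.2.2

section Steps

variable {C : Type u} [CommRing C] (i : C₀ →+* C) (hi : r.Small i) (χ η : Chars d K Ξ O C)
  {M : Type u} [AddCommGroup M] [Module C M]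

/-- Closing the vertex turns `ExtractCut` into a statement on trees: extracting along `Chars.comp`
amounts to cutting first and extracting from the trunk afterwards. -/
theorem ExtractCut.tree {br : Branches d K Ξ O true} (h : ExtractCut r br) (hi : r.Small i)
    (n : MIdx d) (o : O) (f : PTree d K Ξ O true → M) :
    wsum (cutT r i (χ.comp r i η) r.heads ⟨n, o, br⟩) f =
      wsum (cutT r i (χ.con r i) unitHead ⟨n, o, br⟩) fun τ => wsum (cutT r i η r.heads τ) f := by
  -- The functional collects the factors missing at the vertex: those of the limbs that leave σ
  -- there form `(χ.comp r i η).U`, and the sum over `a` takes care of the decoration.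
  have h1 := h C i hi χ η M true true (fun h => h) fun s s' own κ' κ =>
    (η.x s' * χ.U own * η.U (limbsOf κ')) • dsum n fun a q =>
      (χ.comp r i η).x a • dpc q s • f ⟨q + s, o, κ⟩
  rw [cutT_mk, cutT_mk]
  refine Eq.trans ?_ (h1.trans ?_)
  · refine congrArg _ (funext fun t => ?_)
    rw [wsum_smul_right, smul_dsum]
    refine congrArg _ (funext fun a => funext fun q => ?_)
    rw [smul_smul, mul_comm]
    rfl
  · refine congrArg _ (funext fun t => ?_)
    simp only [cutT_mk, limbsOf_ofLimbs]
    have h2 : ∀ a q : MIdx d, ∀ X : M, ((χ.con r i).x a * (χ.con r i).U t.2.1) • dpc q t.1 • X =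
        wsum (conL r i t.2.1) fun own => χ.U own • χ.x a • dpc q t.1 • X := by
      intro a q X
      rw [wsum_smul_right, mul_comm, mul_smul]
      rfl
    simp only [h2, ← wsum_dsum, ← wsum_nsmul, ← wsum_smul]
    refine Eq.trans ?_ (wsum_comm _ _ _)
    refine congrArg _ (funext fun own => congrArg _ (funext fun u => ?_))
    have h4 := dsum_close χ.x η.x η.isDP n t.1 u.1 fun v => f ⟨v, o, u.2.2⟩
    have h5 := congrArg (fun X => (χ.U own * η.U u.2.1) • X) h4
    simp only [smul_dsum] at h5
    refine Eq.trans ?_ (h5.trans ?_)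
    · refine congrArg _ (funext fun s' => funext fun s => ?_)
      simp only [smul_dsum]
      refine congrArg _ (funext fun a => funext fun q => ?_)
      simp only [← Nat.cast_smul_eq_nsmul C, smul_smul, Chars.comp]
      congr 1
      ring
    · refine congrArg _ (funext fun a => funext fun q => ?_)
      simp only [smul_dsum]
      refine congrArg _ (funext fun a' => funext fun q' => ?_)
      simp only [← Nat.cast_smul_eq_nsmul C, smul_smul]
      congr 1
      ring

end Steps

/-- The universal characters. -/
noncomputable def univChars (d : ℕ) (K Ξ O : Type) (C : Type*) [CommRing C] :
    Chars d K Ξ O (DPSh d (Limb d K Ξ O) C) where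
  x := fun a => DPSh.bas a []
  U := fun l => DPSh.bas 0 l
  isDP := DPSh.isDPChar_bas
  isSh := DPSh.isShChar_bas

/-- Extend the scalars of characters. -/
def Chars.map {C C' : Type*} [CommSemiring C] [CommSemiring C'] (χ : Chars d K Ξ O C)
    (φ : C →+* C') : Chars d K Ξ O C' where
  x := fun a => φ (χ.x a)
  U := fun l => φ (χ.U l)
  isDP := ⟨by rw [χ.isDP.zero, map_one], fun a b => by
    rw [← map_mul, χ.isDP.mul, map_mul, map_natCast]⟩
  isSh := ⟨by rw [χ.isSh.nil, map_one], fun l m => by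
    rw [← map_mul, χ.isSh.mul, map_shsum]⟩

-- Contraction of an extracted subtree as a linear functional

section Contracted

variable {C : Type u} [CommRing C] (i : C₀ →+* C) (χ : Chars d K Ξ O C)
  {M : Type u} [AddCommGroup M] [Module C M]

/-- The contracted tree that arises from an extracted subtree, as a linear functional on the values
of the universal characters. -/
noncomputable def contractedTree (f : PTree d K Ξ O true → M) :
    (PTree d K Ξ O true →₀ DPSh d (Limb d K Ξ O) C) →ₗ[C] M :=
  Finsupp.lsum C fun σ => DPSh.lift fun A L => i (r.p σ) • f ⟨A, r.g σ, ofLimbs L⟩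

theorem contractedTree_single (f : PTree d K Ξ O true → M) (σ : PTree d K Ξ O true)
    (a : MIdx d) (l : List (Limb d K Ξ O)) (c : C) :
    contractedTree r i f (Finsupp.single σ (c • DPSh.bas a l)) =
      c • i (r.p σ) • f ⟨a, r.g σ, ofLimbs l⟩ := by
  rw [contractedTree, Finsupp.lsum_single, map_smul, DPSh.lift_bas]

/-- The scalars of the algebra carrying the universal characters. -/
noncomputable def univHom : C₀ →+* DPSh d (Limb d K Ξ O) C :=
  (algebraMap C (DPSh d (Limb d K Ξ O) C)).comp i

/-- Either no contracted subtree contains the root, or one does. In the second case the extracted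
subtree is recorded as a basis element and the universal characters record the decoration and the
limbs of the vertex replacing it; `contractedTree` reassembles the result. The extraction is thereby
an evaluation, to which `ExtractCut` applies. -/
theorem wsum_conT (t : PTree d K Ξ O true) (f : PTree d K Ξ O true → M) :
    wsum (conT r i t) f = (wsum (conB r i t.br) fun κ => f ⟨t.dec, t.exdec, κ⟩) +
      contractedTree r i f (wsum (cutT r (univHom i) (univChars d K Ξ O C) r.heads t) fun σ =>
        Finsupp.single σ 1) := by
  simp only [conT, conB, Rule.heads, contractTree, wcontractVertex, wsum_mapWeight,
    Multiset.map_add, Multiset.sum_add, Multiset.map_map, Function.comp_def]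
  congr 1
  rw [cutT, wsum_evalTree, map_multiset_sum, Multiset.map_map, wextract_eq_cutsWith]
  refine congrArg Multiset.sum (Multiset.map_congr rfl fun s _ => ?_)
  simp only [Function.comp_apply, univHom, univChars, RingHom.comp_apply]
  rw [mul_assoc, ← DPSh.bas_eq, ← Algebra.smul_def, Finsupp.smul_single, smul_eq_mul, mul_one,
    contractedTree_single, map_mul, mul_smul]

theorem Rule.Small.univHom (hi : r.Small i) :
    r.Small (univHom i : C₀ →+* DPSh d (Limb d K Ξ O) C) where
  mul a b := by simp only [PlanarRS.univHom, RingHom.comp_apply, hi.mul, map_mul]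
  box a ha := by simp only [PlanarRS.univHom, RingHom.comp_apply, hi.box a ha, map_zero]

/-- Linear functionals can be moved inside an evaluation whose weights are scalars. -/
theorem wsum_cutB_map {C' : Type*} [CommRing C'] [Algebra C C'] {N : Type*} [AddCommGroup N]
    [Module C N] [Module C' N] [IsScalarTower C C' N]
    (H : PTree d K Ξ O true → Multiset (C₀ × PTree d K Ξ O true)) (c : Bool) {b : Bool}
    (br : Branches d K Ξ O b) (F : MIdx d × List (Limb d K Ξ O) × Branches d K Ξ O b → N) :
    wsum (cutB r ((algebraMap C C').comp i) (χ.map (algebraMap C C')) H c br) F =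
      wsum (cutB r i χ H c br) F := by
  simp only [cutB, wsum_evalBranch, Chars.map, RingHom.comp_apply, ← map_mul, algebraMap_smul]

theorem wsum_cutT_map {C' : Type*} [CommRing C'] [Algebra C C'] {N : Type*} [AddCommGroup N]
    [Module C N] [Module C' N] [IsScalarTower C C' N]
    (H : PTree d K Ξ O true → Multiset (C₀ × PTree d K Ξ O true)) 
    (t : PTree d K Ξ O true) (f : PTree d K Ξ O true → N) :
    wsum (cutT r ((algebraMap C C').comp i) (χ.map (algebraMap C C')) H t) f =
      wsum (cutT r i χ H t) f := by
  simp only [cutT, wsum_evalTree, Chars.map, RingHom.comp_apply, ← map_mul, algebraMap_smul]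

end Contracted

-- Commutation for a tree, from commutation at its root

section Tree

variable {C : Type u} [CommRing C] (i : C₀ →+* C) (χ : Chars d K Ξ O C)
  {M : Type u} [AddCommGroup M] [Module C M]

/-- Where there is no noise edge, the kept branches are determined by their limbs, so passing
through `limbsOf` loses nothing. -/
theorem cutB_ofLimbs_kept (H : PTree d K Ξ O true → Multiset (C₀ × PTree d K Ξ O true)) (c : Bool)
    {b : Bool} (l : List (Limb d K Ξ O))
    (F : MIdx d × List (Limb d K Ξ O) × Branches d K Ξ O b → M) :
    wsum (cutB r i χ H c (ofLimbs l : Branches d K Ξ O b)) F =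
      wsum (cutB r i χ H c (ofLimbs l : Branches d K Ξ O b)) fun t =>
        F (t.1, t.2.1, ofLimbs (limbsOf t.2.2)) := by
  induction l generalizing c F with
  | nil => simp only [ofLimbs, cutB_nil, limbsOf]
  | cons z l ih =>
    cases c
    · simp only [ofLimbs, cutB_false_kernel, limbsOf]
      exact congrArg _ (funext fun τ => ih _ _)
    · simp only [ofLimbs, cutB_true_kernel, limbsOf]
      refine congrArg₂ _ (Finset.sum_congr rfl fun ℓ _ => congrArg _ (congrArg _ (funext fun h =>
        ih _ _))) (congrArg _ (funext fun τ => ih _ _))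

theorem conL_map {C' : Type*} [CommRing C'] [Algebra C C'] {N : Type*} [AddCommGroup N]
    [Module C N] [Module C' N] [IsScalarTower C C' N] (l : List (Limb d K Ξ O))
    (f : List (Limb d K Ξ O) → N) :
    wsum (conL r ((algebraMap C C').comp i) l) f = wsum (conL r i l) f := by
  induction l generalizing f with
  | nil => simp only [conL_nil]
  | cons z l ih =>
    simp only [conL_cons, ih]
    simp only [conT, wsum_mapWeight, RingHom.comp_apply, algebraMap_smul]

theorem con_map {C' : Type*} [CommRing C'] [Algebra C C'] :
    (χ.map (algebraMap C C')).con r ((algebraMap C C').comp i) =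
      (χ.con r i).map (algebraMap C C') := by
  simp only [Chars.con, Chars.map, conL_map]
  congr 1
  funext l
  rw [← Algebra.linearMap_apply, map_wsum]
  rfl

/-- A cut of the contracted tree splits the decoration of its root and cuts its word of limbs, which
is exactly how `Chars.comp` is made. With universal characters in the second place, what is kept
remains visible as a basis element and can be fed to `contractedTree`. -/
theorem contractedTree_comp (f : PTree d K Ξ O true → M) (σ : PTree d K Ξ O true) (a : MIdx d)
    (l : List (Limb d K Ξ O)) (c : C) :
    contractedTree r i f (Finsupp.single σ (c •
      (((χ.map (algebraMap C (DPSh d (Limb d K Ξ O) C))).comp r (univHom i)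
        (univChars d K Ξ O C)).x a * ((χ.map (algebraMap C (DPSh d (Limb d K Ξ O) C))).comp r
          (univHom i) (univChars d K Ξ O C)).U l))) =
      c • i (r.p σ) • wsum (cutT r i χ unitHead ⟨a, r.g σ, ofLimbs l⟩) f := by
  have h1 : ((χ.map (algebraMap C (DPSh d (Limb d K Ξ O) C))).comp r (univHom i)
        (univChars d K Ξ O C)).x a * ((χ.map (algebraMap C (DPSh d (Limb d K Ξ O) C))).comp r
          (univHom i) (univChars d K Ξ O C)).U l =
      wsum (cutB r i χ unitHead true (ofLimbs l : Branches d K Ξ O true)) fun t =>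
        dsum a fun b q => (χ.x b * χ.U t.2.1) • dpc q t.1 • DPSh.bas (q + t.1) (limbsOf t.2.2) := by
    simp only [Chars.comp, univHom]
    rw [wsum_cutB_map, ← LinearMap.mulLeft_apply (R := C), map_wsum]
    refine congrArg _ (funext fun t => ?_)
    rw [LinearMap.mulLeft_apply, dsum, Finset.sum_mul]
    refine Finset.sum_congr rfl fun b _ => ?_
    simp only [Chars.map, univChars]
    -- What is left of the decoration and the shift from the cut edges merge into the new root
    -- decoration; the divided power rule supplies the binomial coefficient.
    have hm : (DPSh.bas (a - b) [] * DPSh.bas t.1 [] : DPSh d (Limb d K Ξ O) C) =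
        (dpc (a - b) t.1 : DPSh d (Limb d K Ξ O) C) * DPSh.bas (a - b + t.1) [] :=
      DPSh.isDPChar_bas.mul _ _
    rw [DPSh.bas_eq (a - b + t.1), Algebra.smul_def, map_mul, nsmul_eq_mul]
    linear_combination (algebraMap C (DPSh d (Limb d K Ξ O) C) (χ.x b) *
      algebraMap C (DPSh d (Limb d K Ξ O) C) (χ.U t.2.1) * DPSh.bas 0 (limbsOf t.2.2)) * hm
  have h2 : ∀ v, contractedTree r i f (Finsupp.single σ v) =
      ((contractedTree r i f) ∘ₗ Finsupp.lsingle σ) v := fun v => rfl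
  have h3 : ∀ b q, ((contractedTree r i f) ∘ₗ Finsupp.lsingle σ) (DPSh.bas b q) =
      i (r.p σ) • f ⟨b, r.g σ, ofLimbs q⟩ := by
    intro b q
    rw [← h2, ← one_smul C (DPSh.bas b q), contractedTree_single, one_smul]
  rw [h1, cutT_mk, h2, map_smul, map_wsum]
  congr 1
  rw [← wsum_smul]
  refine Eq.trans ?_ (cutB_ofLimbs_kept r i χ _ true l _).symm
  refine congrArg _ (funext fun t => ?_)
  simp only [dsum, map_sum, map_smul, map_nsmul, h3, Finset.smul_sum]
  refine Finset.sum_congr rfl fun b _ => ?_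
  rw [smul_comm (i (r.p σ)), smul_comm (i (r.p σ))]

/-- By `wsum_conT` a contraction avoids the root or involves it. `ContractCut` handles the first
part. The second is `ExtractCut` over the algebra `DPSh` with universal `η`, pushed through
`contractedTree`; for this reason the two statements quantify over all rings `C`. -/
theorem contractCut_tree {br : Branches d K Ξ O true} (h1 : ContractCut r br)
    (h2 : ExtractCut r br) (hi : r.Small i) (n : MIdx d) (o : O) (f : PTree d K Ξ O true → M) :
    (wsum (conT r i ⟨n, o, br⟩) fun h => wsum (cutT r i χ unitHead h) f) =
      wsum (cutT r i (χ.con r i) unitHead ⟨n, o, br⟩) fun τ => wsum (conT r i τ) f := by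
  rw [wsum_conT]
  have e : (wsum (cutT r i (χ.con r i) unitHead ⟨n, o, br⟩) fun τ => wsum (conT r i τ) f) =
      (wsum (cutT r i (χ.con r i) unitHead ⟨n, o, br⟩) fun τ =>
        wsum (conB r i τ.br) fun κ => f ⟨τ.dec, τ.exdec, κ⟩) +
      wsum (cutT r i (χ.con r i) unitHead ⟨n, o, br⟩) fun τ => contractedTree r i f
        (wsum (cutT r (univHom i) (univChars d K Ξ O C) r.heads τ) fun σ => Finsupp.single σ 1) := by
    rw [← wsum_add]
    exact congrArg _ (funext fun τ => wsum_conT r i τ f)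
  rw [e]
  congr 1
  · simp only [cutT_mk]
    rw [h1 C i hi χ M]
    refine congrArg _ (funext fun t => ?_)
    have h3 : ∀ a q : MIdx d, ∀ X : M, ((χ.con r i).x a * (χ.con r i).U t.2.1) • dpc q t.1 • X =
        wsum (conL r i t.2.1) fun own => (χ.x a * χ.U own) • dpc q t.1 • X := by
      intro a q X
      rw [wsum_smul_right, wsum_mul_left]
      rfl
    simp only [h3]
    rw [← wsum_dsum]
    refine congrArg _ (funext fun own => ?_)
    simp only [← wsum_nsmul, ← wsum_smul]
    rw [← wsum_dsum]
  · rw [← map_wsum]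
    have h4 := ExtractCut.tree r (univHom i) (χ.map (algebraMap C _)) (univChars d K Ξ O C) h2
      (hi.univHom r i) n o fun σ => (Finsupp.single σ 1 : PTree d K Ξ O true →₀ DPSh d (Limb d K Ξ O) C)
    have h5 : (χ.map (algebraMap C _)).con r (univHom i) =
        (χ.con r i).map (algebraMap C (DPSh d (Limb d K Ξ O) C)) := con_map r i χ
    rw [h5] at h4
    have h6 := wsum_cutT_map r i (χ.con r i) (C' := DPSh d (Limb d K Ξ O) C) unitHead ⟨n, o, br⟩
      fun τ => wsum (cutT r (univHom i) (univChars d K Ξ O C) r.heads τ) fun σ =>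
        (Finsupp.single σ 1 : PTree d K Ξ O true →₀ DPSh d (Limb d K Ξ O) C)
    refine Eq.trans ?_ (congrArg (contractedTree r i f) (h4.trans h6))
    rw [cutT, cutT, wsum_evalTree, wsum_evalTree, map_multiset_sum, map_multiset_sum,
      Multiset.map_map, Multiset.map_map]
    refine congrArg Multiset.sum (Multiset.map_congr rfl fun s _ => ?_)
    have h7 := contractedTree_comp r i χ f s.trunk s.red s.pruned (i s.coef)
    have h8 : ∀ v v' : DPSh d (Limb d K Ξ O) C, (univHom i s.coef * v * v') •
        (Finsupp.single s.trunk 1 : PTree d K Ξ O true →₀ DPSh d (Limb d K Ξ O) C) =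
          Finsupp.single s.trunk (i s.coef • (v * v')) := by
      intro v v'
      rw [Finsupp.smul_single, smul_eq_mul, mul_one, mul_assoc, univHom, RingHom.comp_apply,
        ← Algebra.smul_def]
    simp only [Function.comp_apply, h8]
    rw [h7]
    simp only [univChars]
    rw [← DPSh.bas_eq, contractedTree_single]

end Tree

-- The simultaneous induction over branches

section Induction

variable {C : Type u} [CommRing C] (i : C₀ →+* C) (hi : r.Small i) (χ η : Chars d K Ξ O C)
  {M : Type u} [AddCommGroup M] [Module C M]

theorem contractCut_nil {b : Bool} : ContractCut r (.nil : Branches d K Ξ O b) := by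
  intro C _ i _ χ M _ _ c F
  simp only [conB_nil, cutB_nil, conL_nil]

theorem contractCut_noise (ξ : Ξ) (e n : MIdx d) (o : O) {rest : Branches d K Ξ O false}
    (h : ContractCut r rest) : ContractCut r (.noise ξ e n o rest) := by
  intro C _ i hi χ M _ _ c F
  simp only [conB_noise, cutB_noise]
  exact h C i hi χ M false _

theorem contractCut_keep {b : Bool} (k : K) (e n : MIdx d) (o : O) {above : Branches d K Ξ O true}
    {rest : Branches d K Ξ O b} (h1 : ContractCut r above) (h2 : ExtractCut r above)
    (h3 : ContractCut r rest) (hi : r.Small i)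
    (F : MIdx d × List (Limb d K Ξ O) × Branches d K Ξ O b → M) :
    (wsum (conT r i ⟨n, o, above⟩) fun h => wsum (conB r i rest) fun κ =>
      wsum (cutT r i χ unitHead h) fun τ => wsum (cutB r i χ unitHead false κ) fun t =>
        F (t.1, t.2.1, .kernel k e τ.dec τ.exdec τ.br t.2.2)) =
    wsum (cutT r i (χ.con r i) unitHead ⟨n, o, above⟩) fun τ =>
      wsum (cutB r i (χ.con r i) unitHead false rest) fun t => wsum (conL r i t.2.1) fun own =>
        wsum (conT r i τ) fun h => wsum (conB r i t.2.2) fun κ =>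
          F (t.1, own, .kernel k e h.dec h.exdec h.br κ) := by
  have e1 := contractCut_tree r i χ h1 h2 hi n o fun τ => wsum (conB r i rest) fun κ =>
    wsum (cutB r i χ unitHead false κ) fun t => F (t.1, t.2.1, .kernel k e τ.dec τ.exdec τ.br t.2.2)
  refine Eq.trans (congrArg _ (funext fun h => wsum_comm _ _ _)) (e1.trans ?_)
  refine congrArg _ (funext fun τ => ?_)
  have e2 : ∀ h : PTree d K Ξ O true, _ := fun h => h3 C i hi χ M false fun t =>
    F (t.1, t.2.1, .kernel k e h.dec h.exdec h.br t.2.2)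
  refine Eq.trans (congrArg _ (funext fun h => e2 h)) ?_
  rw [wsum_comm]
  exact congrArg _ (funext fun t => wsum_comm _ _ _)

theorem contractCut_kernel {b : Bool} (k : K) (e n : MIdx d) (o : O) {above : Branches d K Ξ O true}
    {rest : Branches d K Ξ O b} (h1 : ContractCut r above) (h2 : ExtractCut r above)
    (h3 : ContractCut r rest) : ContractCut r (.kernel k e n o above rest) := by
  intro C _ i hi χ M _ _ c F
  have hk := contractCut_keep r i χ k e n o h1 h2 h3 hi F
  cases c
  · simp only [conB_kernel, cutB_false_kernel]
    exact hk
  · simp only [conB_kernel, cutB_true_kernel, wsum_add, wsum_mapWeight_unitHead]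
    refine congrArg₂ _ ?_ hk
    simp only [wsum_finset_sum, wsum_smul]
    refine Finset.sum_congr rfl fun ℓ _ => congrArg _ ?_
    have e2 : ∀ h : PTree d K Ξ O true, _ := fun h => h3 C i hi χ M true fun t =>
      dpc t.1 ℓ • F (t.1 + ℓ, ⟨k, e + ℓ, h⟩ :: t.2.1, t.2.2)
    refine Eq.trans (congrArg _ (funext fun h => e2 h)) ?_
    rw [wsum_comm]
    simp only [conL_cons, wsum_nsmul]

theorem extractCut_nil {b : Bool} : ExtractCut r (.nil : Branches d K Ξ O b) := by
  intro C _ i _ χ η M _ _ c₁ c₂ _ G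
  simp only [cutB_nil, conL_nil, ofLimbs, dsum_zero, dpc_zero_left, one_smul, add_zero]

theorem extractCut_noise (ξ : Ξ) (e n : MIdx d) (o : O) {rest : Branches d K Ξ O false}
    (h : ExtractCut r rest) : ExtractCut r (.noise ξ e n o rest) := by
  intro C _ i hi χ η M _ _ c₁ c₂ _ G
  simp only [cutB_noise]
  have h1 := h C i hi χ η M false false (fun h => h) fun s s' own κ' κ =>
    G s s' own κ' (.noise ξ e n o κ)
  refine Eq.trans ?_ h1
  refine (cutB_false r i _ _ rest _).trans (Eq.trans ?_ (cutB_false r i _ _ rest _).symm)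
  simp only [ofLimbs, cutB_nil]

/-- The edge belongs to the extracted subtree. The tree above it is treated by `ExtractCut.tree`,
and further to the right every edge stays in the subtree. -/
theorem extractCut_keep_keep {b : Bool} (k : K) (e n : MIdx d) (o : O)
    {above : Branches d K Ξ O true} {rest : Branches d K Ξ O b} (h2 : ExtractCut r above)
    (h3 : ExtractCut r rest) (hi : r.Small i) (c : Bool)
    (G : MIdx d → MIdx d → List (Limb d K Ξ O) → Branches d K Ξ O true → Branches d K Ξ O b → M) :
    (wsum (cutT r i (χ.comp r i η) r.heads ⟨n, o, above⟩) fun σ =>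
      wsum (cutB r i (χ.comp r i η) r.heads false rest) fun t =>
        wsum (cutB r i χ unitHead c (ofLimbs t.2.1 : Branches d K Ξ O true)) fun t' =>
          G t.1 t'.1 t'.2.1 t'.2.2 (.kernel k e σ.dec σ.exdec σ.br t.2.2)) =
    wsum (cutT r i (χ.con r i) unitHead ⟨n, o, above⟩) fun τ =>
      wsum (cutB r i (χ.con r i) unitHead false rest) fun t => wsum (conL r i t.2.1) fun own =>
        wsum (cutT r i η r.heads τ) fun σ => wsum (cutB r i η r.heads false t.2.2) fun u =>
          dsum t.1 fun s' s => dpc s u.1 •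
            G (s + u.1) s' own (ofLimbs u.2.1) (.kernel k e σ.dec σ.exdec σ.br u.2.2) := by
  -- By `cutB_false` no limbs leave the subtree at this vertex, so the flag of the second cut is
  -- irrelevant and the induction hypothesis for the flag `false` suffices.
  have e0 : ∀ σ : PTree d K Ξ O true,
      (wsum (cutB r i (χ.comp r i η) r.heads false rest) fun t =>
        wsum (cutB r i χ unitHead c (ofLimbs t.2.1 : Branches d K Ξ O true)) fun t' =>
          G t.1 t'.1 t'.2.1 t'.2.2 (.kernel k e σ.dec σ.exdec σ.br t.2.2)) =
      wsum (cutB r i (χ.comp r i η) r.heads false rest) fun t =>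
        wsum (cutB r i χ unitHead false (ofLimbs t.2.1 : Branches d K Ξ O true)) fun t' =>
          G t.1 t'.1 t'.2.1 t'.2.2 (.kernel k e σ.dec σ.exdec σ.br t.2.2) := by
    intro σ
    refine (cutB_false r i _ _ rest _).trans (Eq.trans ?_ (cutB_false r i _ _ rest _).symm)
    simp only [ofLimbs, cutB_nil]
  have e1 : ∀ σ : PTree d K Ξ O true, _ := fun σ => h3 C i hi χ η M false false (fun h => h)
    fun s s' own κ' κ => G s s' own κ' (.kernel k e σ.dec σ.exdec σ.br κ)
  refine Eq.trans (congrArg _ (funext fun σ => (e0 σ).trans (e1 σ))) ?_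
  rw [ExtractCut.tree r i χ η h2 hi n o]
  refine congrArg _ (funext fun τ => ?_)
  rw [wsum_comm]
  exact congrArg _ (funext fun t => wsum_comm _ _ _)

/-- The edge leaves the extracted subtree with an increase `ℓ` and survives the recentering cut.
Contraction and cut then meet in the whole tree above it, where `contractCut_tree` applies. To its
right nothing more is cut, although edges may still leave the subtree. -/
theorem extractCut_cut_keep {b : Bool} (k : K) (e n : MIdx d) (o : O)
    {above : Branches d K Ξ O true} {rest : Branches d K Ξ O b} (h1 : ContractCut r above)
    (h2 : ExtractCut r above) (h3 : ExtractCut r rest) (hi : r.Small i)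
    (G : MIdx d → MIdx d → List (Limb d K Ξ O) → Branches d K Ξ O true → Branches d K Ξ O b → M) :
    (∑ ℓ ∈ Finset.Iic (fun _ => r.B : MIdx d), i (r.w ℓ) • wsum (conT r i ⟨n, o, above⟩) fun h =>
      wsum (cutB r i (χ.comp r i η) r.heads true rest) fun t => dpc t.1 ℓ •
        wsum (cutT r i χ unitHead h) fun τ =>
          wsum (cutB r i χ unitHead false (ofLimbs t.2.1 : Branches d K Ξ O true)) fun t' =>
            G (t.1 + ℓ) t'.1 t'.2.1 (.kernel k (e + ℓ) τ.dec τ.exdec τ.br t'.2.2) t.2.2) =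
    wsum (cutT r i (χ.con r i) unitHead ⟨n, o, above⟩) fun τ =>
      wsum (cutB r i (χ.con r i) unitHead false rest) fun t => wsum (conL r i t.2.1) fun own =>
        ∑ ℓ ∈ Finset.Iic (fun _ => r.B : MIdx d), i (r.w ℓ) • wsum (conT r i τ) fun h =>
          wsum (cutB r i η r.heads true t.2.2) fun u => dpc u.1 ℓ •
            dsum t.1 fun s' s => dpc s (u.1 + ℓ) •
              G (s + (u.1 + ℓ)) s' own (.kernel k (e + ℓ) h.dec h.exdec h.br (ofLimbs u.2.1))
                u.2.2 := by
  simp only [wsum_finset_sum, wsum_smul]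
  refine Finset.sum_congr rfl fun ℓ _ => congrArg _ ?_
  have e1 := contractCut_tree r i χ h1 h2 hi n o fun τ =>
    wsum (cutB r i (χ.comp r i η) r.heads true rest) fun t =>
      wsum (cutB r i χ unitHead false (ofLimbs t.2.1 : Branches d K Ξ O true)) fun t' =>
        dpc t.1 ℓ •
          G (t.1 + ℓ) t'.1 t'.2.1 (.kernel k (e + ℓ) τ.dec τ.exdec τ.br t'.2.2) t.2.2
  refine Eq.trans (congrArg _ (funext fun h => ?_)) (e1.trans ?_)
  · simp only [← wsum_nsmul]
    exact wsum_comm _ _ _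
  refine congrArg _ (funext fun τ => ?_)
  have e2 : ∀ h : PTree d K Ξ O true, _ := fun h => h3 C i hi χ η M false true (fun _ => rfl)
    fun s s' own κ' κ => dpc s ℓ • G (s + ℓ) s' own (.kernel k (e + ℓ) h.dec h.exdec h.br κ') κ
  refine Eq.trans (congrArg _ (funext fun h => e2 h)) ?_
  rw [wsum_comm]
  refine congrArg _ (funext fun t => (wsum_comm _ _ _).trans ?_)
  refine congrArg _ (funext fun own => congrArg _ (funext fun h => congrArg _ (funext fun u => ?_)))
  rw [smul_dsum]
  refine congrArg _ (funext fun s' => funext fun s => ?_)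
  rw [smul_smul, smul_smul, add_assoc, dpc_assoc]

/-- The edge leaves the extracted subtree and is cut afterwards, so its decoration is increased
twice. The tree above it is only contracted; the content is `sum_cut_cut`. -/
theorem extractCut_cut_cut {b : Bool} (k : K) (e n : MIdx d) (o : O)
    {above : Branches d K Ξ O true} {rest : Branches d K Ξ O b} (h3 : ExtractCut r rest)
    (hi : r.Small i)
    (G : MIdx d → MIdx d → List (Limb d K Ξ O) → Branches d K Ξ O true → Branches d K Ξ O b → M) :
    (∑ ℓ ∈ Finset.Iic (fun _ => r.B : MIdx d), i (r.w ℓ) • wsum (conT r i ⟨n, o, above⟩) fun h =>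
      wsum (cutB r i (χ.comp r i η) r.heads true rest) fun t => dpc t.1 ℓ •
        ∑ ℓ' ∈ Finset.Iic (fun _ => r.B : MIdx d), i (r.w ℓ') •
          wsum (cutB r i χ unitHead true (ofLimbs t.2.1 : Branches d K Ξ O true)) fun t' =>
            dpc t'.1 ℓ' •
              G (t.1 + ℓ) (t'.1 + ℓ') (⟨k, e + ℓ + ℓ', h⟩ :: t'.2.1) t'.2.2 t.2.2) =
    ∑ m ∈ Finset.Iic (fun _ => r.B : MIdx d), i (r.w m) •
      wsum (cutB r i (χ.con r i) unitHead true rest) fun t => dpc t.1 m •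
        wsum (conL r i (⟨k, e + m, ⟨n, o, above⟩⟩ :: t.2.1)) fun own =>
          wsum (cutB r i η r.heads true t.2.2) fun u => dsum (t.1 + m) fun s' s =>
            dpc s u.1 • G (s + u.1) s' own (ofLimbs u.2.1) u.2.2 := by
  have e2 : ∀ (ℓ ℓ' : MIdx d) (h : PTree d K Ξ O true), _ := fun ℓ ℓ' h =>
    h3 C i hi χ η M true true (fun _ => rfl) fun s s' own κ' κ =>
      i (r.w ℓ) • i (r.w ℓ') • dpc s ℓ • dpc s' ℓ' •
        G (s + ℓ) (s' + ℓ') (⟨k, e + (ℓ + ℓ'), h⟩ :: own) κ' κ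
  simp only [Finset.smul_sum, wsum_finset_sum, ← wsum_smul, ← wsum_nsmul, conL_cons, add_assoc e]
  refine Eq.trans (Finset.sum_congr rfl fun ℓ _ => Finset.sum_congr rfl fun ℓ' _ =>
    congrArg _ (funext fun h => Eq.trans ?_ (e2 ℓ ℓ' h))) ?_
  · refine congrArg _ (funext fun t => congrArg _ (funext fun t' => ?_))
    rw [smul_comm (dpc t.1 ℓ) (i (r.w ℓ'))]
  simp only [← wsum_finset_sum]
  rw [wsum_comm]
  refine congrArg _ (funext fun t => congrArg _ (funext fun h => congrArg _ (funext fun own =>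
    congrArg _ (funext fun u => ?_))))
  refine (sum_cut_cut _ (by rw [Finset.coe_Iic]; exact isLowerSet_Iic _) (fun ℓ => i (r.w ℓ)) hi.mul
    hi.box t.1 u.1 fun m s s' => G s s' (⟨k, e + m, h⟩ :: own) (ofLimbs u.2.1) u.2.2)

/-- The three preceding lemmas cover the leftmost edge: the recentering cut can remove it only if it
leaves the extracted subtree. -/
theorem extractCut_kernel {b : Bool} (k : K) (e n : MIdx d) (o : O) {above : Branches d K Ξ O true}
    {rest : Branches d K Ξ O b} (h1 : ContractCut r above) (h2 : ExtractCut r above)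
    (h3 : ExtractCut r rest) : ExtractCut r (.kernel k e n o above rest) := by
  intro C _ i hi χ η M _ _ c₁ c₂ hc G
  have hkk := extractCut_keep_keep r i χ η k e n o h2 h3 hi c₁ G
  have hck := extractCut_cut_keep r i χ η k e n o h1 h2 h3 hi G
  have hcc := extractCut_cut_cut r i χ η k e n o (above := above) h3 hi G
  have hm : mapWeight i (r.heads ⟨n, o, above⟩) = conT r i ⟨n, o, above⟩ := rfl
  have hm' : ∀ τ, mapWeight i (r.heads τ) = conT r i τ := fun _ => rfl
  cases c₂
  · cases c₁
    · simp only [cutB_false_kernel]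
      exact hkk
    -- An edge that may be cut has only cut edges to its left; these have left the subtree as well,
    -- so this pair of flags does not occur.
    · simp at hc
  · cases c₁
    · simp only [cutB_false_kernel, cutB_true_kernel, ofLimbs, wsum_add, hm']
      exact congrArg₂ _ hck hkk
    · simp only [cutB_true_kernel, ofLimbs, wsum_add, hm', wsum_mapWeight_unitHead, smul_add,
        Finset.sum_add_distrib]
      rw [add_assoc]
      exact congrArg₂ _ hcc (congrArg₂ _ hck hkk)

theorem contractCut_extractCut {b : Bool} (br : Branches d K Ξ O b) :
    ContractCut r br ∧ ExtractCut r br := by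
  induction br with
  | nil => exact ⟨contractCut_nil r, extractCut_nil r⟩
  | kernel k e n o above rest h1 h2 =>
    exact ⟨contractCut_kernel r k e n o h1.1 h1.2 h2.1, extractCut_kernel r k e n o h1.1 h1.2 h2.2⟩
  | noise ξ e n o rest h => exact ⟨contractCut_noise r ξ e n o h.1, extractCut_noise r ξ e n o h.2⟩

/-- Cuts and contractions of trees commute. -/
theorem wsum_conT_cutT (hi : r.Small i) (t : PTree d K Ξ O true) (f : PTree d K Ξ O true → M) :
    (wsum (conT r i t) fun h => wsum (cutT r i χ unitHead h) f) =
      wsum (cutT r i (χ.con r i) unitHead t) fun τ => wsum (conT r i τ) f :=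
  contractCut_tree r i χ (contractCut_extractCut r t.br).1 (contractCut_extractCut r t.br).2 hi
    t.dec t.exdec f

end Induction

end Small

/-! ## Change of scalars -/

/-- Apply a map to the coefficient. -/
def BranchCut.mapCoef {C C' : Type*} (φ : C → C') {b : Bool} (t : BranchCut C d K Ξ O b) :
    BranchCut C' d K Ξ O b := ⟨φ t.coef, t.red, t.shift, t.own, t.deep, t.kept⟩

/-- Apply a map to the coefficient. -/
def TreeCut.mapCoef {C C' : Type*} (φ : C → C') {b : Bool} (t : TreeCut C d K Ξ O b) :
    TreeCut C' d K Ξ O b := ⟨φ t.coef, t.red, t.pruned, t.trunk⟩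

section Naturality

variable {C C' : Type*} [CommSemiring C] [CommSemiring C'] (φ : C →+* C')

theorem map_nilStep {b : Bool} : (nilStep : Multiset (BranchCut C d K Ξ O b)).map
    (BranchCut.mapCoef φ) = nilStep := by
  simp [nilStep, BranchCut.mapCoef]

theorem map_wcutStep {b : Bool} (w : MIdx d → C) (B : ℕ) (k : K) (e : MIdx d)
    (heads : Multiset (C × PTree d K Ξ O true)) (rests : Multiset (BranchCut C d K Ξ O b)) :
    (wcutStep w B k e heads rests).map (BranchCut.mapCoef φ) =
      wcutStep (fun ℓ => φ (w ℓ)) B k e (mapWeight φ heads) (rests.map (BranchCut.mapCoef φ)) := by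
  simp [wcutStep, BranchCut.mapCoef, mapWeight, Multiset.map_bind, Multiset.bind_map,
    Function.comp_def]

theorem map_keepStep {b : Bool} (k : K) (e : MIdx d) (aboves : Multiset (TreeCut C d K Ξ O true))
    (rests : Multiset (BranchCut C d K Ξ O b)) :
    (keepStep k e aboves rests).map (BranchCut.mapCoef φ) =
      keepStep k e (aboves.map (TreeCut.mapCoef φ)) (rests.map (BranchCut.mapCoef φ)) := by
  simp [keepStep, BranchCut.mapCoef, TreeCut.mapCoef, Multiset.map_bind, Multiset.bind_map,
    Function.comp_def]

theorem map_noiseStep (ξ : Ξ) (e n : MIdx d) (o : O)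
    (rests : Multiset (BranchCut C d K Ξ O false)) :
    (noiseStep ξ e n o rests).map (BranchCut.mapCoef φ) =
      noiseStep ξ e n o (rests.map (BranchCut.mapCoef φ)) := by
  simp [noiseStep, BranchCut.mapCoef, Function.comp_def]

theorem map_closeVertex {b : Bool} (n : MIdx d) (o : O)
    (terms : Multiset (BranchCut C d K Ξ O b)) :
    (closeVertex n o terms).map (TreeCut.mapCoef φ) =
      closeVertex n o (terms.map (BranchCut.mapCoef φ)) := by
  simp [closeVertex, BranchCut.mapCoef, TreeCut.mapCoef, Multiset.map_bind, Multiset.bind_map,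
    Function.comp_def]

theorem map_cutsWith (w : MIdx d → C) (B : ℕ)
    (H : PTree d K Ξ O true → Multiset (C × PTree d K Ξ O true)) (c : Bool) {b : Bool}
    (br : Branches d K Ξ O b) :
    (cutsWith w B H c br).map (BranchCut.mapCoef φ) =
      cutsWith (fun ℓ => φ (w ℓ)) B (fun t => mapWeight φ (H t)) c br := by
  induction br generalizing c with
  | nil => cases c <;> simp only [cutsWith, map_nilStep]
  | kernel k e n o above rest ih1 ih2 =>
    cases c <;> simp only [cutsWith, Multiset.map_add, map_wcutStep, map_keepStep, map_closeVertex,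
      ih1, ih2]
  | noise ξ e n o rest ih => cases c <;> simp only [cutsWith, map_noiseStep, ih]

theorem map_wcontractVertex (p : PTree d K Ξ O true → C) (g : PTree d K Ξ O true → O) (n : MIdx d)
    (o : O) (A : Multiset (C × Branches d K Ξ O true)) (E : Multiset (BranchCut C d K Ξ O true)) :
    mapWeight φ (wcontractVertex p g n o A E) =
      wcontractVertex (fun σ => φ (p σ)) g n o (mapWeight φ A) (E.map (BranchCut.mapCoef φ)) := by
  rw [wcontractVertex, wcontractVertex, ← map_closeVertex]
  simp [mapWeight, TreeCut.mapCoef, Function.comp_def]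

/-- Coefficients arise from the weights by ring operations only. Applied to the evaluation at `X =
1`, this removes the weights of the increases. -/
theorem map_wcontract_wextract (w : MIdx d → C) (B : ℕ) (p : PTree d K Ξ O true → C)
    (g : PTree d K Ξ O true → O) {b : Bool} (br : Branches d K Ξ O b) :
    mapWeight φ (wcontract w B p g br) =
        wcontract (fun ℓ => φ (w ℓ)) B (fun σ => φ (p σ)) g br ∧
      ∀ c, (wextract w B p g c br).map (BranchCut.mapCoef φ) =
        wextract (fun ℓ => φ (w ℓ)) B (fun σ => φ (p σ)) g c br := by
  induction br with
  | nil =>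
    refine ⟨by simp [wcontract, mapWeight], fun c => ?_⟩
    cases c <;> simp only [wextract, map_nilStep]
  | kernel k e n o above rest ih1 ih2 =>
    refine ⟨?_, fun c => ?_⟩
    · simp only [wcontract]
      rw [← ih1.1, ← ih1.2, ← map_wcontractVertex, ← ih2.1]
      simp [mapWeight, Multiset.map_bind, Multiset.bind_map]
    · cases c <;> simp only [wextract, Multiset.map_add, map_wcutStep, map_keepStep,
        map_closeVertex, map_wcontractVertex, ih1.1, ih1.2, ih2.2]
  | noise ξ e n o rest ih =>
    refine ⟨?_, fun c => ?_⟩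
    · simp only [wcontract]
      rw [← ih.1]
      simp [mapWeight]
    · cases c <;> simp only [wextract, map_noiseStep, ih.2]

theorem map_contractTree (w : MIdx d → C) (B : ℕ) (p : PTree d K Ξ O true → C)
    (g : PTree d K Ξ O true → O) (t : PTree d K Ξ O true) :
    mapWeight φ (contractTree w B p g t) =
      contractTree (fun ℓ => φ (w ℓ)) B (fun σ => φ (p σ)) g t := by
  rw [contractTree, map_wcontractVertex, (map_wcontract_wextract φ w B p g t.br).1,
    (map_wcontract_wextract φ w B p g t.br).2, contractTree]

end Naturality

-- Cuts and contractions of the coactions as weighted ones with trivial weight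

section Frozen

theorem cutStep_eq {C : Type*} [CommSemiring C] {b : Bool} (B : ℕ) (k : K) (e : MIdx d)
    (heads : Multiset (C × PTree d K Ξ O true)) (rests : Multiset (BranchCut C d K Ξ O b)) :
    cutStep B k e heads rests = wcutStep (fun _ => 1) B k e heads rests := by
  simp only [cutStep, wcutStep, mul_one]

theorem cuts_eq_cutsWith (B : ℕ) (c : Bool) {b : Bool} (br : Branches d K Ξ O b) :
    cuts B c br = cutsWith (fun _ => 1) B unitHead c br := by
  induction br generalizing c with
  | nil => cases c <;> simp only [cuts, cutsWith]
  | kernel k e n o above rest ih1 ih2 =>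
    cases c <;> simp only [cuts, cutsWith, cutStep_eq, unitHead, ih1, ih2]
  | noise ξ e n o rest ih => cases c <;> simp only [cuts, cutsWith, ih]

variable (β : K → ℝ) (α : Ξ → ℝ) (R : Type*) [CommRing R]

theorem contractVertex_eq (n : MIdx d) (o : ℝ)
    (A : Multiset (SMinus d β α R × Branches d K Ξ ℝ true))
    (E : Multiset (BranchCut (SMinus d β α R) d K Ξ ℝ true)) :
    contractVertex β α R n o A E =
      wcontractVertex (projNeg β α R) (PTree.degPlus β α) n o A E := rfl

theorem contract_extract_eq (B : ℕ) {b : Bool} (br : Branches d K Ξ ℝ b) :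
    contract β α R B br = wcontract (fun _ => 1) B (projNeg β α R) (PTree.degPlus β α) br ∧
      ∀ c, extract β α R B c br =
        wextract (fun _ => 1) B (projNeg β α R) (PTree.degPlus β α) c br := by
  induction br with
  | nil =>
    refine ⟨by simp only [contract, wcontract], fun c => ?_⟩
    cases c <;> simp only [extract, wextract]
  | kernel k e n o above rest ih1 ih2 =>
    refine ⟨by simp only [contract, wcontract, contractVertex_eq, ih1.1, ih1.2, ih2.1], fun c => ?_⟩
    cases c <;> simp only [extract, wextract, contractVertex_eq, cutStep_eq, ih1.1, ih1.2, ih2.2]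
  | noise ξ e n o rest ih =>
    refine ⟨by simp only [contract, wcontract, ih.1], fun c => ?_⟩
    cases c <;> simp only [extract, wextract, ih.2]

end Frozen

/-! ## Independence of the box -/

section Box

theorem sum_map_eq_zero_of {A M : Type*} [AddCommMonoid M] {T : Multiset A} {F : A → M}
    (h : ∀ a ∈ T, F a = 0) : (T.map F).sum = 0 := by
  rw [Multiset.map_congr rfl h]
  simp

theorem sum_map_congr {A M : Type*} [AddCommMonoid M] {T : Multiset A} {F G : A → M}
    (h : ∀ a ∈ T, F a = G a) : (T.map F).sum = (T.map G).sum := by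
  rw [Multiset.map_congr rfl h]

variable {C M : Type*} [CommSemiring C] [AddCommMonoid M]

theorem sum_map_keepStep {b : Bool} (k : K) (e : MIdx d)
    (aboves : Multiset (TreeCut C d K Ξ O true)) (rests : Multiset (BranchCut C d K Ξ O b))
    (F : BranchCut C d K Ξ O b → M) :
    ((keepStep k e aboves rests).map F).sum = (aboves.map fun s => (rests.map fun t =>
      ((shuffle s.pruned t.deep).map fun l => F
        ⟨s.coef * t.coef * (mchoose (s.red + t.red) s.red : C), s.red + t.red, t.shift, t.own, l,
          .kernel k e s.trunk.dec s.trunk.exdec s.trunk.br t.kept⟩).sum).sum).sum := by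
  simp [keepStep, Multiset.map_bind, Multiset.sum_bind]

theorem sum_map_closeVertex {b : Bool} (n : MIdx d) (o : O)
    (terms : Multiset (BranchCut C d K Ξ O b)) (F : TreeCut C d K Ξ O b → M) :
    ((closeVertex n o terms).map F).sum = ∑ a ∈ Finset.Iic n, (terms.map fun t =>
      ((shuffle t.own t.deep).map fun l => F
        ⟨t.coef * (mchoose (n - a + t.shift) t.shift * mchoose (a + t.red) a : ℕ), a + t.red, l,
          ⟨n - a + t.shift, o, t.kept⟩⟩).sum).sum := by
  simp only [closeVertex, Multiset.map_bind, Multiset.sum_bind, Multiset.map_map, Function.comp_def,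
    Finset.sum]

theorem sum_map_wcutStep {b : Bool} (w : MIdx d → C) (B : ℕ) (k : K) (e : MIdx d)
    (heads : Multiset (C × PTree d K Ξ O true)) (rests : Multiset (BranchCut C d K Ξ O b))
    (F : BranchCut C d K Ξ O b → M) :
    ((wcutStep w B k e heads rests).map F).sum = ∑ ℓ ∈ Finset.Iic (fun _ => B : MIdx d),
      (heads.map fun h => (rests.map fun t => F
        ⟨h.1 * t.coef * (mchoose (t.shift + ℓ) ℓ : C) * w ℓ, t.red, t.shift + ℓ,
          ⟨k, e + ℓ, h.2⟩ :: t.own, t.deep, t.kept⟩).sum).sum := by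
  simp only [wcutStep, Multiset.map_bind, Multiset.sum_bind, Multiset.map_map, Function.comp_def,
    Finset.sum]

theorem sum_map_noiseStep {C : Type*} (ξ : Ξ) (e n : MIdx d) (o : O)
    (rests : Multiset (BranchCut C d K Ξ O false)) (F : BranchCut C d K Ξ O true → M) :
    ((noiseStep ξ e n o rests).map F).sum = (rests.map fun t =>
      F ⟨t.coef, t.red, t.shift, t.own, t.deep, .noise ξ e n o t.kept⟩).sum := by
  simp only [noiseStep, Multiset.map_map, Function.comp_def]

theorem MIdx.lt_size_of_notMem {N : ℕ} {ℓ : MIdx d} (h : ℓ ∉ Finset.Iic (fun _ => N : MIdx d)) :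
    N < ℓ.size := by
  rw [Finset.mem_Iic, Pi.le_def] at h
  push Not at h
  obtain ⟨j, hj⟩ := h
  exact hj.trans_le (Finset.single_le_sum (f := ℓ) (fun _ _ => Nat.zero_le _) (Finset.mem_univ j))

theorem sum_box {B N : ℕ} (h : N ≤ B) (f : MIdx d → M)
    (hf : ∀ ℓ : MIdx d, N < ℓ.size → f ℓ = 0) :
    ∑ ℓ ∈ Finset.Iic (fun _ => B : MIdx d), f ℓ = ∑ ℓ ∈ Finset.Iic (fun _ => N : MIdx d), f ℓ := by
  symm
  refine Finset.sum_subset (Finset.Iic_subset_Iic.2 fun _ => h) fun ℓ _ hℓ => ?_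
  exact hf ℓ (MIdx.lt_size_of_notMem hℓ)

variable (β : K → ℝ) (α : Ξ → ℝ)

theorem absSize_nonneg {b : Bool} (br : Branches d K Ξ ℝ b) : 0 ≤ br.absSize β α := by
  induction br with
  | nil => simp [Branches.absSize]
  | kernel k e n o above rest ih1 ih2 => simp only [Branches.absSize]; positivity
  | noise ξ e n o rest ih => simp only [Branches.absSize]; positivity

theorem deg_le_absSize {b : Bool} (br : Branches d K Ξ ℝ b) : br.deg β α id ≤ br.absSize β α := by
  induction br with
  | nil => simp [Branches.absSize, Branches.deg]
  | kernel k e n o above rest ih1 ih2 =>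
    simp only [Branches.absSize, Branches.deg, id]
    linarith [le_abs_self (β k), le_abs_self o, (Nat.cast_nonneg e.size : (0 : ℝ) ≤ e.size)]
  | noise ξ e n o rest ih =>
    simp only [Branches.absSize, Branches.deg, id]
    linarith [le_abs_self (α ξ - 1), le_abs_self o, (Nat.cast_nonneg e.size : (0 : ℝ) ≤ e.size)]

/-- The degree of what a term cuts off. -/
noncomputable def BranchCut.offDeg {b : Bool} (t : BranchCut C d K Ξ ℝ b) : ℝ :=
  limbsDeg β α t.own + limbsDeg β α t.deep + (t.red.size : ℝ)

/-- The degree of what a term cuts off. -/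
noncomputable def TreeCut.offDeg {b : Bool} (s : TreeCut C d K Ξ ℝ b) : ℝ :=
  limbsDeg β α s.pruned + (s.red.size : ℝ)

theorem MIdx.size_le {a b : MIdx d} (h : a ≤ b) : (a.size : ℝ) ≤ b.size :=
  Nat.cast_le.2 (Finset.sum_le_sum fun i _ => h i)

theorem offDeg_closeVertex {b : Bool} (n : MIdx d) (o : ℝ) (terms : Multiset (BranchCut C d K Ξ ℝ b))
    {D : ℝ} (h : ∀ t ∈ terms, t.offDeg β α ≤ D) (s : TreeCut C d K Ξ ℝ b)
    (hs : s ∈ closeVertex n o terms) : s.offDeg β α ≤ n.size + D := by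
  simp only [closeVertex, Multiset.mem_bind, Multiset.mem_map, Finset.mem_val,
    Finset.mem_Iic] at hs
  obtain ⟨a, ha, t, ht, l, hl, rfl⟩ := hs
  have h1 := h t ht
  have h3 := limbsDeg_shuffle β α hl
  have h4 := MIdx.size_le ha
  simp only [BranchCut.offDeg, TreeCut.offDeg, MIdx.size_add, Nat.cast_add] at h1 ⊢
  linarith

/-- Increasing the decoration of a cut edge only lowers the degree of what is cut off, so a bound
independent of the box holds. -/
theorem offDeg_cutsWith (w : MIdx d → C) (B : ℕ) (c : Bool) {b : Bool} (br : Branches d K Ξ ℝ b)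
    (t : BranchCut C d K Ξ ℝ b) (ht : t ∈ cutsWith w B unitHead c br) :
    t.offDeg β α ≤ br.absSize β α := by
  induction br generalizing c with
  | nil =>
    have : t = ⟨1, 0, 0, [], [], .nil⟩ := by
      cases c <;> simpa only [cutsWith, nilStep, Multiset.mem_singleton] using ht
    subst this
    simp [BranchCut.offDeg, limbsDeg, MIdx.size_zero, Branches.absSize]
  | kernel k e n o above rest ih1 ih2 =>
    have hk : ∀ t ∈ keepStep k e (closeVertex n o (cutsWith w B unitHead true above))
        (cutsWith w B unitHead false rest),
        t.offDeg β α ≤ (Branches.kernel k e n o above rest).absSize β α := by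
      intro t ht
      simp only [keepStep, Multiset.mem_bind, Multiset.mem_map] at ht
      obtain ⟨s, hs, t, ht, l, hl, rfl⟩ := ht
      have h1 := offDeg_closeVertex β α n o _ (ih1 true) s hs
      have h2 := ih2 false t ht
      have h3 := limbsDeg_shuffle β α hl
      simp only [BranchCut.offDeg, TreeCut.offDeg, Branches.absSize, MIdx.size_add, Nat.cast_add]
        at h1 h2 ⊢
      linarith [abs_nonneg (β k), abs_nonneg o, (Nat.cast_nonneg e.size : (0 : ℝ) ≤ e.size)]
    cases c
    · simp only [cutsWith] at ht
      exact hk t ht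
    · simp only [cutsWith, Multiset.mem_add] at ht
      rcases ht with ht | ht
      · simp only [wcutStep, unitHead, Multiset.mem_bind, Multiset.mem_map,
          Multiset.mem_singleton] at ht
        obtain ⟨ℓ, -, _, rfl, t, ht, rfl⟩ := ht
        have h2 := ih2 true t ht
        have h3 := deg_le_absSize β α above
        simp only [BranchCut.offDeg, limbsDeg, List.map_cons, List.sum_cons, MIdx.size_add,
          Nat.cast_add, PTree.degPlus, Branches.absSize] at h2 ⊢
        linarith [le_abs_self (β k), le_abs_self o, (Nat.cast_nonneg e.size : (0 : ℝ) ≤ e.size),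
          (Nat.cast_nonneg (MIdx.size ℓ) : (0 : ℝ) ≤ MIdx.size ℓ)]
      · exact hk t ht
  | noise ξ e n o rest ih =>
    have : t ∈ noiseStep ξ e n o (cutsWith w B unitHead false rest) := by
      cases c <;> simpa only [cutsWith] using ht
    simp only [noiseStep, Multiset.mem_map] at this
    obtain ⟨t, ht', rfl⟩ := this
    have h2 := ih false t ht'
    simp only [BranchCut.offDeg, Branches.absSize] at h2 ⊢
    linarith [abs_nonneg (α ξ - 1), abs_nonneg o, (Nat.cast_nonneg e.size : (0 : ℝ) ≤ e.size),
      (Nat.cast_nonneg n.size : (0 : ℝ) ≤ n.size)]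

theorem sum_closeVertex_box {b : Bool} (n : MIdx d) (o : ℝ)
    (T T' : Multiset (BranchCut C d K Ξ ℝ b)) (D : ℝ)
    (h : ∀ F : BranchCut C d K Ξ ℝ b → M, (∀ t, t.offDeg β α < D → F t = 0) →
      (T.map F).sum = (T'.map F).sum)
    (F : TreeCut C d K Ξ ℝ b → M) (hF : ∀ s, s.offDeg β α < n.size + D → F s = 0) :
    ((closeVertex n o T).map F).sum = ((closeVertex n o T').map F).sum := by
  rw [sum_map_closeVertex, sum_map_closeVertex]
  refine Finset.sum_congr rfl fun a ha => h _ fun t ht => sum_map_eq_zero_of fun l hl => hF _ ?_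
  have h3 := limbsDeg_shuffle β α hl
  have h4 := MIdx.size_le (Finset.mem_Iic.1 ha)
  simp only [BranchCut.offDeg, TreeCut.offDeg, MIdx.size_add, Nat.cast_add] at ht ⊢
  linarith

/-- A single increase with `|ℓ| > N` pushes the degree of what is cut off below `absSize - N`, where
`F` vanishes. With the threshold relative to `absSize`, the hypothesis passes to the branches above
and to the right. -/
theorem sum_cutsWith_box (w : MIdx d → C) {B N : ℕ} (hB : N ≤ B) (c : Bool) {b : Bool}
    (br : Branches d K Ξ ℝ b) (F : BranchCut C d K Ξ ℝ b → M)
    (hF : ∀ t, t.offDeg β α < br.absSize β α - N → F t = 0) :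
    ((cutsWith w B unitHead c br).map F).sum = ((cutsWith w N unitHead c br).map F).sum := by
  induction br generalizing c with
  | nil => cases c <;> simp only [cutsWith]
  | kernel k e n o above rest ih1 ih2 =>
    have hk : ((keepStep k e (closeVertex n o (cutsWith w B unitHead true above))
        (cutsWith w B unitHead false rest)).map F).sum =
      ((keepStep k e (closeVertex n o (cutsWith w N unitHead true above))
        (cutsWith w N unitHead false rest)).map F).sum := by
      rw [sum_map_keepStep, sum_map_keepStep]
      refine (sum_closeVertex_box β α n o _ (cutsWith w N unitHead true above)
        (above.absSize β α - N) (ih1 true) _ fun s hs => ?_).trans ?_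
      · refine sum_map_eq_zero_of fun t ht => sum_map_eq_zero_of fun l hl => hF _ ?_
        have h2 := offDeg_cutsWith β α w B false rest t ht
        have h3 := limbsDeg_shuffle β α hl
        simp only [BranchCut.offDeg, TreeCut.offDeg, Branches.absSize, MIdx.size_add,
          Nat.cast_add] at hs h2 ⊢
        linarith [abs_nonneg (β k), abs_nonneg o, (Nat.cast_nonneg e.size : (0 : ℝ) ≤ e.size)]
      · refine sum_map_congr fun s hs => ih2 false _ fun t ht => ?_
        refine sum_map_eq_zero_of fun l hl => hF _ ?_
        have h1 := offDeg_closeVertex β α n o _ (fun t => offDeg_cutsWith β α w N true above t) s hs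
        have h3 := limbsDeg_shuffle β α hl
        simp only [BranchCut.offDeg, TreeCut.offDeg, Branches.absSize, MIdx.size_add,
          Nat.cast_add] at ht h1 ⊢
        linarith [abs_nonneg (β k), abs_nonneg o, (Nat.cast_nonneg e.size : (0 : ℝ) ≤ e.size)]
    cases c
    · simp only [cutsWith]
      exact hk
    · simp only [cutsWith, Multiset.map_add, Multiset.sum_add, hk]
      congr 1
      rw [sum_map_wcutStep, sum_map_wcutStep]
      have hdeg := deg_le_absSize β α above
      refine (sum_box hB _ fun ℓ hℓ => ?_).trans ?_
      · simp only [unitHead, Multiset.map_singleton, Multiset.sum_singleton]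
        refine sum_map_eq_zero_of fun t ht => hF _ ?_
        have h2 := offDeg_cutsWith β α w B true rest t ht
        have h5 : (N : ℝ) < MIdx.size ℓ := Nat.cast_lt.2 hℓ
        simp only [BranchCut.offDeg, limbsDeg, List.map_cons, List.sum_cons, MIdx.size_add,
          Nat.cast_add, PTree.degPlus, Branches.absSize] at h2 ⊢
        linarith [le_abs_self (β k), le_abs_self o, (Nat.cast_nonneg e.size : (0 : ℝ) ≤ e.size)]
      · refine Finset.sum_congr rfl fun ℓ _ => ?_
        simp only [unitHead, Multiset.map_singleton, Multiset.sum_singleton]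
        refine ih2 true _ fun t ht => hF _ ?_
        simp only [BranchCut.offDeg, limbsDeg, List.map_cons, List.sum_cons, MIdx.size_add,
          Nat.cast_add, PTree.degPlus, Branches.absSize] at ht ⊢
        linarith [le_abs_self (β k), le_abs_self o, (Nat.cast_nonneg e.size : (0 : ℝ) ≤ e.size),
          (Nat.cast_nonneg (MIdx.size ℓ) : (0 : ℝ) ≤ MIdx.size ℓ)]
  | noise ξ e n o rest ih =>
    have h : ∀ B, cutsWith w B unitHead c (.noise ξ e n o rest) =
        noiseStep ξ e n o (cutsWith w B unitHead false rest) := by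
      intro B
      cases c <;> simp only [cutsWith]
    rw [h, h, sum_map_noiseStep, sum_map_noiseStep]
    refine ih false _ fun t ht => hF _ ?_
    simp only [BranchCut.offDeg, Branches.absSize] at ht ⊢
    linarith [abs_nonneg (α ξ - 1), abs_nonneg o, (Nat.cast_nonneg e.size : (0 : ℝ) ≤ e.size),
      (Nat.cast_nonneg n.size : (0 : ℝ) ≤ n.size)]

end Box

-- Independence of the box for contractions

section ContractBox

variable {C M : Type*} [CommSemiring C] [AddCommMonoid M] (β : K → ℝ) (α : Ξ → ℝ)

/-- The part of the regularity of an extracted subtree that a term is responsible for. -/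
noncomputable def BranchCut.keptReg {b : Bool} (t : BranchCut C d K Ξ ℝ b) : ℝ :=
  t.kept.forget.deg β α (fun _ => 0) + (t.shift.size : ℝ)

theorem keptReg_closeVertex {b : Bool} (n : MIdx d) (o : ℝ)
    (terms : Multiset (BranchCut C d K Ξ ℝ b)) {D : ℝ} (h : ∀ t ∈ terms, D ≤ t.keptReg β α)
    (s : TreeCut C d K Ξ ℝ b) (hs : s ∈ closeVertex n o terms) : D ≤ s.trunk.forget.reg β α := by
  simp only [closeVertex, Multiset.mem_bind, Multiset.mem_map] at hs
  obtain ⟨a, -, t, ht, l, -, rfl⟩ := hs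
  have h1 := h t ht
  simp only [BranchCut.keptReg, PTree.forget, PTree.reg, MIdx.size_add, Nat.cast_add] at h1 ⊢
  linarith [(Nat.cast_nonneg (n - a).size : (0 : ℝ) ≤ (n - a).size)]

/-- The shifts are added to vertex decorations of the extracted subtree and can only raise its
regularity, whatever the box. -/
theorem keptReg_cutsWith (w : MIdx d → C) (B : ℕ)
    (H : PTree d K Ξ ℝ true → Multiset (C × PTree d K Ξ ℝ true)) (c : Bool) {b : Bool}
    (br : Branches d K Ξ ℝ b) (t : BranchCut C d K Ξ ℝ b) (ht : t ∈ cutsWith w B H c br) :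
    -br.absSize β α ≤ t.keptReg β α := by
  induction br generalizing c with
  | nil =>
    have : t = ⟨1, 0, 0, [], [], .nil⟩ := by
      cases c <;> simpa only [cutsWith, nilStep, Multiset.mem_singleton] using ht
    subst this
    simp [BranchCut.keptReg, MIdx.size_zero, Branches.absSize, Branches.forget, Branches.deg]
  | kernel k e n o above rest ih1 ih2 =>
    have hk : ∀ t ∈ keepStep k e (closeVertex n o (cutsWith w B H true above))
        (cutsWith w B H false rest),
        -(Branches.kernel k e n o above rest).absSize β α ≤ t.keptReg β α := by
      intro t ht
      simp only [keepStep, Multiset.mem_bind, Multiset.mem_map] at ht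
      obtain ⟨s, hs, t, ht, l, -, rfl⟩ := ht
      have h1 := keptReg_closeVertex β α n o _ (ih1 true) s hs
      have h2 := ih2 false t ht
      simp only [BranchCut.keptReg, PTree.forget, PTree.reg, Branches.forget, Branches.deg,
        Branches.absSize] at h1 h2 ⊢
      linarith [neg_abs_le (β k), abs_nonneg o, (Nat.cast_nonneg n.size : (0 : ℝ) ≤ n.size)]
    cases c
    · simp only [cutsWith] at ht
      exact hk t ht
    · simp only [cutsWith, Multiset.mem_add] at ht
      rcases ht with ht | ht
      · simp only [wcutStep, Multiset.mem_bind, Multiset.mem_map] at ht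
        obtain ⟨ℓ, -, h, -, t, ht, rfl⟩ := ht
        have h2 := ih2 true t ht
        simp only [BranchCut.keptReg, Branches.absSize, MIdx.size_add, Nat.cast_add] at h2 ⊢
        linarith [abs_nonneg (β k), abs_nonneg o, absSize_nonneg β α above,
          (Nat.cast_nonneg e.size : (0 : ℝ) ≤ e.size), (Nat.cast_nonneg n.size : (0 : ℝ) ≤ n.size),
          (Nat.cast_nonneg (MIdx.size ℓ) : (0 : ℝ) ≤ MIdx.size ℓ)]
      · exact hk t ht
  | noise ξ e n o rest ih =>
    have : t ∈ noiseStep ξ e n o (cutsWith w B H false rest) := by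
      cases c <;> simpa only [cutsWith] using ht
    simp only [noiseStep, Multiset.mem_map] at this
    obtain ⟨t, ht', rfl⟩ := this
    have h2 := ih false t ht'
    simp only [BranchCut.keptReg, Branches.forget, Branches.deg, Branches.absSize] at h2 ⊢
    linarith [neg_abs_le (α ξ - 1), abs_nonneg o, (Nat.cast_nonneg n.size : (0 : ℝ) ≤ n.size)]

theorem sum_closeVertex_keptReg {b : Bool} (n : MIdx d) (o : ℝ)
    (T T' : Multiset (BranchCut C d K Ξ ℝ b)) (D : ℝ)
    (h : ∀ F : BranchCut C d K Ξ ℝ b → M, (∀ t, t.coef = 0 → F t = 0) →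
      (∀ t, D < t.keptReg β α → F t = 0) → (T.map F).sum = (T'.map F).sum)
    (F : TreeCut C d K Ξ ℝ b → M) (h0 : ∀ s, s.coef = 0 → F s = 0)
    (hF : ∀ s, D < s.trunk.forget.reg β α → F s = 0) :
    ((closeVertex n o T).map F).sum = ((closeVertex n o T').map F).sum := by
  rw [sum_map_closeVertex, sum_map_closeVertex]
  refine Finset.sum_congr rfl fun a ha => h _ (fun t ht => sum_map_eq_zero_of fun l hl => h0 _ ?_)
    fun t ht => sum_map_eq_zero_of fun l hl => hF _ ?_
  · simp only [ht, zero_mul]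
  · simp only [BranchCut.keptReg, PTree.forget, PTree.reg, MIdx.size_add, Nat.cast_add] at ht ⊢
    linarith [(Nat.cast_nonneg (n - a).size : (0 : ℝ) ≤ (n - a).size)]

theorem sum_wcontractVertex_box (p : PTree d K Ξ ℝ true → C) (g : PTree d K Ξ ℝ true → ℝ)
    (hp : ∀ σ, 0 ≤ σ.forget.reg β α → p σ = 0) (n : MIdx d) (o : ℝ)
    (A A' : Multiset (C × Branches d K Ξ ℝ true)) (E E' : Multiset (BranchCut C d K Ξ ℝ true))
    (D : ℝ) (hD : 0 ≤ D)
    (hA : ∀ F : C × Branches d K Ξ ℝ true → M, (∀ q, q.1 = 0 → F q = 0) →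
      (A.map F).sum = (A'.map F).sum)
    (hE : ∀ F : BranchCut C d K Ξ ℝ true → M, (∀ t, t.coef = 0 → F t = 0) →
      (∀ t, D < t.keptReg β α → F t = 0) → (E.map F).sum = (E'.map F).sum)
    (F : C × PTree d K Ξ ℝ true → M) (h0 : ∀ q, q.1 = 0 → F q = 0) :
    ((wcontractVertex p g n o A E).map F).sum = ((wcontractVertex p g n o A' E').map F).sum := by
  simp only [wcontractVertex, Multiset.map_add, Multiset.sum_add, Multiset.map_map,
    Function.comp_def]
  congr 1
  · exact hA _ fun q hq => h0 _ hq
  · refine sum_closeVertex_keptReg β α n o E E' D hE _ (fun s hs => h0 _ ?_) fun s hs => h0 _ ?_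
    · simp only [hs, zero_mul]
    · simp only [hp _ (hD.trans hs.le), mul_zero]

/-- An increase with `|ℓ| > N` raises the kept regularity above `N - absSize`, which is nonnegative
by `hN`. Subtrees of nonnegative regularity have weight `0`, so such terms disappear when the vertex
is closed. An unfinished extraction has not yet been given this weight; the second claim therefore
assumes that `F` discards large kept regularities. -/
theorem sum_contract_extract_box (w : MIdx d → C) (p : PTree d K Ξ ℝ true → C)
    (g : PTree d K Ξ ℝ true → ℝ) (hp : ∀ σ, 0 ≤ σ.forget.reg β α → p σ = 0) {B N : ℕ} (hB : N ≤ B)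
    {b : Bool} (br : Branches d K Ξ ℝ b) (hN : br.absSize β α ≤ N) :
    (∀ F : C × Branches d K Ξ ℝ b → M, (∀ q, q.1 = 0 → F q = 0) →
      ((wcontract w B p g br).map F).sum = ((wcontract w N p g br).map F).sum) ∧
    ∀ c, ∀ F : BranchCut C d K Ξ ℝ b → M, (∀ t, t.coef = 0 → F t = 0) →
      (∀ t, N - br.absSize β α < t.keptReg β α → F t = 0) →
      ((wextract w B p g c br).map F).sum = ((wextract w N p g c br).map F).sum := by
  induction br with
  | nil =>
    refine ⟨fun F _ => by simp only [wcontract], fun c F _ _ => ?_⟩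
    cases c <;> simp only [wextract]
  | kernel k e n o above rest ih1 ih2 =>
    have a1 := absSize_nonneg β α above
    have a2 := absSize_nonneg β α rest
    have a3 := abs_nonneg (β k)
    have a4 := abs_nonneg o
    have a5 : (0 : ℝ) ≤ e.size := Nat.cast_nonneg _
    have a6 : (0 : ℝ) ≤ n.size := Nat.cast_nonneg _
    simp only [Branches.absSize] at hN ⊢
    have ih1 := ih1 (by linarith)
    have ih2 := ih2 (by linarith)
    have hV := sum_wcontractVertex_box (M := M) β α p g hp n o _ _ _ _
      (N - above.absSize β α) (by linarith) ih1.1 (ih1.2 true)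
    refine ⟨fun F h0 => ?_, fun c F h0 hF => ?_⟩
    · simp only [wcontract, Multiset.map_bind, Multiset.sum_bind, Multiset.map_map,
        Function.comp_def]
      refine (hV _ fun q hq => sum_map_eq_zero_of fun q' _ => h0 _ ?_).trans ?_
      · simp only [hq, zero_mul]
      · refine sum_map_congr fun q _ => ih2.1 _ fun q' hq' => h0 _ ?_
        simp only [hq', mul_zero]
    · have hl : ∀ (B c), ∀ t ∈ wextract w B p g c rest, -rest.absSize β α ≤ t.keptReg β α := by
        intro B c t ht
        rw [wextract_eq_cutsWith] at ht
        exact keptReg_cutsWith β α w B _ c rest t ht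
      have hla : ∀ B, ∀ s ∈ closeVertex n o (wextract w B p g true above),
          -above.absSize β α ≤ s.trunk.forget.reg β α := by
        intro B s hs
        refine keptReg_closeVertex β α n o _ (fun t ht => ?_) s hs
        rw [wextract_eq_cutsWith] at ht
        exact keptReg_cutsWith β α w B _ true above t ht
      have hk : ((keepStep k e (closeVertex n o (wextract w B p g true above))
          (wextract w B p g false rest)).map F).sum =
          ((keepStep k e (closeVertex n o (wextract w N p g true above))
            (wextract w N p g false rest)).map F).sum := by
        rw [sum_map_keepStep, sum_map_keepStep]
        refine (sum_closeVertex_keptReg β α n o _ (wextract w N p g true above)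
          (N - above.absSize β α) (ih1.2 true) _ (fun s hs => ?_) fun s hs => ?_).trans ?_
        · refine sum_map_eq_zero_of fun t ht => sum_map_eq_zero_of fun l hl => h0 _ ?_
          simp only [hs, zero_mul]
        · refine sum_map_eq_zero_of fun t ht => sum_map_eq_zero_of fun l _ => hF _ ?_
          have h2 := hl B false t ht
          simp only [BranchCut.keptReg, PTree.forget, PTree.reg, Branches.forget,
            Branches.deg] at hs h2 ⊢
          linarith [neg_abs_le (β k)]
        · refine sum_map_congr fun s hs => ih2.2 false _ (fun t ht => ?_) fun t ht => ?_
          · refine sum_map_eq_zero_of fun l hl => h0 _ ?_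
            simp only [ht, mul_zero, zero_mul]
          · refine sum_map_eq_zero_of fun l _ => hF _ ?_
            have h1 := hla N s hs
            simp only [BranchCut.keptReg, PTree.forget, PTree.reg, Branches.forget,
              Branches.deg] at ht h1 ⊢
            linarith [neg_abs_le (β k)]
      cases c
      · simp only [wextract]
        exact hk
      · simp only [wextract, Multiset.map_add, Multiset.sum_add, hk]
        congr 1
        rw [sum_map_wcutStep, sum_map_wcutStep]
        refine (sum_box hB _ fun ℓ hℓ => ?_).trans ?_
        · refine sum_map_eq_zero_of fun h _ => sum_map_eq_zero_of fun t ht => hF _ ?_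
          have h2 := hl B true t ht
          have h5 : (N : ℝ) < MIdx.size ℓ := Nat.cast_lt.2 hℓ
          simp only [BranchCut.keptReg, MIdx.size_add, Nat.cast_add] at h2 ⊢
          linarith
        · refine Finset.sum_congr rfl fun ℓ _ => ?_
          refine (hV _ fun q hq => sum_map_eq_zero_of fun q' _ => h0 _ ?_).trans ?_
          · simp only [hq, zero_mul]
          · refine sum_map_congr fun q _ => ih2.2 true _ (fun t ht => h0 _ ?_) fun t ht => hF _ ?_
            · simp only [ht, mul_zero, zero_mul]
            · simp only [BranchCut.keptReg, MIdx.size_add, Nat.cast_add] at ht ⊢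
              linarith [(Nat.cast_nonneg (MIdx.size ℓ) : (0 : ℝ) ≤ MIdx.size ℓ)]
  | noise ξ e n o rest ih =>
    have a4 := abs_nonneg o
    have a3 := abs_nonneg (α ξ - 1)
    have a5 : (0 : ℝ) ≤ e.size := Nat.cast_nonneg _
    have a6 : (0 : ℝ) ≤ n.size := Nat.cast_nonneg _
    simp only [Branches.absSize] at hN ⊢
    have ih := ih (by linarith)
    refine ⟨fun F h0 => ?_, fun c F h0 hF => ?_⟩
    · simp only [wcontract, Multiset.map_map, Function.comp_def]
      exact ih.1 _ fun q hq => h0 _ hq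
    · have h : ∀ B, wextract w B p g c (.noise ξ e n o rest) =
          noiseStep ξ e n o (wextract w B p g false rest) := by
        intro B
        cases c <;> simp only [wextract]
      rw [h, h, sum_map_noiseStep, sum_map_noiseStep]
      refine ih.2 false _ (fun t ht => h0 _ ht) fun t ht => hF _ ?_
      simp only [BranchCut.keptReg, Branches.forget, Branches.deg] at ht ⊢
      linarith [neg_abs_le (α ξ - 1)]

theorem sum_contractTree_box (w : MIdx d → C) (p : PTree d K Ξ ℝ true → C)
    (g : PTree d K Ξ ℝ true → ℝ) (hp : ∀ σ, 0 ≤ σ.forget.reg β α → p σ = 0) {B N : ℕ} (hB : N ≤ B)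
    (t : PTree d K Ξ ℝ true) (hN : t.br.absSize β α ≤ N)
    (F : C × PTree d K Ξ ℝ true → M) (h0 : ∀ q, q.1 = 0 → F q = 0) :
    ((contractTree w B p g t).map F).sum = ((contractTree w N p g t).map F).sum := by
  have h := sum_contract_extract_box (M := M) β α w p g hp hB t.br hN
  exact sum_wcontractVertex_box β α p g hp t.dec t.exdec _ _ _ _ (N - t.br.absSize β α)
    (by linarith) h.1 (h.2 true) F h0

end ContractBox

/-! ## Truncation -/

theorem ofLimbs_limbsOf (κ : Branches d K Ξ O false) : ofLimbs (limbsOf κ) = κ := by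
  -- The index is made a variable with an equation, as the induction on an indexed family requires.
  suffices h : ∀ {b : Bool} (κ : Branches d K Ξ O b), b = false → ofLimbs (limbsOf κ) = κ from
    h κ rfl
  intro b κ hb
  induction κ with
  | nil => rfl
  | kernel k e n o above rest ih1 ih2 => simp only [limbsOf, ofLimbs, ih2 hb]
  | noise ξ e n o rest ih => cases hb

section Trunc

variable {S : Type u} [CommRing S]

/-- The sum of the coefficients up to degree `N`. -/
noncomputable def truncSum (N : ℕ) : Polynomial S →+ S :=
  ∑ k ∈ Finset.range (N + 1), (Polynomial.lcoeff S k).toAddMonoidHom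

theorem truncSum_apply (N : ℕ) (c : Polynomial S) :
    truncSum N c = ∑ k ∈ Finset.range (N + 1), c.coeff k := by
  simp [truncSum]

theorem truncSum_eq_eval {N : ℕ} {c : Polynomial S} (h : c.natDegree ≤ N) :
    truncSum N c = c.eval 1 := by
  rw [truncSum_apply, Polynomial.eval_eq_sum_range' (Nat.lt_succ_of_le h)]
  simp

/-- Polynomials modulo `X ^ (N + 1)`. -/
abbrev TruncPoly (S : Type u) [CommRing S] (N : ℕ) : Type u :=
  Polynomial S ⧸ Ideal.span {(Polynomial.X : Polynomial S) ^ (N + 1)}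

/-- Multiples of `X ^ (N + 1)` have no coefficients up to degree `N`, so `truncSum` descends to the
quotient. -/
theorem truncSum_eq_of_mk_eq {N : ℕ} {c c' : Polynomial S}
    (h : (Ideal.Quotient.mk _ c : TruncPoly S N) = Ideal.Quotient.mk _ c') :
    truncSum N c = truncSum N c' := by
  rw [Ideal.Quotient.eq, Ideal.mem_span_singleton] at h
  rw [← sub_eq_zero, ← map_sub, truncSum_apply]
  refine Finset.sum_eq_zero fun k hk => ?_
  exact Polynomial.X_pow_dvd_iff.1 h k (Finset.mem_range.1 hk)

/-- The sum of the coefficients of a truncated polynomial. -/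
noncomputable def quotSum (N : ℕ) : TruncPoly S N →+ S :=
  AddMonoidHom.mk' (fun q => truncSum N (Function.surjInv Ideal.Quotient.mk_surjective q)) <| by
    intro a b
    rw [← map_add]
    refine truncSum_eq_of_mk_eq (N := N) ?_
    simp only [map_add, Function.surjInv_eq]

theorem quotSum_mk (N : ℕ) (c : Polynomial S) :
    quotSum N (Ideal.Quotient.mk _ c) = truncSum N c :=
  truncSum_eq_of_mk_eq (Function.surjInv_eq _ _)

variable {M : Type*} [AddCommGroup M] [Module S M]

/-- The additive map out of `DPSh` with prescribed additive maps on the lines of the basis. -/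
noncomputable def DPSh.sumHom {X : Type} {C : Type*} [CommRing C] {M : Type*} [AddCommGroup M]
    (F : MIdx d × List X → C →+ M) : DPSh d X C →+ M :=
  (Finsupp.liftAddHom F : ((MIdx d × List X) →₀ C) →+ M)

theorem DPSh.sumHom_smul_bas {X : Type} {C : Type*} [CommRing C] {M : Type*} [AddCommGroup M]
    (F : MIdx d × List X → C →+ M) (c : C) (a : MIdx d) (l : List X) :
    DPSh.sumHom F (c • DPSh.bas a l) = F (a, l) c := by
  have h : c • (DPSh.bas a l : DPSh d X C) =
      (Finsupp.single (a, l) c : (MIdx d × List X) →₀ C) := by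
    unfold DPSh.bas
    exact (Finsupp.smul_single _ _ _).trans (by rw [smul_eq_mul, mul_one])
  rw [h]
  exact Finsupp.liftAddHom_apply_single _ _ _

/-- Insert truncated weights and basis elements into a function. -/
noncomputable def evalOut (N : ℕ) (f : MIdx d → Branches d K Ξ O false → PTree d K Ξ O true → M) :
    (PTree d K Ξ O true →₀ DPSh d (Limb d K Ξ O) (TruncPoly S N)) →+ M :=
  Finsupp.liftAddHom fun τ => DPSh.sumHom fun q : MIdx d × List (Limb d K Ξ O) =>
    ((AddMonoidHom.flip (smulAddHom S M)) (f q.1 (ofLimbs q.2) τ)).comp (quotSum N)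

/-- Summing the coefficients of a truncated polynomial is additive but not multiplicative. It is
therefore applied only after the weights of both sides have been multiplied out in the quotient. -/
theorem evalOut_single (N : ℕ) (f : MIdx d → Branches d K Ξ O false → PTree d K Ξ O true → M)
    (τ : PTree d K Ξ O true) (c : Polynomial S) (a : MIdx d) (l : List (Limb d K Ξ O)) :
    evalOut N f (Finsupp.single τ ((Ideal.Quotient.mk _ c : TruncPoly S N) •
      (DPSh.bas a l : DPSh d (Limb d K Ξ O) (TruncPoly S N)))) =
      truncSum N c • f a (ofLimbs l) τ := by
  rw [evalOut, Finsupp.liftAddHom_apply_single, DPSh.sumHom_smul_bas]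
  simp [quotSum_mk]

/-- The weight of an increase of an edge decoration. -/
noncomputable def degWeight (S : Type u) [CommRing S] (ℓ : MIdx d) : Polynomial S :=
  Polynomial.X ^ ℓ.size

/-- This is `wsum_conT_cutT` for the universal characters over truncated polynomials, read off
coefficient by coefficient with `evalOut`. One box serves all cuts and contractions, and no degree
assumption is needed. -/
theorem sum_contract_cut_trunc (p : PTree d K Ξ O true → Polynomial S)
    (g : PTree d K Ξ O true → O) (N : ℕ)
    (f : MIdx d → Branches d K Ξ O false → PTree d K Ξ O true → M) (t : PTree d K Ξ O true) :
    ((contractTree (degWeight S) N p g t).map fun q =>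
      ((closeVertex q.2.dec q.2.exdec (cutsWith (degWeight S) N unitHead true q.2.br)).map fun s =>
        truncSum N (q.1 * s.coef) • f s.red (ofLimbs s.pruned) s.trunk).sum).sum =
    ((closeVertex t.dec t.exdec (cutsWith (degWeight S) N unitHead true t.br)).map fun s =>
      ((wcontract (degWeight S) N p g (ofLimbs s.pruned : Branches d K Ξ O false)).map fun a =>
        ((contractTree (degWeight S) N p g s.trunk).map fun h =>
          truncSum N (s.coef * a.1 * h.1) • f s.red a.2 h.2).sum).sum).sum := by
  let Q := TruncPoly S N
  let W := DPSh d (Limb d K Ξ O) Q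
  let mk : Polynomial S →+* Q := Ideal.Quotient.mk _
  let r : Rule d K Ξ O (Polynomial S) := ⟨degWeight S, N, p, g⟩
  let i : Polynomial S →+* W := univHom mk
  have hmk : r.Small mk := by
    refine ⟨fun a b => ?_, fun a ha => ?_⟩
    · simp only [r, degWeight, MIdx.size_add, pow_add, map_mul]
    -- Outside the box some coordinate exceeds `N`, so the exponent is at least `N + 1`.
    · refine Ideal.Quotient.eq_zero_iff_mem.2 (Ideal.mem_span_singleton.2 (pow_dvd_pow _ ?_))
      exact MIdx.lt_size_of_notMem ha
  have hi : r.Small i := hmk.univHom r mk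
  have key := congrArg (evalOut N f) (wsum_conT_cutT r i (univChars d K Ξ O Q) hi t
    fun τ => (Finsupp.single τ 1 : PTree d K Ξ O true →₀ W))
  have hsm : ∀ (c : Polynomial S) (m : PTree d K Ξ O true →₀ W), i c • m = mk c • m := by
    intro c m
    exact algebraMap_smul W (mk c) m
  have hb : ∀ (a : MIdx d) (l : List (Limb d K Ξ O)) (c : Polynomial S),
      i c * (univChars d K Ξ O Q).x a * (univChars d K Ξ O Q).U l = mk c • DPSh.bas a l := by
    intro a l c
    simp only [univChars]
    rw [mul_assoc, ← DPSh.bas_eq, Algebra.smul_def]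
    rfl
  refine Eq.trans ?_ (key.trans ?_)
  · rw [conT, wsum_mapWeight, map_multiset_sum, Multiset.map_map]
    refine sum_map_congr fun q _ => ?_
    rw [Function.comp_apply, cutT, wsum_evalTree, hsm, Multiset.smul_sum, map_multiset_sum,
      Multiset.map_map, Multiset.map_map]
    refine sum_map_congr fun s _ => ?_
    simp only [Function.comp_apply]
    rw [hb, Finsupp.smul_single, Finsupp.smul_single, smul_eq_mul, mul_one, smul_smul, ← map_mul,
      evalOut_single]
  · rw [cutT, wsum_evalTree, map_multiset_sum, Multiset.map_map]
    refine sum_map_congr fun s _ => ?_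
    have h1 : ((univChars d K Ξ O Q).con r i).U s.pruned =
        wsum (conB r i (ofLimbs s.pruned : Branches d K Ξ O false)) fun κ =>
          (univChars d K Ξ O Q).U (limbsOf κ) := by
      rw [conB_ofLimbs]
      simp only [limbsOf_ofLimbs]
      rfl
    rw [Function.comp_apply, h1, ← wsum_mul_left, conB, wsum_mapWeight, Multiset.sum_smul,
      map_multiset_sum, Multiset.map_map, Multiset.map_map]
    refine sum_map_congr fun a _ => ?_
    simp only [Function.comp_apply]
    rw [conT, wsum_mapWeight, Multiset.smul_sum, map_multiset_sum, Multiset.map_map,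
      Multiset.map_map]
    refine sum_map_congr fun h _ => ?_
    simp only [Function.comp_apply]
    have h2 : i a.1 • (i s.coef * ((univChars d K Ξ O Q).con r i).x s.red *
        (univChars d K Ξ O Q).U (limbsOf a.2)) =
        mk (s.coef * a.1) • DPSh.bas s.red (limbsOf a.2) := by
      rw [← hb, map_mul, smul_eq_mul]
      simp only [Chars.con]
      ring
    rw [h2, smul_smul, Finsupp.smul_single, smul_eq_mul, mul_one]
    have h3 : mk (s.coef * a.1) • (DPSh.bas s.red (limbsOf a.2) : W) * i h.1 =
        mk (s.coef * a.1 * h.1) • DPSh.bas s.red (limbsOf a.2) := by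
      rw [mul_comm, mul_smul_comm, map_mul mk _ h.1, mul_smul, Algebra.smul_def (mk h.1)]
      rfl
    rw [h3, evalOut_single, ofLimbs_limbsOf]

end Trunc

-- Comparison of the truncated identity with the coactions

section Final

variable (β : K → ℝ) (α : Ξ → ℝ) (R : Type u) [CommRing R]

/-- The weight of a contracted subtree, as a constant polynomial. -/
noncomputable def polyNeg (σ : PTree d K Ξ ℝ true) : Polynomial (SMinus d β α R) :=
  Polynomial.C (projNeg β α R σ)

/-- All contractions of a tree, with polynomial weights. -/
noncomputable def polyContract (B : ℕ) (t : PTree d K Ξ ℝ true) :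
    Multiset (Polynomial (SMinus d β α R) × PTree d K Ξ ℝ true) :=
  contractTree (degWeight (SMinus d β α R)) B (polyNeg β α R) (PTree.degPlus β α) t

/-- All contractions inside the branches at a vertex, with polynomial weights. -/
noncomputable def polyContractBr (B : ℕ) {b : Bool} (br : Branches d K Ξ ℝ b) :
    Multiset (Polynomial (SMinus d β α R) × Branches d K Ξ ℝ b) :=
  wcontract (degWeight (SMinus d β α R)) B (polyNeg β α R) (PTree.degPlus β α) br

/-- All left admissible cuts of a tree, with polynomial weights. -/
noncomputable def polyCut (B : ℕ) (t : PTree d K Ξ ℝ true) :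
    Multiset (TreeCut (Polynomial (SMinus d β α R)) d K Ξ ℝ true) :=
  closeVertex t.dec t.exdec (cutsWith (degWeight (SMinus d β α R)) B unitHead true t.br)

/-- The term of the identity with the given trees. -/
noncomputable def outTerm (n : MIdx d) (κ : Branches d K Ξ ℝ false) (τ : PTree d K Ξ ℝ true) :
    SMinus d β α R ⊗[R] (TExPlus d β α R ⊗[R] TEx d K Ξ R) :=
  1 ⊗ₜ (projPos β α R ⟨n, 0, κ⟩ ⊗ₜ Finsupp.single τ 1)

theorem eval_degWeight {S : Type*} [CommRing S] :
    (fun ℓ : MIdx d => Polynomial.evalRingHom (1 : S) (degWeight S ℓ)) = fun _ => 1 := by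
  funext ℓ
  simp [degWeight]

theorem eval_polyNeg : (fun σ : PTree d K Ξ ℝ true =>
    Polynomial.evalRingHom 1 (polyNeg β α R σ)) = projNeg β α R := by
  funext σ
  simp [polyNeg]

theorem contractVertex_eq_polyContract (B : ℕ) (t : PTree d K Ξ ℝ true) :
    contractVertex β α R t.dec t.exdec (contract β α R B t.br) (extract β α R B true t.br) =
      mapWeight (Polynomial.evalRingHom 1) (polyContract β α R B t) := by
  rw [polyContract, map_contractTree, eval_degWeight, eval_polyNeg, contractVertex_eq,
    (contract_extract_eq β α R B t.br).1, (contract_extract_eq β α R B t.br).2, contractTree]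

theorem contract_eq_polyContractBr (B : ℕ) {b : Bool} (br : Branches d K Ξ ℝ b) :
    contract β α R B br = mapWeight (Polynomial.evalRingHom 1) (polyContractBr β α R B br) := by
  rw [polyContractBr, (map_wcontract_wextract _ _ _ _ _ br).1, eval_degWeight, eval_polyNeg,
    (contract_extract_eq β α R B br).1]

theorem cuts_eq_polyCut (B : ℕ) (t : PTree d K Ξ ℝ true) :
    (closeVertex t.dec t.exdec (cuts B true t.br)).map
        (TreeCut.mapCoef (Nat.castRingHom (SMinus d β α R))) =
      (polyCut β α R B t).map (TreeCut.mapCoef (Polynomial.evalRingHom 1)) := by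
  rw [polyCut, map_closeVertex, map_closeVertex, cuts_eq_cutsWith, map_cutsWith, map_cutsWith,
    eval_degWeight]
  simp [mapWeight, unitHead]

theorem sum_cuts_eq {M : Type*} [AddCommMonoid M] (B : ℕ) (t : PTree d K Ξ ℝ true)
    (F : SMinus d β α R → MIdx d → List (Limb d K Ξ ℝ) → PTree d K Ξ ℝ true → M) :
    ((closeVertex t.dec t.exdec (cuts B true t.br)).map fun s =>
      F (s.coef : SMinus d β α R) s.red s.pruned s.trunk).sum =
    ((polyCut β α R B t).map fun s => F (s.coef.eval 1) s.red s.pruned s.trunk).sum := by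
  have h := congrArg (fun T => (T.map fun s : TreeCut (SMinus d β α R) d K Ξ ℝ true =>
    F s.coef s.red s.pruned s.trunk).sum) (cuts_eq_polyCut β α R B t)
  simpa only [Multiset.map_map, Function.comp_def, TreeCut.mapCoef, eq_natCast,
    Polynomial.coe_evalRingHom] using h

theorem absSize_le_bound {b : Bool} (t : PTree d K Ξ ℝ b) :
    (t.dec.size : ℝ) + t.br.absSize β α ≤ t.bound β α := by
  refine le_trans ?_ (Nat.le_ceil _)
  linarith [abs_nonneg t.exdec]

/-- The inequality is strict because the unit has degree zero and survives the projection. -/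
theorem projPos_eq_zero {t : PTree d K Ξ ℝ false} (h : t.degPlus β α < 0) :
    projPos β α R t = 0 := by
  rw [projPos, dif_neg]
  rintro (h1 | rfl)
  · exact absurd h1 h.not_gt
  · simp [PTree.degPlus, PTree.one, MIdx.size_zero, Branches.deg] at h

theorem outTerm_eq_zero {n : MIdx d} {κ : Branches d K Ξ ℝ false} (τ : PTree d K Ξ ℝ true)
    (h : (n.size : ℝ) + κ.deg β α id < 0) : outTerm β α R n κ τ = 0 := by
  rw [outTerm, projPos_eq_zero, TensorProduct.zero_tmul, TensorProduct.tmul_zero]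
  simpa only [PTree.degPlus, add_zero] using h

theorem polyNeg_eq_zero (σ : PTree d K Ξ ℝ true) (h : 0 ≤ σ.forget.reg β α) :
    polyNeg β α R σ = 0 := by
  rw [polyNeg, projNeg, dif_neg h.not_gt, map_zero]

theorem deg_of_mem_polyContractBr (B : ℕ) {b : Bool} (br : Branches d K Ξ ℝ b)
    (q : Polynomial (SMinus d β α R) × Branches d K Ξ ℝ b) (hq : q ∈ polyContractBr β α R B br) :
    q.2.deg β α id = br.deg β α id := by
  refine (deg_contract_extract β α R B br).1 (q.1.eval 1, q.2) ?_
  rw [contract_eq_polyContractBr]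
  exact Multiset.mem_map_of_mem (fun q : Polynomial (SMinus d β α R) × Branches d K Ξ ℝ b =>
    (Polynomial.evalRingHom 1 q.1, q.2)) hq

/-- Contractions preserve the degree, and away from the root they never remove the last edge, so a
tree becomes the unit only if it was the unit. -/
theorem isPos_contract_iff (B : ℕ) (t : PTree d K Ξ ℝ false)
    (q : SMinus d β α R × Branches d K Ξ ℝ false) (hq : q ∈ contract β α R B t.br) :
    (⟨t.dec, t.exdec, q.2⟩ : PTree d K Ξ ℝ false).IsPos β α ↔ t.IsPos β α := by
  refine ⟨?_, fun h => isPos_of_mem_contract β α R B ⟨t, h⟩ q hq⟩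
  obtain ⟨n, o, br⟩ := t
  rintro (h | h)
  · left
    have h1 := (deg_contract_extract β α R B br).1 q hq
    simp only [PTree.degPlus] at h ⊢
    rwa [← h1]
  · right
    simp only [PTree.one, PTree.mk.injEq] at h ⊢
    refine ⟨h.1, h.2.1, ?_⟩
    have h2 := h.2.2
    cases br with
    | nil => rfl
    | kernel k e n o above rest =>
      simp only [contract, Multiset.mem_bind, Multiset.mem_map] at hq
      obtain ⟨_, _, _, _, rfl⟩ := hq
      cases h2

theorem deltaMinusExNonRoot_projPos (t : PTree d K Ξ ℝ false) :
    deltaMinusExNonRoot β α R (projPos β α R t) =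
      ((contract β α R (t.bound β α) t.br).map fun q =>
        q.1 ⊗ₜ[R] projPos β α R ⟨t.dec, t.exdec, q.2⟩).sum := by
  by_cases h : t.IsPos β α
  · rw [projPos, dif_pos h, deltaMinusExNonRoot, Finsupp.linearCombination_single, one_smul]
    congr 1
    rw [← Multiset.pmap_eq_map (p := fun q => (⟨t.dec, t.exdec, q.2⟩ : PTree d K Ξ ℝ false).IsPos β α)
      _ _ (isPos_of_mem_contract β α R (t.bound β α) ⟨t, h⟩)]
    refine Multiset.pmap_congr _ fun q _ h1 _ => ?_
    rw [projPos, dif_pos h1]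
  · have h1 : projPos β α R t = 0 := dif_neg h
    rw [h1, map_zero]
    symm
    refine sum_map_eq_zero_of fun q hq => ?_
    have h2 : projPos β α R ⟨t.dec, t.exdec, q.2⟩ = 0 :=
      dif_neg fun h' => h ((isPos_contract_iff β α R _ t q hq).1 h')
    rw [h2, TensorProduct.tmul_zero]

theorem eventually_forall_mem {A : Type*} (T : Multiset A) {P : ℕ → A → Prop}
    (h : ∀ a ∈ T, ∀ᶠ N in Filter.atTop, P N a) : ∀ᶠ N in Filter.atTop, ∀ a ∈ T, P N a := by
  induction T using Multiset.induction_on with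
  | empty => simp
  | cons a T ih =>
    simp only [Multiset.forall_mem_cons, Filter.eventually_and]
    exact ⟨h a (Multiset.mem_cons_self a T), ih fun b hb => h b (Multiset.mem_cons_of_mem hb)⟩

theorem sum_polyContract {M : Type*} [AddCommMonoid M] {B : ℕ} (t : PTree d K Ξ ℝ true)
    (hB : t.bound β α ≤ B) (F : Polynomial (SMinus d β α R) × PTree d K Ξ ℝ true → M)
    (h0 : ∀ q, q.1 = 0 → F q = 0) :
    ((polyContract β α R B t).map F).sum = ((polyContract β α R (t.bound β α) t).map F).sum :=
  sum_contractTree_box β α _ _ _ (polyNeg_eq_zero β α R) hB t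
    (le_trans (by simp) (absSize_le_bound β α t)) F h0

theorem sum_polyContractBr {M : Type*} [AddCommMonoid M] {B : ℕ} {b : Bool} (t : PTree d K Ξ ℝ b)
    (hB : t.bound β α ≤ B) (F : Polynomial (SMinus d β α R) × Branches d K Ξ ℝ b → M)
    (h0 : ∀ q, q.1 = 0 → F q = 0) :
    ((polyContractBr β α R B t.br).map F).sum =
      ((polyContractBr β α R (t.bound β α) t.br).map F).sum :=
  (sum_contract_extract_box β α _ _ _ (polyNeg_eq_zero β α R) hB t.br
    (le_trans (by simp) (absSize_le_bound β α t))).1 F h0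

theorem sum_polyCut {M : Type*} [AddCommMonoid M] {B : ℕ} (t : PTree d K Ξ ℝ true)
    (hB : t.bound β α ≤ B) (F : TreeCut (Polynomial (SMinus d β α R)) d K Ξ ℝ true → M)
    (hF : ∀ s, (s.red.size : ℝ) + limbsDeg β α s.pruned < 0 → F s = 0) :
    ((polyCut β α R B t).map F).sum = ((polyCut β α R (t.bound β α) t).map F).sum := by
  refine sum_closeVertex_box β α t.dec t.exdec _ _ (t.br.absSize β α - t.bound β α)
    (sum_cutsWith_box β α _ hB true t.br) F fun s hs => hF s ?_
  have h := absSize_le_bound β α t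
  simp only [TreeCut.offDeg] at hs
  linarith

/-- The outer box is first shrunk to `t.bound β α`, after which the terms no longer depend on `N`.
Only finitely many inner bounds and polynomial degrees then remain to be exceeded by `N`; beyond
them the inner boxes can be shrunk too and `truncSum` is the value at `1`. -/
theorem eventually_contract_cut (t : PTree d K Ξ ℝ true) : ∀ᶠ N in Filter.atTop,
    ((polyContract β α R N t).map fun q => ((polyCut β α R N q.2).map fun s =>
      truncSum N (q.1 * s.coef) • outTerm β α R s.red (ofLimbs s.pruned) s.trunk).sum).sum =
    ((polyContract β α R (t.bound β α) t).map fun q =>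
      ((polyCut β α R (q.2.bound β α) q.2).map fun s =>
        (q.1 * s.coef).eval 1 • outTerm β α R s.red (ofLimbs s.pruned) s.trunk).sum).sum := by
  have h1 := eventually_forall_mem (polyContract β α R (t.bound β α) t)
    (P := fun N q => q.2.bound β α ≤ N) fun q _ => Filter.eventually_ge_atTop _
  have h2 := eventually_forall_mem (polyContract β α R (t.bound β α) t)
    (P := fun N q => ∀ s ∈ polyCut β α R (q.2.bound β α) q.2, (q.1 * s.coef).natDegree ≤ N)
    fun q _ => eventually_forall_mem _ fun s _ => Filter.eventually_ge_atTop _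
  filter_upwards [Filter.eventually_ge_atTop (t.bound β α), h1, h2] with N h0 h1 h2
  rw [sum_polyContract β α R t h0 _ fun q hq => sum_map_eq_zero_of fun s _ => by
    rw [hq, zero_mul, map_zero, zero_smul]]
  refine sum_map_congr fun q hq => ?_
  rw [sum_polyCut β α R q.2 (h1 q hq) _ fun s hs => by
    rw [outTerm_eq_zero, smul_zero]; rwa [deg_ofLimbs]]
  refine sum_map_congr fun s hs => ?_
  rw [truncSum_eq_eval (h2 q hq s hs)]

theorem eventually_cut_contract (t : PTree d K Ξ ℝ true) : ∀ᶠ N in Filter.atTop,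
    ((polyCut β α R N t).map fun s =>
      ((polyContractBr β α R N (ofLimbs s.pruned : Branches d K Ξ ℝ false)).map fun a =>
        ((polyContract β α R N s.trunk).map fun h =>
          truncSum N (s.coef * a.1 * h.1) • outTerm β α R s.red a.2 h.2).sum).sum).sum =
    ((polyCut β α R (t.bound β α) t).map fun s =>
      ((polyContractBr β α R (PTree.bound β α (⟨s.red, 0, ofLimbs s.pruned⟩ : PTree d K Ξ ℝ false))
          (ofLimbs s.pruned : Branches d K Ξ ℝ false)).map fun a =>
        ((polyContract β α R (s.trunk.bound β α) s.trunk).map fun h =>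
          (s.coef * a.1 * h.1).eval 1 • outTerm β α R s.red a.2 h.2).sum).sum).sum := by
  let P : TreeCut (Polynomial (SMinus d β α R)) d K Ξ ℝ true → PTree d K Ξ ℝ false :=
    fun s => ⟨s.red, 0, ofLimbs s.pruned⟩
  have h1 := eventually_forall_mem (polyCut β α R (t.bound β α) t)
    (P := fun N s => (P s).bound β α ≤ N) fun q _ => Filter.eventually_ge_atTop _
  have h2 := eventually_forall_mem (polyCut β α R (t.bound β α) t)
    (P := fun N s => s.trunk.bound β α ≤ N) fun q _ => Filter.eventually_ge_atTop _
  have h3 := eventually_forall_mem (polyCut β α R (t.bound β α) t)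
    (P := fun N s => ∀ a ∈ polyContractBr β α R ((P s).bound β α) (P s).br,
      ∀ h ∈ polyContract β α R (s.trunk.bound β α) s.trunk, (s.coef * a.1 * h.1).natDegree ≤ N)
    fun s _ => eventually_forall_mem _ fun a _ => eventually_forall_mem _ fun h _ =>
      Filter.eventually_ge_atTop _
  filter_upwards [Filter.eventually_ge_atTop (t.bound β α), h1, h2, h3] with N h0 h1 h2 h3
  -- Contracting inside the pruned limbs does not change their degree, so terms of negative pruned
  -- degree still vanish in `outTerm`.
  rw [sum_polyCut β α R t h0 _ fun s hs => sum_map_eq_zero_of fun a ha => sum_map_eq_zero_of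
    fun h _ => by
      rw [outTerm_eq_zero, smul_zero]; rwa [deg_of_mem_polyContractBr β α R N _ a ha, deg_ofLimbs]]
  refine sum_map_congr fun s hs => ?_
  refine (sum_polyContractBr β α R (P s) (h1 s hs) _ fun a ha => sum_map_eq_zero_of fun h _ => by
    rw [ha, mul_zero, zero_mul, map_zero, zero_smul]).trans ?_
  refine sum_map_congr fun a ha => ?_
  rw [sum_polyContract β α R s.trunk (h2 s hs) _ fun h hh => by
    rw [hh, mul_zero, map_zero, zero_smul]]
  refine sum_map_congr fun h hh => ?_
  rw [truncSum_eq_eval (h3 s hs a ha h hh)]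

theorem deltaPlusEx_single (t : PTree d K Ξ ℝ true) :
    deltaPlusEx (d := d) β α R (Finsupp.single t 1) =
      ((closeVertex t.dec t.exdec (cuts (t.bound β α) true t.br)).map fun s =>
        (s.coef : R) • (projPos β α R ⟨s.red, 0, ofLimbs s.pruned⟩ ⊗ₜ[R]
          Finsupp.single s.trunk 1)).sum := by
  rw [deltaPlusEx, Finsupp.linearCombination_single, one_smul]

theorem deltaMinusEx_single (t : PTree d K Ξ ℝ true) :
    deltaMinusEx β α R (Finsupp.single t 1) =
      ((polyContract β α R (t.bound β α) t).map fun q =>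
        q.1.eval 1 ⊗ₜ[R] Finsupp.single q.2 (1 : R)).sum := by
  rw [deltaMinusEx, Finsupp.linearCombination_single, one_smul, contractVertex_eq_polyContract,
    mapWeight, Multiset.map_map]
  rfl

theorem tmul_natCast_smul {S M : Type*} [CommRing S] [Algebra R S] [AddCommGroup M] [Module R M]
    (x : S) (c : ℕ) (y : M) : x ⊗ₜ[R] ((c : R) • y) = (x * (c : S)) • ((1 : S) ⊗ₜ[R] y) := by
  rw [Nat.cast_smul_eq_nsmul, ← TensorProduct.smul_tmul, TensorProduct.smul_tmul', smul_eq_mul,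
    mul_one, nsmul_eq_mul, mul_comm]

theorem smul_m13_tmul {S M N : Type*} [CommRing S] [Algebra R S] [AddCommGroup M] [Module R M]
    [AddCommGroup N] [Module R N] (c : ℕ) (x z : S) (y : M) (w : N) :
    (c : R) • m13 R S M N ((x ⊗ₜ y) ⊗ₜ (z ⊗ₜ w)) =
      ((c : S) * x * z) • ((1 : S) ⊗ₜ[R] (y ⊗ₜ[R] w)) := by
  simp only [m13, LinearMap.comp_apply, LinearEquiv.coe_coe,
    TensorProduct.tensorTensorTensorComm_tmul, TensorProduct.map_tmul, LinearMap.mul'_apply,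
    LinearMap.id_apply]
  rw [Nat.cast_smul_eq_nsmul, TensorProduct.smul_tmul', TensorProduct.smul_tmul', smul_eq_mul,
    mul_one, nsmul_eq_mul, mul_assoc]

theorem smul_m13_sum_tmul_sum {S M N A H : Type*} [CommRing S] [Algebra R S] [AddCommGroup M]
    [Module R M] [AddCommGroup N] [Module R N] (c : ℕ) (s : Multiset A) (t : Multiset H)
    (x : A → S) (y : A → M) (z : H → S) (w : H → N) :
    (c : R) • m13 R S M N ((s.map fun a => x a ⊗ₜ y a).sum ⊗ₜ (t.map fun h => z h ⊗ₜ w h).sum) =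
      (s.map fun a => (t.map fun h =>
        ((c : S) * x a * z h) • ((1 : S) ⊗ₜ[R] (y a ⊗ₜ[R] w h))).sum).sum := by
  induction s using Multiset.induction_on with
  | empty => simp
  | cons a s ih =>
    rw [Multiset.map_cons, Multiset.sum_cons, Multiset.map_cons, Multiset.sum_cons,
      TensorProduct.add_tmul, map_add, smul_add, ih]
    congr 1
    rw [← TensorProduct.mk_apply, map_multiset_sum, map_multiset_sum, Multiset.smul_sum,
      Multiset.map_map, Multiset.map_map, Multiset.map_map]
    refine sum_map_congr fun h _ => ?_
    exact smul_m13_tmul R c (x a) (z h) (y a) (w h)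

theorem lTensor_deltaPlusEx_deltaMinusEx (t : PTree d K Ξ ℝ true) :
    (deltaPlusEx (d := d) β α R).lTensor (SMinus d β α R)
        (deltaMinusEx β α R (Finsupp.single t 1)) =
      ((polyContract β α R (t.bound β α) t).map fun q =>
        ((polyCut β α R (q.2.bound β α) q.2).map fun s =>
          (q.1 * s.coef).eval 1 • outTerm β α R s.red (ofLimbs s.pruned) s.trunk).sum).sum := by
  rw [deltaMinusEx_single, map_multiset_sum, Multiset.map_map]
  refine sum_map_congr fun q _ => ?_
  rw [Function.comp_apply, LinearMap.lTensor_tmul, deltaPlusEx_single]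
  have h := sum_cuts_eq β α R (q.2.bound β α) q.2 fun c n l τ =>
    (q.1.eval 1 * c) • outTerm β α R n (ofLimbs l) τ
  simp only [Polynomial.eval_mul]
  rw [← h, ← TensorProduct.mk_apply, map_multiset_sum, Multiset.map_map]
  refine sum_map_congr fun s _ => ?_
  exact tmul_natCast_smul (M := TExPlus d β α R ⊗[R] TEx d K Ξ R) R (q.1.eval 1) s.coef
    (projPos β α R ⟨s.red, 0, ofLimbs s.pruned⟩ ⊗ₜ Finsupp.single s.trunk 1)

theorem m13_deltaMinusEx_deltaPlusEx (t : PTree d K Ξ ℝ true) :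
    m13 R (SMinus d β α R) (TExPlus d β α R) (TEx d K Ξ R)
        (TensorProduct.map (deltaMinusExNonRoot β α R) (deltaMinusEx β α R)
          (deltaPlusEx β α R (Finsupp.single t 1))) =
      ((polyCut β α R (t.bound β α) t).map fun s =>
        ((polyContractBr β α R (PTree.bound β α (⟨s.red, 0, ofLimbs s.pruned⟩ : PTree d K Ξ ℝ false))
            (ofLimbs s.pruned : Branches d K Ξ ℝ false)).map fun a =>
          ((polyContract β α R (s.trunk.bound β α) s.trunk).map fun h =>
            (s.coef * a.1 * h.1).eval 1 • outTerm β α R s.red a.2 h.2).sum).sum).sum := by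
  simp only [Polynomial.eval_mul]
  have h := sum_cuts_eq β α R (t.bound β α) t fun c n l τ =>
    ((polyContractBr β α R (PTree.bound β α (⟨n, 0, ofLimbs l⟩ : PTree d K Ξ ℝ false))
        (ofLimbs l : Branches d K Ξ ℝ false)).map fun a =>
      ((polyContract β α R (τ.bound β α) τ).map fun h =>
        (c * a.1.eval 1 * h.1.eval 1) • outTerm β α R n a.2 h.2).sum).sum
  rw [← h, deltaPlusEx_single, map_multiset_sum, map_multiset_sum, Multiset.map_map,
    Multiset.map_map]
  refine sum_map_congr fun s _ => ?_
  simp only [Function.comp_apply]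
  rw [map_smul, map_smul, TensorProduct.map_tmul, deltaMinusExNonRoot_projPos, deltaMinusEx_single,
    contract_eq_polyContractBr, mapWeight, Multiset.map_map]
  exact smul_m13_sum_tmul_sum R s.coef _ _ _ _ _ _

end Final

end PlanarRS

theorem mainTheorem4 {d : ℕ} {K Ξ : Type} (β : K → ℝ) (α : Ξ → ℝ) (R : Type*) [CommRing R] :
    (PlanarRS.deltaPlusEx (d := d) β α R).lTensor (PlanarRS.SMinus d β α R) ∘ₗ
        PlanarRS.deltaMinusEx β α R =
      PlanarRS.m13 R (PlanarRS.SMinus d β α R) (PlanarRS.TExPlus d β α R) (PlanarRS.TEx d K Ξ R) ∘ₗ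
        TensorProduct.map (PlanarRS.deltaMinusExNonRoot β α R) (PlanarRS.deltaMinusEx β α R) ∘ₗ
          PlanarRS.deltaPlusEx β α R := by
  refine Finsupp.lhom_ext' fun t => LinearMap.ext_ring ?_
  simp only [LinearMap.comp_apply, Finsupp.lsingle_apply]
  rw [PlanarRS.lTensor_deltaPlusEx_deltaMinusEx, PlanarRS.m13_deltaMinusEx_deltaPlusEx]
  -- One truncation order is chosen that is large enough for both sides.
  obtain ⟨N, h1, h2⟩ := ((PlanarRS.eventually_contract_cut (d := d) β α R t).and
    (PlanarRS.eventually_cut_contract β α R t)).exists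
  rw [← h1, ← h2]
  exact PlanarRS.sum_contract_cut_trunc (PlanarRS.polyNeg β α R) (PlanarRS.PTree.degPlus β α) N
    (PlanarRS.outTerm β α R) t
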